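/- Let $n>2$ be an integer and let $\frac{n-1}{2}<\alpha<n$. For complex-valued $f$ on $\mathbb R^n$ put $$(K^\alpha f)(x)=\int_{\mathbb R^n}\frac{e^{i|y|}}{|y|^{n-\alpha}}\,f(x-y)\,dy .$$ In the unit square $[0,1]\times[0,1]$ consider the points $$P=\Big(\tfrac{4\alpha-n+3}{2n+2},\tfrac12\Big),\qquad P'=\Big(\tfrac12,\tfrac{3n-4\alpha-1}{2n+2}\Big),$$ $$B=\Big(1-\tfrac{(n-1)(n-\alpha)}{n(n+1)},\,1-\tfrac{\alpha}{n}\Big),\qquad B'=\Big(\tfrac{\alpha}{n},\,\tfrac{(n-1)(n-\alpha)}{n(n+1)}\Big),$$ and write $(P'P)$ and $(B'B)$ for the open segments joining them. Let $1\le p,q\le\infty$ be such that $$\Big(\tfrac1p,\tfrac1q\Big)\in (P'P)\ \text{ if } \tfrac{n-1}{2}<\alpha<\tfrac n2,\qquad \Big(\tfrac1p,\tfrac1q\Big)\in (B'B)\ \text{ if } \tfrac n2\le\alpha<n .$$ Then $K^\alpha$ is bounded from $L_p(\mathbb R^n)$ to $L_q(\mathbb R^n)$: for every $f\in L_p(\mathbb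 R^n)$ the integral defining $(K^\alpha f)(x)$ converges absolutely for almost every $x$, $K^\alpha f\in L_q(\mathbb R^n)$, and $$\|K^\alpha f\|_{q}\le C\,\|f\|_{p},$$ where the constant $C$ does not depend on $f$; if $\alpha<\frac n2$ it depends only on $n$ and $\alpha$, and if $\alpha\ge\frac n2$ it may depend on $n,\alpha,p,q$. -/

import Mathlib

open MeasureTheory
open scoped NNReal ENNReal

namespace OscillatoryPotential

noncomputable section

/-- The oscillating kernel `exp (i|y|) / |y|^(n-α)` on `ℝⁿ`. -/
def kernel (n : ℕ) (α : ℝ) (y : EuclideanSpace ℝ (Fin n)) : ℂ :=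
  Complex.exp (Complex.I * (‖y‖ : ℂ)) / ((‖y‖ ^ ((n : ℝ) - α) : ℝ) : ℂ)

/-- The oscillatory potential
`(K^α f)(x) = ∫ exp (i|y|) / |y|^(n-α) * f (x - y) dy`. -/
def K (n : ℕ) (α : ℝ) (f : EuclideanSpace ℝ (Fin n) → ℂ) (x : EuclideanSpace ℝ (Fin n)) : ℂ :=
  ∫ y, kernel n α y * f (x - y)

/-- `K^α` maps `L_p(ℝⁿ)` to `L_q(ℝⁿ)` with norm at most `C`: for every `f` in `L_p` the integral
defining `K^α f` converges absolutely almost everywhere, `K^α f` lies in `L_q`, and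
`‖K^α f‖_q ≤ C ‖f‖_p`. -/
def BoundedBy (n : ℕ) (α : ℝ) (p q : ℝ≥0∞) (C : ℝ≥0) : Prop :=
  ∀ f : EuclideanSpace ℝ (Fin n) → ℂ, MemLp f p volume →
    (∀ᵐ x, Integrable (fun y => kernel n α y * f (x - y)) volume) ∧
    MemLp (K n α f) q volume ∧
    eLpNorm (K n α f) q volume ≤ C * eLpNorm f p volume

/-- The point `(1/p, 1/q)` of the unit square (with `1/∞ = 0`); used for `1 ≤ p, q ≤ ∞`. -/
def exponentPoint (p q : ℝ≥0∞) : ℝ × ℝ := ((p⁻¹).toReal, (q⁻¹).toReal)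

/-- The point `B`. -/
def pointB (n : ℕ) (α : ℝ) : ℝ × ℝ :=
  (1 - ((n : ℝ) - 1) * (n - α) / (n * (n + 1)), 1 - α / n)

/-- The point `B'`. -/
def pointB' (n : ℕ) (α : ℝ) : ℝ × ℝ :=
  (α / n, ((n : ℝ) - 1) * (n - α) / (n * (n + 1)))

/-- The point `P`. -/
def pointP (n : ℕ) (α : ℝ) : ℝ × ℝ :=
  ((4 * α - n + 3) / (2 * n + 2), 1 / 2)

/-- The point `P'`. -/
def pointP' (n : ℕ) (α : ℝ) : ℝ × ℝ :=
  (1 / 2, (3 * n - 4 * α - 1) / (2 * n + 2))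

end

end OscillatoryPotential

/-! Put b = n - α, so that the kernel is e^{i|y|}|y|^{-b}. The estimates are proved for the bilinear
form ∬ k(x-y) f(y) g(x) dy dx on bounded functions with bounded support, in the coordinates x = 1/p
and y = 1 - 1/q. Duality and truncation then return to the operator.

The core is an L_p → L_2 bound on each line re b = (n+1)/2 - s with 0 < s < 1/2, at 1/p = 1/2 +
2s/(n+1) (`formBound_powKernel_half`). The function Γ(b) e^{i|y|}|y|^{-b} is the Mellin transform in
t of e^{-(t-i)|y|}, and for re a > 0 the Fourier transform of e^{-a|y|} is a constant times a(a² +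
ρ²)^{-(n+1)/2}, where ρ = 2π|ξ|. The range t > 1 is harmless. The range t ≤ 1 gives a multiplier
dominated by (1+ρ)^{-(n+1)/2}|ρ-1|^{-s}, whatever im b is. By Cauchy–Schwarz and Plancherel, what
remains is to integrate |f^|² against |ρ-1|^{-2s} near the sphere ρ = 1.

That weight is a superposition of indicators of annuli |ρ-1| < l. On one annulus a restriction
estimate of Stein–Tomas type holds (`annulus_bound`): the indicator is at most 10 l Im((l-i)² +
ρ²)^{-1}, and this resolvent is in turn a superposition over μ > 0 of the multipliers of
e^{-(μ+l-i)|y|}. Their forms are bounded by interpolating the trivial L_1 bound with the L_2 bound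
by the supremum of the multiplier. The outcome is a gain l^{(n+1)(1/p-1/2)}. The weight to be summed
is exactly critical for this gain, so inserting the estimate directly would diverge logarithmically.
Cutting f at a height depending on l, with Plancherel below the cut and the annulus estimate for a
smaller p above it, recovers the sum (`lintegral_annulus_le`).

If α < n/2, then n/2 < b < (n+1)/2 and the core bound is the estimate at P. Evenness of the kernel
gives P', and Riesz–Thorin covers the segment with a single constant. If α ≥ n/2, Stein
interpolation (`formBound_powKernel_of_line`) joins the lines re w = β, with β slightly above n/2,
to re w = 0, where the kernels are bounded and map L_1 to L_∞. As β decreases to n/2 the resulting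
segments exhaust the open segment (B'B). The choice of β, and hence the constant, depends on the
point. -/

namespace OscillatoryPotential

open Filter Topology Metric Set

set_option linter.unusedSectionVars false

/-! ### Test functions, norms in reciprocal exponents, and the bilinear form -/

section Nice

variable {V : Type*} [NormedAddCommGroup V] [InnerProductSpace ℝ V] [FiniteDimensional ℝ V]
  [MeasurableSpace V] [BorelSpace V]

/-- Bounded measurable functions with bounded support. -/
structure IsNice (f : V → ℂ) : Prop where
  measurable : Measurable f
  bounded : ∃ C : ℝ, ∀ x, ‖f x‖ ≤ C
  support : ∃ R : ℝ, ∀ x, R < ‖x‖ → f x = 0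

/-- The `L^(1/x)` norm, as a function of the reciprocal exponent `x`. -/
noncomputable def recipNorm (x : ℝ) (f : V → ℂ) : ℝ := (∫ y, ‖f y‖ ^ x⁻¹) ^ x

/-- The bilinear form `∬ k (x - y) f(y) g(x) dy dx`. -/
noncomputable def form (k f g : V → ℂ) : ℂ :=
  ∫ p : V × V, k (p.1 - p.2) * f p.2 * g p.1

theorem recipNorm_nonneg (x : ℝ) (f : V → ℂ) : 0 ≤ recipNorm x f := by
  unfold recipNorm; positivity

namespace IsNice

variable {f g : V → ℂ}

theorem exists_bound (hf : IsNice f) : ∃ C R : ℝ, 0 ≤ C ∧ 0 ≤ R ∧ (∀ x, ‖f x‖ ≤ C) ∧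
    ∀ x, R < ‖x‖ → f x = 0 := by
  obtain ⟨C, hC⟩ := hf.bounded
  obtain ⟨R, hR⟩ := hf.support
  exact ⟨max C 0, max R 0, le_max_right _ _, le_max_right _ _,
    fun x => (hC x).trans (le_max_left _ _), fun x hx => hR x ((le_max_left _ _).trans_lt hx)⟩

theorem of_norm_le (hf : IsNice f) (hg : Measurable g) {M : ℝ} (h : ∀ x, ‖g x‖ ≤ M * ‖f x‖) :
    IsNice g := by
  obtain ⟨C, R, hC, hR, hfC, hfR⟩ := hf.exists_bound
  refine ⟨hg, ⟨|M| * C, fun x => (h x).trans ?_⟩, ⟨R, fun x hx => ?_⟩⟩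
  · exact mul_le_mul (le_abs_self M) (hfC x) (norm_nonneg _) (abs_nonneg _)
  · have := h x
    rw [hfR x hx, norm_zero, mul_zero] at this
    exact norm_le_zero_iff.mp this

theorem const_mul (hf : IsNice f) (c : ℂ) : IsNice (fun x => c * f x) :=
  hf.of_norm_le (hf.measurable.const_mul c) (M := ‖c‖) fun _ => (norm_mul _ _).le

theorem conj (hf : IsNice f) : IsNice (fun x => (starRingEnd ℂ) (f x)) :=
  hf.of_norm_le (Complex.continuous_conj.measurable.comp hf.measurable) (M := 1)
    fun x => by simp

theorem indicator (hf : IsNice f) {s : Set V} (hs : MeasurableSet s) : IsNice (s.indicator f) :=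
  hf.of_norm_le (hf.measurable.indicator hs) (M := 1) fun x => by
    rw [one_mul]; exact norm_indicator_le_norm_self _ _

theorem integrable_norm_rpow (hf : IsNice f) {r : ℝ} (hr : 0 < r) :
    Integrable (fun x => ‖f x‖ ^ r) := by
  obtain ⟨C, R, hC, hR, hfC, hfR⟩ := hf.exists_bound
  have h : Integrable ((closedBall (0 : V) R).indicator fun _ => C ^ r) :=
    (integrable_indicator_iff measurableSet_closedBall).2
      (integrableOn_const (measure_closedBall_lt_top).ne)
  refine h.mono' (hf.measurable.norm.pow_const r).aestronglyMeasurable (ae_of_all _ fun x => ?_)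
  rw [Real.norm_of_nonneg (by positivity)]
  by_cases hx : R < ‖x‖
  · rw [hfR x hx, norm_zero, Real.zero_rpow hr.ne']
    exact indicator_nonneg (fun _ _ => by positivity) _
  · rw [indicator_of_mem (by simpa using hx)]
    exact Real.rpow_le_rpow (norm_nonneg _) (hfC x) hr.le

theorem integrable (hf : IsNice f) : Integrable f := by
  refine (integrable_norm_iff hf.measurable.aestronglyMeasurable).1 ?_
  simpa using hf.integrable_norm_rpow one_pos

theorem integrable_norm_sq (hf : IsNice f) : Integrable (fun x => ‖f x‖ ^ 2) := by
  have := hf.integrable_norm_rpow two_pos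
  simpa using this

end IsNice

theorem recipNorm_one (f : V → ℂ) : recipNorm 1 f = ∫ y, ‖f y‖ := by
  simp [recipNorm]

theorem recipNorm_half_sq (f : V → ℂ) : recipNorm (1 / 2) f ^ 2 = ∫ y, ‖f y‖ ^ 2 := by
  have h : 0 ≤ ∫ y, ‖f y‖ ^ 2 := by positivity
  simp only [recipNorm, one_div, inv_inv]
  rw [← Real.rpow_natCast, ← Real.rpow_mul (by positivity)]
  norm_num

theorem recipNorm_mono {f g : V → ℂ} {x M : ℝ} (hx : 0 < x) (hM : 0 ≤ M) (hf : IsNice f)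
    (h : ∀ y, ‖g y‖ ≤ M * ‖f y‖) : recipNorm x g ≤ M * recipNorm x f := by
  unfold recipNorm
  have h1 : (∫ y, ‖g y‖ ^ x⁻¹) ≤ M ^ x⁻¹ * ∫ y, ‖f y‖ ^ x⁻¹ := by
    rw [← integral_const_mul]
    refine integral_mono_of_nonneg (ae_of_all _ fun y => by positivity)
      ((hf.integrable_norm_rpow (by positivity)).const_mul _) (ae_of_all _ fun y => ?_)
    simp only
    rw [← Real.mul_rpow hM (norm_nonneg _)]
    exact Real.rpow_le_rpow (norm_nonneg _) (h y) (by positivity)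
  calc _ ≤ (M ^ x⁻¹ * ∫ y, ‖f y‖ ^ x⁻¹) ^ x := Real.rpow_le_rpow (by positivity) h1 hx.le
    _ = _ := by
      rw [Real.mul_rpow (by positivity) (by positivity), ← Real.rpow_mul hM,
        inv_mul_cancel₀ hx.ne', Real.rpow_one]

theorem recipNorm_conj (x : ℝ) (f : V → ℂ) :
    recipNorm x (fun y => (starRingEnd ℂ) (f y)) = recipNorm x f := by
  simp [recipNorm]

section Form

variable {k f g : V → ℂ}

/-- The supports confine `p.1 - p.2` to a ball, so `k` can be replaced by its truncation to that
ball, which is integrable. The integrand is then dominated by a convolution integrand. -/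
theorem integrable_form (hk : Measurable k) (hk' : LocallyIntegrable k) (hf : IsNice f)
    (hg : IsNice g) : Integrable (fun p : V × V => k (p.1 - p.2) * f p.2 * g p.1) := by
  obtain ⟨C, R, hC, hR, hfC, hfR⟩ := hf.exists_bound
  obtain ⟨C', R', hC', hR', hgC, hgR⟩ := hg.exists_bound
  have h1 : Integrable ((closedBall (0 : V) (R + R')).indicator k) :=
    (integrable_indicator_iff measurableSet_closedBall).2
      (hk'.integrableOn_isCompact (isCompact_closedBall _ _))
  have h2 := (hf.integrable.convolution_integrand (ContinuousLinearMap.mul ℝ ℂ) h1).norm.const_mul C'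
  refine h2.mono' ?_ (ae_of_all _ fun p => ?_)
  · exact (((hk.comp (measurable_fst.sub measurable_snd)).mul
      (hf.measurable.comp measurable_snd)).mul (hg.measurable.comp measurable_fst)).aestronglyMeasurable
  · simp only [ContinuousLinearMap.mul_apply', norm_mul]
    by_cases hx : R' < ‖p.1‖
    · rw [hgR _ hx]; simp; positivity
    by_cases hy : R < ‖p.2‖
    · rw [hfR _ hy]; simp
    rw [indicator_of_mem]
    · calc _ ≤ ‖k (p.1 - p.2)‖ * ‖f p.2‖ * C' := by gcongr; exact hgC _
        _ = _ := by ring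
    · rw [mem_closedBall_zero_iff]
      have := norm_sub_le p.1 p.2
      linarith

theorem form_comm (hk : ∀ y, k (-y) = k y) : form k f g = form k g f := by
  unfold form
  rw [Measure.volume_eq_prod, ← integral_prod_swap]
  congr 1
  ext p
  simp only [Prod.fst_swap, Prod.snd_swap]
  rw [← hk, neg_sub]
  ring

theorem norm_form_le_of_norm_le_one (hk1 : ∀ y, ‖k y‖ ≤ 1)
    (hf : IsNice f) (hg : IsNice g) :
    ‖form k f g‖ ≤ recipNorm 1 f * recipNorm 1 g := by
  rw [recipNorm_one, recipNorm_one, mul_comm]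
  unfold form
  rw [Measure.volume_eq_prod, ← integral_prod_mul]
  refine norm_integral_le_of_norm_le (hg.integrable.norm.mul_prod hf.integrable.norm)
    (ae_of_all _ fun p => ?_)
  rw [norm_mul, norm_mul]
  calc _ ≤ 1 * ‖f p.2‖ * ‖g p.1‖ := by gcongr; exact hk1 _
    _ = _ := by ring

theorem tendsto_form (hk : Measurable k) (hk' : LocallyIntegrable k) (hf : IsNice f)
    (hg : IsNice g) {F G : ℕ → V → ℂ} {M : ℝ} (hFm : ∀ m, Measurable (F m))
    (hGm : ∀ m, Measurable (G m)) (hF : ∀ m x, ‖F m x‖ ≤ M * ‖f x‖)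
    (hG : ∀ m x, ‖G m x‖ ≤ M * ‖g x‖) (hFt : ∀ x, Tendsto (fun m => F m x) atTop (𝓝 (f x)))
    (hGt : ∀ x, Tendsto (fun m => G m x) atTop (𝓝 (g x))) :
    Tendsto (fun m => form k (F m) (G m)) atTop (𝓝 (form k f g)) := by
  refine tendsto_integral_of_dominated_convergence
    (fun p => (M * M) * ‖k (p.1 - p.2) * f p.2 * g p.1‖) (fun m => ?_)
    ((integrable_form hk hk' hf hg).norm.const_mul _) (fun m => ae_of_all _ fun p => ?_)
    (ae_of_all _ fun p => ?_)
  · exact (((hk.comp (measurable_fst.sub measurable_snd)).mul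
      ((hFm m).comp measurable_snd)).mul ((hGm m).comp measurable_fst)).aestronglyMeasurable
  · rw [norm_mul, norm_mul, norm_mul, norm_mul]
    calc _ ≤ ‖k (p.1 - p.2)‖ * (M * ‖f p.2‖) * (M * ‖g p.1‖) := by
          gcongr
          · exact mul_nonneg (norm_nonneg _) ((norm_nonneg _).trans (hF m p.2))
          · exact hF m _
          · exact hG m _
      _ = _ := by ring
  · exact (tendsto_const_nhds.mul (hFt _)).mul (hGt _)

theorem form_sum (hk : Measurable k) (hk' : LocallyIntegrable k) {ι κ : Type*} (s : Finset ι)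
    (t : Finset κ) {F : ι → V → ℂ} {G : κ → V → ℂ} (hF : ∀ i ∈ s, IsNice (F i))
    (hG : ∀ j ∈ t, IsNice (G j)) (a : ι → ℂ) (b : κ → ℂ) :
    form k (fun x => ∑ i ∈ s, a i * F i x) (fun x => ∑ j ∈ t, b j * G j x) =
      ∑ i ∈ s, ∑ j ∈ t, a i * b j * form k (F i) (G j) := by
  have hint : ∀ i ∈ s, ∀ j ∈ t, Integrable (fun p : V × V =>
      a i * b j * (k (p.1 - p.2) * F i p.2 * G j p.1)) := fun i hi j hj =>
    (integrable_form hk hk' (hF i hi) (hG j hj)).const_mul _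
  calc _ = ∫ p : V × V, ∑ i ∈ s, ∑ j ∈ t, a i * b j * (k (p.1 - p.2) * F i p.2 * G j p.1) := by
        refine integral_congr_ae (ae_of_all _ fun p => ?_)
        simp only [Finset.mul_sum, Finset.sum_mul]
        rw [Finset.sum_comm]
        refine Finset.sum_congr rfl fun i _ => Finset.sum_congr rfl fun j _ => by ring
    _ = _ := by
        rw [integral_finsetSum _ fun i hi => integrable_finsetSum _ (hint i hi)]
        refine Finset.sum_congr rfl fun i hi => ?_
        rw [integral_finsetSum _ (hint i hi)]
        simp_rw [integral_const_mul]
        rfl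

end Form

end Nice

/-! ### Stein and Riesz–Thorin interpolation for convolution forms -/

section Interpolation

open Complex.HadamardThreeLines

/-- The value `a |a|^(w - 1)`, entire in `w`, of modulus `|a|^(re w)`. -/
noncomputable def twist (w a : ℂ) : ℂ := a * ((‖a‖ : ℂ) ^ (w - 1))

theorem twist_zero (w : ℂ) : twist w 0 = 0 := by simp [twist]

theorem twist_one (a : ℂ) : twist 1 a = a := by simp [twist]

theorem norm_twist {w : ℂ} (hw : w.re ≠ 0) (a : ℂ) : ‖twist w a‖ = ‖a‖ ^ w.re := by
  rcases eq_or_ne a 0 with rfl | ha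
  · simp [twist_zero, Real.zero_rpow hw]
  · have h : 0 < ‖a‖ := norm_pos_iff.mpr ha
    rw [twist, norm_mul, Complex.norm_cpow_eq_rpow_re_of_pos h, Complex.sub_re, Complex.one_re,
      Real.rpow_sub_one h.ne']
    field_simp

theorem differentiable_twist {a : ℂ} {w : ℂ → ℂ} (hw : Differentiable ℂ w) :
    Differentiable ℂ (fun z => twist (w z) a) := by
  rcases eq_or_ne a 0 with rfl | ha
  · simp [twist_zero]
  · have h : (‖a‖ : ℂ) ≠ 0 := by simpa using ha
    unfold twist
    exact ((hw.sub_const 1).const_cpow (Or.inl h)).const_mul a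

theorem measurable_twist (w : ℂ) : Measurable (twist w) := by
  unfold twist; fun_prop

variable {V : Type*} [NormedAddCommGroup V] [InnerProductSpace ℝ V] [FiniteDimensional ℝ V]
  [MeasurableSpace V] [BorelSpace V]

theorem recipNorm_twist {f : V → ℂ} {x x' : ℝ} (hx : 0 < x) (hx' : 0 < x') {w : ℂ}
    (hw : w.re = x' / x) :
    recipNorm x' (fun y => twist w (f y)) = (∫ y, ‖f y‖ ^ x⁻¹) ^ x' := by
  have h0 : w.re ≠ 0 := by rw [hw]; positivity
  simp only [recipNorm, norm_twist h0, hw]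
  congr 2
  ext y
  rw [← Real.rpow_mul (norm_nonneg _)]
  congr 1
  field_simp

theorem IsNice.twist {f : V → ℂ} (hf : IsNice f) {w : ℂ} (hw : 0 < w.re) :
    IsNice (fun y => twist w (f y)) := by
  obtain ⟨C, R, hC, hR, hfC, hfR⟩ := hf.exists_bound
  refine ⟨(measurable_twist w).comp hf.measurable, ⟨C ^ w.re, fun y => ?_⟩, ⟨R, fun y hy => ?_⟩⟩
  · rw [norm_twist hw.ne']
    exact Real.rpow_le_rpow (norm_nonneg _) (hfC y) hw.le
  · rw [hfR y hy, twist_zero]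

/-- Twisting acts value by value, so the dependence on `w` sits in finitely many scalars. The value
0 is left out because its level set is unbounded. -/
theorem simpleFunc_twist_eq_sum (f : SimpleFunc V ℂ) (w : ℂ) (y : V) :
    OscillatoryPotential.twist w (f y) = ∑ c ∈ f.range.filter (· ≠ 0),
      OscillatoryPotential.twist w c * (f ⁻¹' {c}).indicator 1 y := by
  by_cases h : f y = 0
  · rw [h, twist_zero]
    refine (Finset.sum_eq_zero fun c hc => ?_).symm
    rw [indicator_of_notMem, mul_zero]
    simp only [mem_preimage, mem_singleton_iff, h]
    exact ((Finset.mem_filter.1 hc).2).symm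
  · rw [Finset.sum_eq_single (f y)]
    · simp
    · intro c _ hc
      rw [indicator_of_notMem, mul_zero]
      simpa using hc.symm
    · intro hy
      simp [h] at hy

theorem IsNice.indicator_preimage {f : SimpleFunc V ℂ} (hf : IsNice f) {c : ℂ} (hc : c ≠ 0) :
    IsNice ((f ⁻¹' {c}).indicator (1 : V → ℂ)) := by
  refine hf.of_norm_le (measurable_one.indicator (f.measurableSet_preimage _)) (M := ‖c‖⁻¹)
    fun x => ?_
  by_cases hx : f x = c
  · rw [indicator_of_mem (by simpa using hx), hx]
    simp [hc]
  · rw [indicator_of_notMem (by simpa using hx)]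
    simp; positivity

/-- A family of kernels whose forms are analytic and bounded in the strip `0 ≤ re z ≤ 1`. -/
structure AnalyticFamily (k : ℂ → V → ℂ) : Prop where
  measurable : ∀ z, Measurable (k z)
  locallyIntegrable : ∀ z ∈ verticalClosedStrip 0 1, LocallyIntegrable (k z)
  diffContOnCl : ∀ f g, IsNice f → IsNice g →
    DiffContOnCl ℂ (fun z => form (k z) f g) (verticalStrip 0 1)
  bounded : ∀ f g, IsNice f → IsNice g →
    ∃ C, ∀ z ∈ verticalClosedStrip 0 1, ‖form (k z) f g‖ ≤ C

/-- `k` defines a form bounded by `M` on the pair of reciprocal exponents `(x, y)`. -/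
def FormBound (k : V → ℂ) (x y M : ℝ) : Prop :=
  ∀ f g, IsNice f → IsNice g → ‖form k f g‖ ≤ M * recipNorm x f * recipNorm y g

theorem diffContOnCl_sum {ι : Type*} (s : Finset ι) {F : ι → ℂ → ℂ} {D : Set ℂ}
    (h : ∀ i ∈ s, DiffContOnCl ℂ (F i) D) : DiffContOnCl ℂ (fun z => ∑ i ∈ s, F i z) D := by
  refine ⟨?_, ?_⟩
  · exact DifferentiableOn.fun_sum fun i hi => (h i hi).1
  · exact continuousOn_finsetSum s fun i hi => (h i hi).2

/-- Three lines theorem applied to the form of the twisted functions. For simple functions it is a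
finite sum of entire scalars times forms of indicators, so analyticity and boundedness in the strip
come from the family. -/
theorem interpolation_simple {k : ℂ → V → ℂ} (hk : AnalyticFamily k) {x₀ x₁ y₀ y₁ M₀ M₁ : ℝ}
    (hx₀ : 0 < x₀) (hx₁ : 0 < x₁) (hy₀ : 0 < y₀) (hy₁ : 0 < y₁)
    (h₀ : ∀ z : ℂ, z.re = 0 → FormBound (k z) x₀ y₀ M₀)
    (h₁ : ∀ z : ℂ, z.re = 1 → FormBound (k z) x₁ y₁ M₁) {θ : ℝ} (hθ₀ : 0 ≤ θ) (hθ₁ : θ ≤ 1)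
    (hM₀ : 0 ≤ M₀) (hM₁ : 0 ≤ M₁)
    {f g : SimpleFunc V ℂ} (hf : IsNice f) (hg : IsNice g) :
    ‖form (k θ) f g‖ ≤ M₀ ^ (1 - θ) * M₁ ^ θ * recipNorm ((1 - θ) * x₀ + θ * x₁) f *
      recipNorm ((1 - θ) * y₀ + θ * y₁) g := by
  have hpos : ∀ {u v : ℝ}, 0 < u → 0 < v → ∀ {t : ℝ}, 0 ≤ t → t ≤ 1 → 0 < (1 - t) * u + t * v := by
    intro u v hu hv t ht0 ht1
    rcases ht0.eq_or_lt with rfl | ht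
    · simpa using hu
    · have := mul_pos ht hv
      have := mul_nonneg (sub_nonneg.2 ht1) hu.le
      linarith
  set x := (1 - θ) * x₀ + θ * x₁ with hx
  set y := (1 - θ) * y₀ + θ * y₁ with hy
  have hxp : 0 < x := hpos hx₀ hx₁ hθ₀ hθ₁
  have hyp : 0 < y := hpos hy₀ hy₁ hθ₀ hθ₁
  -- `u` and `v` equal 1 at θ, where the twist gives back `f` and `g`. On the two boundary lines
  -- their real parts turn the norms into powers of `S` and `T` alone.
  set u : ℂ → ℂ := fun z => ((1 - z) * x₀ + z * x₁) / x with hu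
  set v : ℂ → ℂ := fun z => ((1 - z) * y₀ + z * y₁) / y with hv
  have hure : ∀ z, (u z).re = ((1 - z.re) * x₀ + z.re * x₁) / x := fun z => by
    simp [hu, Complex.div_ofReal_re]
  have hvre : ∀ z, (v z).re = ((1 - z.re) * y₀ + z.re * y₁) / y := fun z => by
    simp [hv, Complex.div_ofReal_re]
  have hud : Differentiable ℂ u := by fun_prop
  have hvd : Differentiable ℂ v := by fun_prop
  have hup : ∀ z ∈ verticalClosedStrip 0 1, 0 < (u z).re := fun z hz => by
    rw [hure]; exact div_pos (hpos hx₀ hx₁ hz.1 hz.2) hxp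
  have hvp : ∀ z ∈ verticalClosedStrip 0 1, 0 < (v z).re := fun z hz => by
    rw [hvre]; exact div_pos (hpos hy₀ hy₁ hz.1 hz.2) hyp
  set Φ : ℂ → ℂ := fun z => form (k z) (fun y => twist (u z) (f y)) (fun y => twist (v z) (g y))
    with hΦ
  set s := f.range.filter (· ≠ 0)
  set t := g.range.filter (· ≠ 0)
  have hs : ∀ c ∈ s, IsNice ((f ⁻¹' {c}).indicator (1 : V → ℂ)) := fun c hc =>
    hf.indicator_preimage (Finset.mem_filter.1 hc).2
  have ht : ∀ c ∈ t, IsNice ((g ⁻¹' {c}).indicator (1 : V → ℂ)) := fun c hc =>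
    hg.indicator_preimage (Finset.mem_filter.1 hc).2
  have hΦsum : ∀ z ∈ verticalClosedStrip 0 1, Φ z = ∑ c ∈ s, ∑ d ∈ t,
      twist (u z) c * twist (v z) d * form (k z) ((f ⁻¹' {c}).indicator (1 : V → ℂ))
        ((g ⁻¹' {d}).indicator (1 : V → ℂ)) := by
    intro z hz
    rw [← form_sum (hk.measurable z) (hk.locallyIntegrable z hz) s t hs ht]
    simp only [hΦ, simpleFunc_twist_eq_sum, s, t]
  have hcl : closure (verticalStrip 0 1) = verticalClosedStrip 0 1 := by
    rw [verticalClosedStrip, ← closure_Ioo zero_ne_one, ← Complex.closure_preimage_re]; rfl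
  have hsub : verticalStrip 0 1 ⊆ verticalClosedStrip 0 1 := hcl ▸ subset_closure
  have hΦd : DiffContOnCl ℂ Φ (verticalStrip 0 1) := by
    have h := diffContOnCl_sum (D := verticalStrip 0 1) s fun c hc => diffContOnCl_sum t fun d hd =>
      (((differentiable_twist (a := c) hud).mul (differentiable_twist (a := d) hvd)).diffContOnCl).smul
        (hk.diffContOnCl _ _ (hs c hc) (ht d hd))
    refine ⟨h.1.congr fun z hz => ?_, h.2.congr fun z hz => ?_⟩
    · exact hΦsum z (hsub hz)
    · exact hΦsum z (hcl ▸ hz)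
  have htw : ∀ {w : ℂ → ℂ} {b : ℝ} (c : ℂ),
      (∀ z ∈ verticalClosedStrip 0 1, 0 < (w z).re ∧ (w z).re ≤ b) →
      ∀ z ∈ verticalClosedStrip 0 1, ‖twist (w z) c‖ ≤ (1 + ‖c‖) ^ b := by
    intro w b c hw z hz
    rw [norm_twist (hw z hz).1.ne']
    calc _ ≤ (1 + ‖c‖) ^ (w z).re :=
          Real.rpow_le_rpow (norm_nonneg _) (by linarith) (hw z hz).1.le
      _ ≤ _ := Real.rpow_le_rpow_of_exponent_le (by linarith [norm_nonneg c]) (hw z hz).2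
  have hub : ∀ z ∈ verticalClosedStrip 0 1, 0 < (u z).re ∧ (u z).re ≤ (x₀ + x₁) / x := by
    intro z hz
    refine ⟨hup z hz, ?_⟩
    rw [hure]
    gcongr
    · nlinarith [hz.1]
    · nlinarith [hz.2]
  have hvb : ∀ z ∈ verticalClosedStrip 0 1, 0 < (v z).re ∧ (v z).re ≤ (y₀ + y₁) / y := by
    intro z hz
    refine ⟨hvp z hz, ?_⟩
    rw [hvre]
    gcongr
    · nlinarith [hz.1]
    · nlinarith [hz.2]
  have hbdd : BddAbove ((norm ∘ Φ) '' verticalClosedStrip 0 1) := by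
    choose! C hC using fun c (hc : c ∈ s) d (hd : d ∈ t) => hk.bounded _ _ (hs c hc) (ht d hd)
    refine ⟨∑ c ∈ s, ∑ d ∈ t, (1 + ‖c‖) ^ ((x₀ + x₁) / x) * (1 + ‖d‖) ^ ((y₀ + y₁) / y) * C c d, ?_⟩
    rintro _ ⟨z, hz, rfl⟩
    simp only [Function.comp, hΦsum z hz]
    refine norm_sum_le_of_le _ fun c hc => norm_sum_le_of_le _ fun d hd => ?_
    rw [norm_mul, norm_mul]
    have h1 := htw c hub z hz
    have h2 := htw d hvb z hz
    have h3 := hC c hc d hd z hz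
    gcongr
  set S := ∫ y, ‖f y‖ ^ x⁻¹ with hS
  set T := ∫ z, ‖g z‖ ^ y⁻¹ with hT
  have hS0 : 0 ≤ S := by positivity
  have hT0 : 0 ≤ T := by positivity
  have hA : ∀ z ∈ Complex.re ⁻¹' {0}, ‖Φ z‖ ≤ M₀ * S ^ x₀ * T ^ y₀ := by
    intro z hz
    have hz : z.re = 0 := hz
    have hz' : z ∈ verticalClosedStrip 0 1 := ⟨hz.ge, by simp [hz]⟩
    have := h₀ z hz _ _ (hf.twist (hup z hz')) (hg.twist (hvp z hz'))
    rwa [recipNorm_twist (x := x) hxp hx₀ (by rw [hure, hz]; simp),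
      recipNorm_twist (x := y) hyp hy₀ (by rw [hvre, hz]; simp)] at this
  have hB : ∀ z ∈ Complex.re ⁻¹' {1}, ‖Φ z‖ ≤ M₁ * S ^ x₁ * T ^ y₁ := by
    intro z hz
    have hz : z.re = 1 := hz
    have hz' : z ∈ verticalClosedStrip 0 1 := ⟨by simp [hz], hz.le⟩
    have := h₁ z hz _ _ (hf.twist (hup z hz')) (hg.twist (hvp z hz'))
    rwa [recipNorm_twist (x := x) hxp hx₁ (by rw [hure, hz]; simp),
      recipNorm_twist (x := y) hyp hy₁ (by rw [hvre, hz]; simp)] at this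
  have key := norm_le_interp_of_mem_verticalClosedStrip₀₁' Φ (z := (θ : ℂ))
    ⟨by simpa using hθ₀, by simpa using hθ₁⟩ hΦd hbdd hA hB
  have hΦθ : Φ θ = form (k θ) f g := by
    have h1 : u θ = 1 := by
      simp only [hu]
      rw [div_eq_one_iff_eq (by exact_mod_cast hxp.ne'), hx]; push_cast; rfl
    have h2 : v θ = 1 := by
      simp only [hv]
      rw [div_eq_one_iff_eq (by exact_mod_cast hyp.ne'), hy]; push_cast; rfl
    simp only [hΦ, h1, h2, twist_one]
  rw [hΦθ, Complex.ofReal_re] at key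
  refine key.trans_eq ?_
  have e1 : recipNorm x f = S ^ x := rfl
  have e2 : recipNorm y g = T ^ y := rfl
  have split : ∀ {A a b : ℝ}, 0 ≤ A → 0 < a → 0 < b →
      A ^ ((1 - θ) * a + θ * b) = (A ^ a) ^ (1 - θ) * (A ^ b) ^ θ := by
    intro A a b hA ha hb
    rw [← Real.rpow_mul hA, ← Real.rpow_mul hA, ← Real.rpow_add_of_nonneg hA
      (mul_nonneg ha.le (by linarith)) (mul_nonneg hb.le hθ₀)]
    congr 1; ring
  rw [e1, e2, hx, hy, split hS0 hx₀ hx₁, split hT0 hy₀ hy₁,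
    Real.mul_rpow (by positivity) (by positivity), Real.mul_rpow (by positivity) (by positivity),
    Real.mul_rpow (by positivity) (by positivity), Real.mul_rpow (by positivity) (by positivity)]
  ring

/-- The approximating simple functions are dominated by twice the original ones. The factor 4 is the
product of the two losses. -/
theorem FormBound.of_simple {k : V → ℂ} (hk : Measurable k) (hk' : LocallyIntegrable k)
    {x y M : ℝ} (hx : 0 < x) (hy : 0 < y) (hM : 0 ≤ M)
    (h : ∀ f g : SimpleFunc V ℂ, IsNice f → IsNice g →
      ‖form k f g‖ ≤ M * recipNorm x f * recipNorm y g) : FormBound k x y (4 * M) := by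
  intro f g hf hg
  set F : ℕ → SimpleFunc V ℂ := fun m => SimpleFunc.approxOn f hf.measurable univ 0 (mem_univ _) m
  set G : ℕ → SimpleFunc V ℂ := fun m => SimpleFunc.approxOn g hg.measurable univ 0 (mem_univ _) m
  have hF : ∀ m x, ‖F m x‖ ≤ 2 * ‖f x‖ := fun m x => by
    rw [two_mul]; exact SimpleFunc.norm_approxOn_zero_le _ _ _ _
  have hG : ∀ m x, ‖G m x‖ ≤ 2 * ‖g x‖ := fun m x => by
    rw [two_mul]; exact SimpleFunc.norm_approxOn_zero_le _ _ _ _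
  have ht := tendsto_form hk hk' hf hg (fun m => (F m).measurable) (fun m => (G m).measurable)
    hF hG (fun x => SimpleFunc.tendsto_approxOn _ _ (by simp))
    (fun x => SimpleFunc.tendsto_approxOn _ _ (by simp))
  refine le_of_tendsto ht.norm (Eventually.of_forall fun m => ?_)
  have h1 := recipNorm_mono hx zero_le_two hf (hF m)
  have h2 := recipNorm_mono hy zero_le_two hg (hG m)
  calc _ ≤ M * recipNorm x (F m) * recipNorm y (G m) :=
        h _ _ (hf.of_norm_le (F m).measurable (hF m)) (hg.of_norm_le (G m).measurable (hG m))
    _ ≤ M * (2 * recipNorm x f) * (2 * recipNorm y g) := by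
        gcongr
        · exact recipNorm_nonneg _ _
        · exact mul_nonneg hM (mul_nonneg zero_le_two (recipNorm_nonneg _ _))
    _ = _ := by ring

/-- Stein interpolation for analytic families of convolution kernels. -/
theorem interpolation {k : ℂ → V → ℂ} (hk : AnalyticFamily k) {x₀ x₁ y₀ y₁ M₀ M₁ : ℝ}
    (hx₀ : 0 < x₀) (hx₁ : 0 < x₁) (hy₀ : 0 < y₀) (hy₁ : 0 < y₁)
    (hM₀ : 0 ≤ M₀) (hM₁ : 0 ≤ M₁)
    (h₀ : ∀ z : ℂ, z.re = 0 → FormBound (k z) x₀ y₀ M₀)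
    (h₁ : ∀ z : ℂ, z.re = 1 → FormBound (k z) x₁ y₁ M₁) {θ : ℝ} (hθ₀ : 0 ≤ θ) (hθ₁ : θ ≤ 1) :
    FormBound (k θ) ((1 - θ) * x₀ + θ * x₁) ((1 - θ) * y₀ + θ * y₁)
      (4 * (M₀ ^ (1 - θ) * M₁ ^ θ)) := by
  have hpos : ∀ {u v : ℝ}, 0 < u → 0 < v → 0 < (1 - θ) * u + θ * v := by
    intro u v hu hv
    rcases hθ₀.eq_or_lt with rfl | ht
    · simpa using hu
    · have := mul_pos ht hv
      have := mul_nonneg (sub_nonneg.2 hθ₁) hu.le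
      linarith
  exact FormBound.of_simple (hk.measurable _)
    (hk.locallyIntegrable _ ⟨by simpa using hθ₀, by simpa using hθ₁⟩) (hpos hx₀ hx₁) (hpos hy₀ hy₁)
    (by positivity) fun f g hf hg => interpolation_simple hk hx₀ hx₁ hy₀ hy₁ h₀ h₁ hθ₀ hθ₁ hM₀ hM₁ hf hg

/-- Riesz–Thorin interpolation. -/
theorem FormBound.interpolate {k : V → ℂ} (hk : Measurable k) (hk' : LocallyIntegrable k)
    {x₀ x₁ y₀ y₁ M₀ M₁ : ℝ} (hx₀ : 0 < x₀) (hx₁ : 0 < x₁) (hy₀ : 0 < y₀) (hy₁ : 0 < y₁)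
    (hM₀ : 0 ≤ M₀) (hM₁ : 0 ≤ M₁) (h₀ : FormBound k x₀ y₀ M₀) (h₁ : FormBound k x₁ y₁ M₁)
    {θ : ℝ} (hθ₀ : 0 ≤ θ) (hθ₁ : θ ≤ 1) :
    FormBound k ((1 - θ) * x₀ + θ * x₁) ((1 - θ) * y₀ + θ * y₁)
      (4 * (M₀ ^ (1 - θ) * M₁ ^ θ)) :=
  interpolation (k := fun _ => k) ⟨fun _ => hk, fun _ _ => hk', fun _ _ _ _ => diffContOnCl_const,
    fun f g _ _ => ⟨‖form k f g‖, fun _ _ => le_rfl⟩⟩ hx₀ hx₁ hy₀ hy₁ hM₀ hM₁ (fun _ _ => h₀)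
    (fun _ _ => h₁) hθ₀ hθ₁

end Interpolation

/-! ### Subordination of e^{-a|r|} to Gaussians on the line -/

section Subordination

open scoped FourierTransform Real

theorem integrable_exp_neg_mul_abs {a : ℝ} (ha : 0 < a) :
    Integrable (fun t : ℝ => Complex.exp (-(a * |t| : ℝ))) := by
  have h1 : IntegrableOn (fun t : ℝ => Complex.exp (-(a * |t| : ℝ))) (Ioi 0) := by
    refine (integrableOn_exp_mul_complex_Ioi (a := -a) (by simpa using ha) 0).congr_fun
      (fun t ht => ?_) measurableSet_Ioi
    simp [abs_of_pos (mem_Ioi.1 ht)]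
  have h2 : IntegrableOn (fun t : ℝ => Complex.exp (-(a * |t| : ℝ))) (Iic 0) := by
    refine (integrableOn_exp_mul_complex_Iic (a := a) (by simpa using ha) 0).congr_fun
      (fun t ht => ?_) measurableSet_Iic
    simp [abs_of_nonpos (mem_Iic.1 ht)]
  rw [← integrableOn_univ, ← Iic_union_Ioi (a := (0 : ℝ))]
  exact h2.union h1

theorem fourier_exp_neg_mul_abs {a : ℝ} (ha : 0 < a) (s : ℝ) :
    𝓕 (fun t : ℝ => Complex.exp (-(a * |t| : ℝ))) s =
      ((2 * a / (a ^ 2 + 4 * π ^ 2 * s ^ 2) : ℝ) : ℂ) := by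
  have hint := integrable_exp_neg_mul_abs ha
  have hint' : Integrable (fun t : ℝ => Complex.exp ((-2 * π * t * s : ℝ) * Complex.I) •
      Complex.exp (-(a * |t| : ℝ))) := by
    refine hint.norm.mono' (by fun_prop) (ae_of_all _ fun t => ?_)
    rw [norm_smul, Complex.norm_exp_ofReal_mul_I, one_mul]
  rw [Real.fourier_real_eq_integral_exp_smul, ← intervalIntegral.integral_Iic_add_Ioi (b := 0)
    hint'.integrableOn hint'.integrableOn]
  have e1 : ∫ t in Iic (0 : ℝ), Complex.exp ((-2 * π * t * s : ℝ) * Complex.I) •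
      Complex.exp (-(a * |t| : ℝ)) = 1 / (a - 2 * π * s * Complex.I) := by
    rw [setIntegral_congr_fun measurableSet_Iic (g := fun t : ℝ =>
      Complex.exp ((a - 2 * π * s * Complex.I) * t))]
    · rw [integral_exp_mul_complex_Iic (by simpa using ha)]; simp
    · intro t ht
      simp only [smul_eq_mul, ← Complex.exp_add, abs_of_nonpos (mem_Iic.1 ht)]
      congr 1; push_cast; ring
  have e2 : ∫ t in Ioi (0 : ℝ), Complex.exp ((-2 * π * t * s : ℝ) * Complex.I) •
      Complex.exp (-(a * |t| : ℝ)) = 1 / (a + 2 * π * s * Complex.I) := by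
    rw [setIntegral_congr_fun measurableSet_Ioi (g := fun t : ℝ =>
      Complex.exp ((-(a + 2 * π * s * Complex.I)) * t))]
    · rw [integral_exp_mul_complex_Ioi (by simpa using ha), Complex.ofReal_zero, mul_zero,
        Complex.exp_zero, neg_div_neg_eq]
    · intro t ht
      simp only [smul_eq_mul, ← Complex.exp_add, abs_of_pos (mem_Ioi.1 ht)]
      congr 1; push_cast; ring
  rw [e1, e2]
  have n1 : (a - 2 * π * s * Complex.I : ℂ) ≠ 0 := fun h => by
    have := congrArg Complex.re h; simp at this; exact ha.ne' this
  have n2 : (a + 2 * π * s * Complex.I : ℂ) ≠ 0 := fun h => by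
    have := congrArg Complex.re h; simp at this; exact ha.ne' this
  have n3 : (a ^ 2 + 4 * π ^ 2 * s ^ 2 : ℂ) = (a - 2 * π * s * Complex.I) * (a + 2 * π * s * Complex.I) := by
    ring_nf; rw [Complex.I_sq]; ring
  push_cast
  rw [n3]
  field_simp
  ring

theorem integrable_two_mul_div {a : ℝ} (ha : 0 < a) :
    Integrable (fun s : ℝ => 2 * a / (a ^ 2 + 4 * π ^ 2 * s ^ 2)) := by
  have h := (integrable_inv_one_add_sq.comp_mul_left' (R := 2 * π / a) (by positivity)).const_mul (2 / a)
  refine h.congr (ae_of_all _ fun s => ?_)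
  simp only
  have : 0 < a ^ 2 + 4 * π ^ 2 * s ^ 2 := by positivity
  have h' : 1 + (2 * π / a * s) ^ 2 = (a ^ 2 + 4 * π ^ 2 * s ^ 2) / a ^ 2 := by field_simp; ring
  rw [h']
  field_simp

theorem exp_neg_mul_abs_eq_integral {a : ℝ} (ha : 0 < a) (r : ℝ) :
    Complex.exp (-(a * |r| : ℝ)) = ∫ s : ℝ, Complex.exp (Complex.I * (2 * π * r : ℝ) * s) *
      ((2 * a / (a ^ 2 + 4 * π ^ 2 * s ^ 2) : ℝ) : ℂ) := by
  have hc : Continuous (fun t : ℝ => Complex.exp (-(a * |t| : ℝ))) := by fun_prop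
  have hF : 𝓕 (fun t : ℝ => Complex.exp (-(a * |t| : ℝ))) =
      fun s => ((2 * a / (a ^ 2 + 4 * π ^ 2 * s ^ 2) : ℝ) : ℂ) :=
    funext fun s => fourier_exp_neg_mul_abs ha s
  have := congrFun (hc.fourierInv_fourier_eq (integrable_exp_neg_mul_abs ha)
    (by rw [hF]; exact (integrable_two_mul_div ha).ofReal)) r
  rw [← this, hF, Real.fourierInv_eq']
  refine integral_congr_ae (ae_of_all _ fun s => ?_)
  simp only [smul_eq_mul, RCLike.inner_apply, conj_trivial]
  congr 2; push_cast; ring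

theorem integral_exp_neg_mul_Ioi {c : ℝ} (hc : 0 < c) : ∫ u in Ioi (0 : ℝ), Real.exp (-(c * u)) = 1 / c := by
  have := Real.integral_rpow_mul_exp_neg_mul_Ioi one_pos hc
  simpa using this

theorem integrableOn_rpow_mul_exp {c s : ℝ} (hc : 0 < c) (hs : -1 < s) :
    IntegrableOn (fun u : ℝ => u ^ s * Real.exp (-(c * u))) (Ioi 0) := by
  have := integrableOn_rpow_mul_exp_neg_mul_rpow (s := s) (p := 1) (b := c) hs one_pos hc
  simpa using this

/-- Subordination of the exponential to Gaussians. -/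
theorem subordination {a : ℝ} (ha : 0 < a) (r : ℝ) :
    Complex.exp (-(a * |r| : ℝ)) = ∫ u in Ioi (0 : ℝ),
      ((2 * a * Real.exp (-(a ^ 2 * u)) : ℝ) : ℂ) *
        (((4 * π * u) ^ (-(1 / 2) : ℝ) * Real.exp (-r ^ 2 / (4 * u)) : ℝ) : ℂ) := by
  rw [exp_neg_mul_abs_eq_integral ha]
  -- The rational function in Fourier inversion is written as ∫ 2a e^{-(a² + 4π²s²)u} du.
  -- Integrating in `s` first leaves the Fourier integral of a Gaussian.
  set G : ℝ → ℝ → ℂ := fun s u => Complex.exp (Complex.I * (2 * π * r : ℝ) * s) *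
    ((2 * a * Real.exp (-((a ^ 2 + 4 * π ^ 2 * s ^ 2) * u)) : ℝ) : ℂ) with hG
  have hpos : ∀ s : ℝ, 0 < a ^ 2 + 4 * π ^ 2 * s ^ 2 := fun s => by positivity
  have hnorm : ∀ s u, ‖G s u‖ = 2 * a * Real.exp (-((a ^ 2 + 4 * π ^ 2 * s ^ 2) * u)) := by
    intro s u
    simp only [hG]
    rw [norm_mul, Complex.norm_real, Real.norm_of_nonneg (by positivity), mul_assoc Complex.I,
      mul_comm Complex.I, ← Complex.ofReal_mul, Complex.norm_exp_ofReal_mul_I, one_mul]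
  have h1 : ∀ s : ℝ, ∫ u in Ioi (0 : ℝ), G s u = Complex.exp (Complex.I * (2 * π * r : ℝ) * s) *
      ((2 * a / (a ^ 2 + 4 * π ^ 2 * s ^ 2) : ℝ) : ℂ) := by
    intro s
    simp only [hG]
    rw [integral_const_mul, integral_complex_ofReal, integral_const_mul,
      integral_exp_neg_mul_Ioi (hpos s)]
    congr 2; ring
  have hi : Integrable (Function.uncurry G) (volume.prod (volume.restrict (Ioi (0 : ℝ)))) := by
    rw [integrable_prod_iff (by
      apply Measurable.aestronglyMeasurable
      simp only [hG, Function.uncurry_def]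
      fun_prop)]
    constructor
    · refine ae_of_all _ fun s => ?_
      simp only [Function.uncurry, hG]
      refine Integrable.const_mul (Integrable.ofReal ?_) _
      have := integrableOn_rpow_mul_exp (s := 0) (hpos s) (by norm_num)
      simp only [Real.rpow_zero, one_mul] at this
      exact this.const_mul _
    · simp only [Function.uncurry, hnorm, integral_const_mul]
      refine (integrable_two_mul_div ha).congr (ae_of_all _ fun s => ?_)
      simp only
      rw [integral_exp_neg_mul_Ioi (hpos s)]; ring
  simp_rw [← h1]
  rw [integral_integral_swap hi]
  refine setIntegral_congr_fun measurableSet_Ioi fun u hu => ?_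
  have hu : 0 < u := hu
  have e : ∀ s : ℝ, G s u = ((2 * a * Real.exp (-(a ^ 2 * u)) : ℝ) : ℂ) *
      (Complex.exp (Complex.I * (2 * π * r : ℝ) * s) * Complex.exp (-(4 * π ^ 2 * u : ℝ) * s ^ 2)) := by
    intro s
    simp only [hG]
    have : Real.exp (-((a ^ 2 + 4 * π ^ 2 * s ^ 2) * u)) =
        Real.exp (-(a ^ 2 * u)) * Real.exp (-(4 * π ^ 2 * u) * s ^ 2) := by
      rw [← Real.exp_add]; congr 1; ring
    rw [this]; push_cast; ring
  simp only [e]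
  rw [integral_const_mul, fourierIntegral_gaussian (by rw [Complex.ofReal_re]; positivity)]
  congr 1
  have h4 : (π / (4 * π ^ 2 * u : ℝ) : ℂ) = (((4 * π * u)⁻¹ : ℝ) : ℂ) := by
    push_cast; field_simp
  rw [h4, show (1 / 2 : ℂ) = ((1 / 2 : ℝ) : ℂ) by push_cast; rfl, ← Complex.ofReal_cpow (by positivity),
    Real.inv_rpow (by positivity), ← Real.rpow_neg (by positivity)]
  push_cast
  congr 2
  field_simp
  ring

end Subordination

/-! ### The Fourier transform of e^{-a|y|} for real a -/

section Multiplier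

open scoped FourierTransform Real

variable {V : Type*} [NormedAddCommGroup V] [InnerProductSpace ℝ V] [FiniteDimensional ℝ V]
  [MeasurableSpace V] [BorelSpace V]

local notation "dim" => (Module.finrank ℝ V : ℝ)

/-- The exponential kernel `exp (-a|y|)`. -/
noncomputable def expKernel (a : ℂ) (y : V) : ℂ := Complex.exp (-(a * ‖y‖))

/-- The normalising constant of the Fourier transform of the exponential kernel. -/
noncomputable def mulConst (d : ℝ) : ℝ := 2 * (4 * π) ^ ((d - 1) / 2) * Real.Gamma ((d + 1) / 2)

/-- The Fourier transform of the exponential kernel. -/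
noncomputable def expMultiplier (a : ℂ) (ξ : V) : ℂ :=
  mulConst dim * a * (a ^ 2 + (2 * π * ‖ξ‖ : ℝ) ^ 2) ^ ((-((dim + 1) / 2) : ℝ) : ℂ)

theorem mulConst_pos {d : ℝ} (hd : 0 ≤ d) : 0 < mulConst d := by
  unfold mulConst
  have := Real.Gamma_pos_of_pos (s := (d + 1) / 2) (by linarith)
  positivity

/-- Subordination presents the kernel as a mixture of Gaussians in |x|. Each is the transform of a
Gaussian on `V`, and the remaining integral in `u` is a Gamma integral. Transforming the multiplier
rather than the kernel avoids an inversion theorem on `V`. -/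
theorem fourier_expMultiplier_of_real {a : ℝ} (ha : 0 < a) (x : V) :
    𝓕 (expMultiplier (a : ℂ) : V → ℂ) x = expKernel (a : ℂ) x := by
  set d := dim with hd
  have hd0 : 0 ≤ d := by positivity
  have hker : expKernel (a : ℂ) x = Complex.exp (-(a * |‖x‖| : ℝ)) := by
    simp [expKernel]
  rw [hker, subordination ha, Real.fourier_eq']
  -- The power (d-1)/2 of 4πu converts the Gaussian normalisation in dimension d into the
  -- one-dimensional one from subordination.
  set G : V → ℝ → ℂ := fun ξ u => Complex.exp ((-2 * π * inner ℝ ξ x : ℝ) * Complex.I) *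
    ((2 * a * (4 * π * u) ^ ((d - 1) / 2) *
      Real.exp (-((a ^ 2 + (2 * π * ‖ξ‖) ^ 2) * u)) : ℝ) : ℂ) with hG
  have hpos : ∀ ξ : V, 0 < a ^ 2 + (2 * π * ‖ξ‖) ^ 2 := fun s => by positivity
  have hgauss : ∀ u : ℝ, 0 < u →
      ∫ ξ : V, Complex.exp ((-2 * π * inner ℝ ξ x : ℝ) * Complex.I) *
        Complex.exp (-(4 * π ^ 2 * u : ℝ) * ‖ξ‖ ^ 2) =
      (((4 * π * u) ^ (-(d / 2)) * Real.exp (-‖x‖ ^ 2 / (4 * u)) : ℝ) : ℂ) := by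
    intro u hu
    have h := fourier_gaussian_innerProductSpace (V := V) (b := ((4 * π ^ 2 * u : ℝ) : ℂ))
      (by rw [Complex.ofReal_re]; positivity) x
    rw [Real.fourier_eq'] at h
    simp only [smul_eq_mul] at h
    rw [h]
    have h4 : (π / (4 * π ^ 2 * u : ℝ) : ℂ) = (((4 * π * u)⁻¹ : ℝ) : ℂ) := by
      push_cast; field_simp
    rw [h4, show (Module.finrank ℝ V / 2 : ℂ) = ((d / 2 : ℝ) : ℂ) by push_cast [hd]; rfl,
      ← Complex.ofReal_cpow (by positivity), Real.inv_rpow (by positivity),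
      ← Real.rpow_neg (by positivity)]
    push_cast
    congr 2
    field_simp
  have hinner : ∀ u : ℝ, 0 < u → ∫ ξ : V, G ξ u = ((2 * a * Real.exp (-(a ^ 2 * u)) : ℝ) : ℂ) *
        (((4 * π * u) ^ (-(1 / 2) : ℝ) * Real.exp (-|‖x‖| ^ 2 / (4 * u)) : ℝ) : ℂ) := by
    intro u hu
    have e : ∀ ξ : V, G ξ u = ((2 * a * (4 * π * u) ^ ((d - 1) / 2) * Real.exp (-(a ^ 2 * u)) : ℝ) : ℂ) *
        (Complex.exp ((-2 * π * inner ℝ ξ x : ℝ) * Complex.I) *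
        Complex.exp (-(4 * π ^ 2 * u : ℝ) * ‖ξ‖ ^ 2)) := by
      intro ξ
      have : Real.exp (-((a ^ 2 + (2 * π * ‖ξ‖) ^ 2) * u)) =
          Real.exp (-(a ^ 2 * u)) * Real.exp (-(4 * π ^ 2 * u) * ‖ξ‖ ^ 2) := by
        rw [← Real.exp_add]; congr 1; ring
      simp only [hG]
      rw [this]; push_cast; ring
    simp only [e]
    rw [integral_const_mul, hgauss u hu, ← Complex.ofReal_mul, ← Complex.ofReal_mul]
    congr 1
    have : (4 * π * u) ^ (-(1 / 2) : ℝ) = (4 * π * u) ^ ((d - 1) / 2) * (4 * π * u) ^ (-(d / 2)) := by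
      rw [← Real.rpow_add (by positivity)]; congr 1; ring
    rw [this, abs_norm]; ring
  have hnorm : ∀ ξ u, 0 < u → ‖G ξ u‖ = (2 * a * (4 * π * u) ^ ((d - 1) / 2)) *
      Real.exp (-((a ^ 2 + (2 * π * ‖ξ‖) ^ 2) * u)) := by
    intro ξ u hu
    simp only [hG]
    rw [norm_mul, Complex.norm_real, Real.norm_of_nonneg (by positivity),
      Complex.norm_exp_ofReal_mul_I, one_mul]
  have hGam : ∀ ξ : V, ∫ u in Ioi (0 : ℝ), 2 * a * (4 * π * u) ^ ((d - 1) / 2) *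
      Real.exp (-((a ^ 2 + (2 * π * ‖ξ‖) ^ 2) * u)) =
      mulConst d * a * (a ^ 2 + (2 * π * ‖ξ‖) ^ 2) ^ (-((d + 1) / 2)) := by
    intro ξ
    have h := Real.integral_rpow_mul_exp_neg_mul_Ioi (a := (d + 1) / 2) (by linarith) (hpos ξ)
    rw [setIntegral_congr_fun measurableSet_Ioi (g := fun u : ℝ => 2 * a * (4 * π) ^ ((d - 1) / 2) *
      (u ^ ((d + 1) / 2 - 1) * Real.exp (-((a ^ 2 + (2 * π * ‖ξ‖) ^ 2) * u)))), integral_const_mul, h,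
      one_div, Real.inv_rpow (hpos ξ).le, ← Real.rpow_neg (hpos ξ).le]
    · unfold mulConst; ring
    · intro u hu
      simp only
      rw [Real.mul_rpow (by positivity) (mem_Ioi.1 hu).le,
        show (d + 1) / 2 - 1 = (d - 1) / 2 by ring]
      ring
  have hm : ∀ ξ : V, ∫ u in Ioi (0 : ℝ), G ξ u =
      Complex.exp ((-2 * π * inner ℝ ξ x : ℝ) * Complex.I) * expMultiplier (a : ℂ) ξ := by
    intro ξ
    simp only [hG]
    rw [integral_const_mul, integral_complex_ofReal, hGam]
    congr 1
    unfold expMultiplier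
    rw [← Complex.ofReal_pow, ← Complex.ofReal_pow, ← Complex.ofReal_add,
      ← Complex.ofReal_cpow (hpos ξ).le]
    push_cast; rfl
  have hi : Integrable (Function.uncurry fun u ξ => G ξ u)
      ((volume.restrict (Ioi (0 : ℝ))).prod volume) := by
    rw [integrable_prod_iff (by
      apply Measurable.aestronglyMeasurable
      simp only [hG, Function.uncurry_def]
      fun_prop)]
    have hg : ∀ u : ℝ, 0 < u → Integrable (fun ξ : V => Real.exp (-(4 * π ^ 2 * u) * ‖ξ‖ ^ 2)) := by
      intro u hu
      have := (GaussianFourier.integrable_cexp_neg_mul_sq_norm_add (V := V)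
        (b := ((4 * π ^ 2 * u : ℝ) : ℂ)) (by rw [Complex.ofReal_re]; positivity) 0 0).norm
      simpa [Complex.norm_exp, ← Complex.ofReal_pow] using this
    have hn : ∀ u : ℝ, 0 < u → ∀ ξ : V, ‖G ξ u‖ =
        (2 * a * (4 * π * u) ^ ((d - 1) / 2) * Real.exp (-(a ^ 2 * u))) *
          Real.exp (-(4 * π ^ 2 * u) * ‖ξ‖ ^ 2) := by
      intro u hu ξ
      rw [hnorm ξ u hu, mul_assoc _ (Real.exp _) (Real.exp _), ← Real.exp_add]
      congr 2; ring
    constructor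
    · filter_upwards [ae_restrict_mem measurableSet_Ioi] with u hu
      refine (integrable_norm_iff ?_).1 ?_
      · apply Measurable.aestronglyMeasurable
        simp only [hG]
        fun_prop
      · simp only [Function.uncurry, hn u hu]
        exact (hg u hu).const_mul _
    · simp only [Function.uncurry]
      have h0 := (integrableOn_rpow_mul_exp (c := a ^ 2) (s := -(1 / 2)) (by positivity)
        (by norm_num)).const_mul (2 * a * (4 * π) ^ (-(1 / 2) : ℝ))
      refine IntegrableOn.congr_fun h0 (fun u hu => ?_) measurableSet_Ioi
      have hu : 0 < u := hu
      simp only [hn u hu]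
      rw [integral_const_mul]
      have h1 := GaussianFourier.integral_rexp_neg_mul_sq_norm (V := V) (b := 4 * π ^ 2 * u) (by positivity)
      rw [h1]
      have h4 : π / (4 * π ^ 2 * u) = (4 * π * u)⁻¹ := by field_simp
      rw [h4, Real.inv_rpow (by positivity), ← Real.rpow_neg (by positivity)]
      have : (4 * π * u) ^ (-(1 / 2) : ℝ) = (4 * π * u) ^ ((d - 1) / 2) * (4 * π * u) ^ (-(d / 2)) := by
        rw [← Real.rpow_add (by positivity)]; congr 1; ring
      rw [show (2 * a * (4 * π) ^ (-(1 / 2) : ℝ)) * (u ^ (-(1 / 2) : ℝ) * Real.exp (-(a ^ 2 * u))) =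
        2 * a * ((4 * π) ^ (-(1 / 2) : ℝ) * u ^ (-(1 / 2) : ℝ)) * Real.exp (-(a ^ 2 * u)) by ring,
        ← Real.mul_rpow (by positivity) hu.le, this]
      ring
  simp only [smul_eq_mul]
  simp_rw [← hm]
  rw [← integral_integral_swap hi]
  exact setIntegral_congr_fun measurableSet_Ioi fun u hu => by simpa using hinner u hu

end Multiplier

/-! ### Holomorphic dependence of integrals on a parameter -/

section Holomorphic

/-- Cauchy's estimate on small circles turns the local bound for `F` into one for its derivative, so
no derivative bound has to be assumed. -/
theorem differentiableOn_integral {α : Type*} [MeasurableSpace α] {μ : Measure α} {U : Set ℂ}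
    (hU : IsOpen U) {F : ℂ → α → ℂ} (hmeas : ∀ z ∈ U, AEStronglyMeasurable (F z) μ)
    (hdiff : ∀ᵐ x ∂μ, DifferentiableOn ℂ (F · x) U)
    (hbound : ∀ z ∈ U, ∃ s ∈ 𝓝 z, ∃ bound : α → ℝ, Integrable bound μ ∧
      ∀ᵐ x ∂μ, ∀ w ∈ s, ‖F w x‖ ≤ bound x) :
    DifferentiableOn ℂ (fun z => ∫ x, F z x ∂μ) U := by
  intro z hz
  obtain ⟨s, hs, bound, hbi, hb⟩ := hbound z hz
  obtain ⟨ε, hε, hball⟩ := Metric.mem_nhds_iff.1 (inter_mem hs (hU.mem_nhds hz))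
  set r := ε / 3 with hr
  have hr0 : 0 < r := by positivity
  have hsub : ∀ w ∈ ball z r, closedBall w r ⊆ ball z ε := fun w hw y hy => by
    rw [mem_ball] at hw ⊢
    rw [mem_closedBall] at hy
    calc dist y z ≤ dist y w + dist w z := dist_triangle _ _ _
      _ < r + r := by linarith
      _ ≤ ε := by rw [hr]; linarith
  have hdat : ∀ᵐ x ∂μ, ∀ w ∈ ball z r, HasDerivAt (F · x) (deriv (F · x) w) w := by
    filter_upwards [hdiff] with x hx w hw
    have hwU : w ∈ U := (hball (hsub w hw (mem_closedBall_self hr0.le))).2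
    exact (hx.differentiableAt (hU.mem_nhds hwU)).hasDerivAt
  have hder : ∀ᵐ x ∂μ, ∀ w ∈ ball z r, ‖deriv (F · x) w‖ ≤ bound x / r := by
    filter_upwards [hdiff, hb] with x hx hbx w hw
    refine Complex.norm_deriv_le_of_forall_mem_sphere_norm_le hr0 ?_ fun y hy => ?_
    · refine (hx.mono fun y hy => ?_).diffContOnCl
      rw [closure_ball _ hr0.ne'] at hy
      exact (hball (hsub w hw hy)).2
    · exact hbx y (hball (hsub w hw (sphere_subset_closedBall hy))).1
  have hzb : z ∈ ball z r := mem_ball_self hr0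
  -- The derivative is measurable as a pointwise limit of difference quotients along the sequence
  -- `u`.
  have hm' : AEStronglyMeasurable (fun x => deriv (F · x) z) μ := by
    set u : ℕ → ℂ := fun n => ((r / 2 / (n + 1) : ℝ) : ℂ) with hu
    have hu0 : ∀ n, u n ≠ 0 := fun n => by
      simp only [hu, ne_eq, Complex.ofReal_eq_zero]; positivity
    have hut : Tendsto u atTop (𝓝[≠] 0) := by
      refine tendsto_nhdsWithin_iff.2 ⟨?_, Eventually.of_forall hu0⟩
      have : Tendsto (fun n : ℕ => r / 2 / ((n : ℝ) + 1)) atTop (𝓝 0) := by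
        have := (tendsto_one_div_add_atTop_nhds_zero_nat (𝕜 := ℝ)).const_mul (r / 2)
        simpa [div_eq_mul_inv] using this
      have := (Complex.continuous_ofReal.tendsto 0).comp this
      rwa [Complex.ofReal_zero] at this
    have huU : ∀ n, z + u n ∈ U := fun n => by
      refine (hball ?_).2
      rw [mem_ball, dist_self_add_left, hu, Complex.norm_real, Real.norm_of_nonneg (by positivity)]
      calc r / 2 / ((n : ℝ) + 1) ≤ r / 2 := div_le_self (by positivity) (by linarith [n.cast_nonneg (α := ℝ)])
        _ < ε := by rw [hr]; linarith
    refine aestronglyMeasurable_of_tendsto_ae atTop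
      (f := fun (n : ℕ) x => (u n)⁻¹ • (F (z + u n) x - F z x)) (fun n => ?_) ?_
    · exact ((hmeas _ (huU n)).sub (hmeas z hz)).const_smul ((u n)⁻¹)
    · filter_upwards [hdat] with x hx
      exact (hx z hzb).tendsto_slope_zero.comp hut
  have hint : Integrable (F z) μ :=
    hbi.mono' (hmeas z hz) (hb.mono fun x hx => hx z (mem_of_mem_nhds hs))
  exact (hasDerivAt_integral_of_dominated_loc_of_deriv_le (F' := fun w x => deriv (F · x) w)
    (ball_mem_nhds z hr0)
    (by filter_upwards [hU.mem_nhds hz] with w hw using hmeas w hw) hint hm' hder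
    (hbi.div_const r) hdat).2.differentiableAt.differentiableWithinAt

end Holomorphic

/-! ### The multiplier of e^{-a|y|} for re a > 0 -/

section ComplexMultiplier

open scoped FourierTransform Real

/-- The factorisation (a + iρ)(a - iρ). For a = t - i only the first factor degenerates, at ρ = 1.
-/
theorem norm_sq_add_sq (a : ℂ) (ρ : ℝ) :
    ‖a ^ 2 + (ρ : ℂ) ^ 2‖ = ‖a + ρ * Complex.I‖ * ‖a - ρ * Complex.I‖ := by
  rw [← norm_mul]; congr 1; ring_nf; rw [Complex.I_sq]; ring

/-- Both factors are at least `a.re`, which suffices when ρ² ≤ 4|a|². For larger ρ the term ρ²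
dominates a². -/
theorem sq_re_mul_le_norm_sq_add_sq {a : ℂ} (ha : 0 < a.re) (ρ : ℝ) :
    a.re ^ 2 * (1 + ρ ^ 2) ≤ (1 + 4 * ‖a‖ ^ 2) * ‖a ^ 2 + (ρ : ℂ) ^ 2‖ := by
  have h1 : a.re ≤ ‖a + ρ * Complex.I‖ := by
    simpa using Complex.re_le_norm (a + ρ * Complex.I)
  have h2 : a.re ≤ ‖a - ρ * Complex.I‖ := by
    simpa using Complex.re_le_norm (a - ρ * Complex.I)
  have h3 : a.re ^ 2 ≤ ‖a ^ 2 + (ρ : ℂ) ^ 2‖ := by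
    rw [norm_sq_add_sq, sq]; exact mul_le_mul h1 h2 ha.le (norm_nonneg _)
  have h4 : a.re ^ 2 ≤ ‖a‖ ^ 2 := pow_le_pow_left₀ ha.le (Complex.re_le_norm a) 2
  rcases le_total (ρ ^ 2) (4 * ‖a‖ ^ 2) with h | h
  · calc a.re ^ 2 * (1 + ρ ^ 2) ≤ ‖a ^ 2 + (ρ : ℂ) ^ 2‖ * (1 + 4 * ‖a‖ ^ 2) := by gcongr
      _ = _ := mul_comm _ _
  · have h5 : ρ ^ 2 - ‖a‖ ^ 2 ≤ ‖a ^ 2 + (ρ : ℂ) ^ 2‖ := by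
      have := norm_sub_norm_le ((ρ : ℂ) ^ 2) (-(a ^ 2))
      rw [norm_neg, norm_pow, norm_pow, Complex.norm_real, Real.norm_eq_abs, sq_abs,
        sub_neg_eq_add, add_comm] at this
      linarith
    nlinarith [sq_nonneg ‖a‖, sq_nonneg ρ]

/-- This keeps the base of the complex power off the branch cut, so the multiplier is holomorphic in
`a` on the right half-plane. -/
theorem sq_add_sq_mem_slitPlane {a : ℂ} (ha : 0 < a.re) (ρ : ℝ) :
    a ^ 2 + (ρ : ℂ) ^ 2 ∈ Complex.slitPlane := by
  rw [Complex.mem_slitPlane_iff]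
  simp only [sq, Complex.add_re, Complex.mul_re, Complex.ofReal_re, Complex.ofReal_im,
    Complex.add_im, Complex.mul_im]
  by_cases h : a.im = 0
  · left; rw [h]; nlinarith [mul_pos ha ha, mul_self_nonneg ρ]
  · right; ring_nf; positivity

variable {V : Type*} [NormedAddCommGroup V] [InnerProductSpace ℝ V] [FiniteDimensional ℝ V]
  [MeasurableSpace V] [BorelSpace V]

local notation "dim" => (Module.finrank ℝ V : ℝ)

theorem norm_expMultiplier (a : ℂ) (ξ : V) :
    ‖expMultiplier a ξ‖ =
      mulConst dim * ‖a‖ * ‖a ^ 2 + ((2 * π * ‖ξ‖ : ℝ) : ℂ) ^ 2‖ ^ (-((dim + 1) / 2)) := by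
  rw [expMultiplier, norm_mul, norm_mul, Complex.norm_cpow_real, Complex.norm_real,
    Real.norm_of_nonneg (mulConst_pos (by positivity)).le]

theorem measurable_expMultiplier (a : ℂ) : Measurable (expMultiplier a : V → ℂ) := by
  unfold expMultiplier; fun_prop

theorem norm_expMultiplier_le {a : ℂ} {δ A : ℝ} (hδ : 0 < δ) (ha : δ ≤ a.re) (hA : ‖a‖ ≤ A) (ξ : V) :
    ‖expMultiplier a ξ‖ ≤ mulConst dim * A * (δ ^ 2 / (1 + 4 * A ^ 2)) ^ (-((dim + 1) / 2)) *
      (1 + ‖ξ‖ ^ 2) ^ (-(dim + 1) / 2) := by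
  have hA0 : 0 ≤ A := (norm_nonneg a).trans hA
  have hc := mulConst_pos (d := dim) (by positivity)
  have h := sq_re_mul_le_norm_sq_add_sq (hδ.trans_le ha) (2 * π * ‖ξ‖)
  have h1 : δ ^ 2 / (1 + 4 * A ^ 2) * (1 + ‖ξ‖ ^ 2) ≤ ‖a ^ 2 + ((2 * π * ‖ξ‖ : ℝ) : ℂ) ^ 2‖ := by
    rw [div_mul_eq_mul_div, div_le_iff₀ (by positivity)]
    have h2 : ‖ξ‖ ^ 2 ≤ (2 * π * ‖ξ‖) ^ 2 := by
      have : 1 ≤ 2 * π := by linarith [Real.pi_gt_three]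
      gcongr
      nlinarith [norm_nonneg ξ]
    calc δ ^ 2 * (1 + ‖ξ‖ ^ 2) ≤ a.re ^ 2 * (1 + (2 * π * ‖ξ‖) ^ 2) := by gcongr
      _ ≤ _ := h
      _ ≤ (1 + 4 * A ^ 2) * ‖a ^ 2 + ((2 * π * ‖ξ‖ : ℝ) : ℂ) ^ 2‖ := by gcongr
      _ = _ := mul_comm _ _
  rw [norm_expMultiplier, neg_div, mul_assoc (mulConst dim * A), ← Real.mul_rpow (by positivity) (by positivity)]
  have h3 := Real.rpow_le_rpow_of_nonpos (z := -((dim + 1) / 2)) (by positivity) h1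
    (by have : 0 ≤ dim := by positivity
        linarith)
  gcongr

theorem integrable_expMultiplier {a : ℂ} (ha : 0 < a.re) : Integrable (expMultiplier a : V → ℂ) := by
  refine ((integrable_rpow_neg_one_add_norm_sq (μ := (volume : Measure V)) (r := dim + 1)
    (by linarith)).const_mul (mulConst dim * ‖a‖ * (a.re ^ 2 / (1 + 4 * ‖a‖ ^ 2)) ^
      (-((dim + 1) / 2)))).mono' (measurable_expMultiplier a).aestronglyMeasurable
    (ae_of_all _ fun ξ => ?_)
  exact norm_expMultiplier_le ha le_rfl le_rfl ξ

/-- Both sides are holomorphic in `a` on the right half-plane and agree at the real points 1 +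
1/(n+1), which accumulate at 1. The identity theorem does the rest. -/
theorem fourier_expMultiplier {a : ℂ} (ha : 0 < a.re) (x : V) :
    𝓕 (expMultiplier a : V → ℂ) x = expKernel a x := by
  set U : Set ℂ := {a | 0 < a.re} with hUdef
  have hU : IsOpen U := isOpen_lt continuous_const Complex.continuous_re
  have hUc : IsPreconnected U := (convex_halfSpace_re_gt 0).isPreconnected
  have h1 : DifferentiableOn ℂ (fun a => 𝓕 (expMultiplier a : V → ℂ) x) U := by
    simp only [Real.fourier_eq']
    refine differentiableOn_integral hU (fun z hz => ?_) (ae_of_all _ fun ξ => ?_) fun z hz => ?_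
    · exact (((by fun_prop : Measurable fun v : V =>
        Complex.exp ((-2 * π * inner ℝ v x : ℝ) * Complex.I))).smul
          (measurable_expMultiplier z)).aestronglyMeasurable
    · intro z hz
      refine DifferentiableAt.differentiableWithinAt ?_
      simp only [smul_eq_mul]
      refine DifferentiableAt.const_mul ?_ _
      unfold expMultiplier
      refine DifferentiableAt.mul (by fun_prop) ?_
      refine DifferentiableAt.cpow (by fun_prop) (by fun_prop) ?_
      exact sq_add_sq_mem_slitPlane hz _
    · have hz : 0 < z.re := hz
      refine ⟨{w | z.re / 2 < w.re} ∩ ball 0 (‖z‖ + 1), inter_mem ?_ ?_, _,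
        ((integrable_rpow_neg_one_add_norm_sq (μ := (volume : Measure V)) (r := dim + 1)
          (by linarith)).const_mul (mulConst dim * (‖z‖ + 1) *
            ((z.re / 2) ^ 2 / (1 + 4 * (‖z‖ + 1) ^ 2)) ^ (-((dim + 1) / 2)))),
        ae_of_all _ fun ξ w hw => ?_⟩
      · exact (isOpen_lt continuous_const Complex.continuous_re).mem_nhds (by
          change z.re / 2 < z.re; linarith)
      · exact isOpen_ball.mem_nhds (by simp)
      · rw [norm_smul, Complex.norm_exp_ofReal_mul_I, one_mul]
        refine norm_expMultiplier_le (by linarith) (le_of_lt hw.1) ?_ ξ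
        have := hw.2
        rw [mem_ball_zero_iff] at this
        exact this.le
  have h2 : DifferentiableOn ℂ (fun a => expKernel a x) U := by
    unfold expKernel
    fun_prop
  have key := (h1.analyticOnNhd hU).eqOn_of_preconnected_of_frequently_eq (h2.analyticOnNhd hU) hUc
    (z₀ := 1) (by simp [hUdef]) ?_
  · exact key ha
  · have hut : Tendsto (fun n : ℕ => 1 + ((1 / ((n : ℝ) + 1) : ℝ) : ℂ)) atTop (𝓝[≠] 1) := by
      refine tendsto_nhdsWithin_iff.2 ⟨?_, Eventually.of_forall fun n => ?_⟩
      · have := ((Complex.continuous_ofReal.tendsto 0).comp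
          (tendsto_one_div_add_atTop_nhds_zero_nat (𝕜 := ℝ))).const_add 1
        simpa using this
      · simp only [mem_compl_iff, mem_singleton_iff, add_eq_left, Complex.ofReal_eq_zero]
        positivity
    refine hut.frequently (Frequently.of_forall fun n => ?_)
    rw [show 1 + ((1 / ((n : ℝ) + 1) : ℝ) : ℂ) = ((1 + 1 / ((n : ℝ) + 1) : ℝ) : ℂ) by push_cast; rfl]
    exact fourier_expMultiplier_of_real (by positivity) x

theorem continuous_expKernel (a : ℂ) : Continuous (expKernel a : V → ℂ) := by
  unfold expKernel; fun_prop

theorem norm_expKernel (a : ℂ) (y : V) : ‖expKernel a y‖ = Real.exp (-(a.re * ‖y‖)) := by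
  simp [expKernel, Complex.norm_exp]

theorem norm_expKernel_le_one {a : ℂ} (ha : 0 ≤ a.re) (y : V) : ‖expKernel a y‖ ≤ 1 := by
  rw [norm_expKernel, Real.exp_le_one_iff]
  have := mul_nonneg ha (norm_nonneg y)
  linarith

/-- The form of the exponential kernel on the Fourier side. -/
theorem form_expKernel {a : ℂ} (ha : 0 < a.re) {f g : V → ℂ} (hf : IsNice f) (hg : IsNice g) :
    form (expKernel a) f g = ∫ ξ, expMultiplier a ξ * (𝓕⁻ f ξ * 𝓕 g ξ) := by
  have e : ∀ ξ : V, expMultiplier a ξ * (𝓕⁻ f ξ * 𝓕 g ξ) =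
      ∫ p : V × V, expMultiplier a ξ * (Complex.exp ((-2 * π * inner ℝ ξ (p.1 - p.2) : ℝ) * Complex.I)
        * (f p.2 * g p.1)) := by
    intro ξ
    rw [integral_const_mul, Real.fourierInv_eq', Real.fourier_eq', mul_comm (∫ _, _), Measure.volume_eq_prod,
      ← integral_prod_mul]
    congr 1
    refine integral_congr_ae (ae_of_all _ fun p => ?_)
    simp only [smul_eq_mul]
    rw [show ∀ A B C D : ℂ, A * B * (C * D) = (A * C) * (D * B) by intros; ring, ← Complex.exp_add]
    congr 2
    rw [inner_sub_right, real_inner_comm p.1, real_inner_comm p.2]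
    push_cast; ring
  have hi : Integrable (Function.uncurry fun (ξ : V) (p : V × V) => expMultiplier a ξ *
      (Complex.exp ((-2 * π * inner ℝ ξ (p.1 - p.2) : ℝ) * Complex.I) * (f p.2 * g p.1)))
      (volume.prod volume) := by
    have h0 : Integrable (fun p : V × V => f p.2 * g p.1) := by
      have := hg.integrable.mul_prod hf.integrable
      simp only [mul_comm (f _)]
      exact this
    refine ((integrable_expMultiplier (V := V) ha).mul_prod h0).norm.mono' ?_ (ae_of_all _ fun q => ?_)
    · apply Measurable.aestronglyMeasurable
      have h1 := measurable_expMultiplier (V := V) a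
      have h2 := hf.measurable
      have h3 := hg.measurable
      simp only [Function.uncurry_def]
      fun_prop
    · simp only [Function.uncurry, norm_mul, Complex.norm_exp_ofReal_mul_I, one_mul]
      exact le_rfl
  simp_rw [e]
  rw [integral_integral_swap hi]
  unfold form
  refine integral_congr_ae (ae_of_all _ fun p => ?_)
  simp only
  rw [← fourier_expMultiplier ha, Real.fourier_eq', mul_assoc, ← integral_mul_const]
  refine integral_congr_ae (ae_of_all _ fun ξ => ?_)
  simp only [smul_eq_mul]
  ring

end ComplexMultiplier

/-! ### Plancherel as an inequality, and form bounds for e^{-a|y|} -/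

section Plancherel

open scoped FourierTransform Real

variable {V : Type*} [NormedAddCommGroup V] [InnerProductSpace ℝ V] [FiniteDimensional ℝ V]
  [MeasurableSpace V] [BorelSpace V]

local notation "dim" => (Module.finrank ℝ V : ℝ)

theorem IsNice.continuous_fourier {f : V → ℂ} (hf : IsNice f) : Continuous (𝓕 f) :=
  VectorFourier.fourierIntegral_continuous Real.continuous_fourierChar
    (L := innerₗ V) (by exact continuous_inner) hf.integrable

theorem IsNice.continuous_fourierInv {f : V → ℂ} (hf : IsNice f) : Continuous (𝓕⁻ f) := by
  have : 𝓕⁻ f = fun ξ => 𝓕 f (-ξ) := funext fun ξ => Real.fourierInv_eq_fourier_neg f ξ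
  rw [this]
  exact hf.continuous_fourier.comp continuous_neg

theorem fourier_conj (f : V → ℂ) (ξ : V) :
    𝓕 (fun y => (starRingEnd ℂ) (f y)) ξ = (starRingEnd ℂ) (𝓕⁻ f ξ) := by
  rw [Real.fourier_eq', Real.fourierInv_eq', ← integral_conj]
  congr 1
  ext y
  simp only [smul_eq_mul, map_mul, ← Complex.exp_conj, Complex.conj_I, Complex.conj_ofReal]
  congr 2
  push_cast; ring

theorem form_expKernel_conj {a : ℂ} (ha : 0 < a.re) {f : V → ℂ} (hf : IsNice f) :
    form (expKernel a) f (fun y => (starRingEnd ℂ) (f y)) =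
      ∫ ξ, expMultiplier a ξ * ((‖𝓕⁻ f ξ‖ ^ 2 : ℝ) : ℂ) := by
  rw [form_expKernel ha hf hf.conj]
  simp only [fourier_conj, Complex.mul_conj, Complex.normSq_eq_norm_sq]

theorem integrable_exp_neg_norm : Integrable (fun y : V => Real.exp (-‖y‖)) := by
  set k := Module.finrank ℝ V + 1 with hk
  have h := (integrable_one_add_norm (μ := (volume : Measure V)) (r := (k : ℝ))
    (by rw [hk]; push_cast; linarith)).const_mul (Real.exp 1 * k.factorial)
  refine h.mono' (by fun_prop) (ae_of_all _ fun y => ?_)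
  rw [Real.norm_of_nonneg (Real.exp_pos _).le, Real.rpow_neg (by positivity), Real.rpow_natCast]
  have h1 := Real.pow_div_factorial_le_exp (x := 1 + ‖y‖) (by positivity) k
  rw [Real.exp_add, div_le_iff₀ (by positivity)] at h1
  rw [Real.exp_neg, ← div_eq_mul_inv, inv_le_comm₀ (by positivity) (by positivity), inv_div,
    div_le_iff₀ (by positivity)]
  linarith

theorem integral_exp_neg_mul_norm {a : ℝ} (ha : 0 < a) :
    ∫ y : V, Real.exp (-(a * ‖y‖)) = (a ^ Module.finrank ℝ V)⁻¹ * ∫ y : V, Real.exp (-‖y‖) := by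
  have := Measure.integral_comp_smul (volume : Measure V) (fun y => Real.exp (-‖y‖)) a
  simp only [norm_smul, Real.norm_of_nonneg ha.le, smul_eq_mul] at this
  rw [this, abs_of_pos (by positivity)]

theorem integrable_exp_neg_mul_norm {a : ℝ} (ha : 0 < a) :
    Integrable (fun y : V => Real.exp (-(a * ‖y‖))) := by
  have := (integrable_comp_smul_iff (volume : Measure V) (fun y => Real.exp (-‖y‖)) ha.ne').2
    integrable_exp_neg_norm
  simpa only [norm_smul, Real.norm_of_nonneg ha.le] using this

/-- Schur's test: |f(x)f(y)| ≤ (|f(x)|² + |f(y)|²)/2, and each half integrates by translation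
invariance. -/
theorem norm_form_conj_le {k f : V → ℂ} (hk : Integrable k) (hf : IsNice f) :
    ‖form k f (fun y => (starRingEnd ℂ) (f y))‖ ≤ (∫ y, ‖k y‖) * ∫ y, ‖f y‖ ^ 2 := by
  have hf2 := hf.integrable_norm_sq
  have i1 : Integrable (fun p : V × V => ‖f p.2‖ ^ 2 * ‖k (p.1 - p.2)‖) (volume.prod volume) :=
    hf2.convolution_integrand (ContinuousLinearMap.mul ℝ ℝ) hk.norm
  have i2 : Integrable (fun p : V × V => ‖f p.1‖ ^ 2 * ‖k (p.1 - p.2)‖) (volume.prod volume) := by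
    have := (hf2.convolution_integrand (ContinuousLinearMap.mul ℝ ℝ) hk.norm.comp_neg).swap
    simpa [Function.comp_def] using this
  have e1 : ∫ p : V × V, ‖f p.2‖ ^ 2 * ‖k (p.1 - p.2)‖ ∂(volume.prod volume) =
      (∫ y, ‖k y‖) * ∫ y, ‖f y‖ ^ 2 := by
    rw [integral_prod_symm _ i1]
    simp only [integral_const_mul]
    simp_rw [integral_sub_right_eq_self (fun y => ‖k y‖)]
    rw [integral_mul_const, mul_comm]
  have e2 : ∫ p : V × V, ‖f p.1‖ ^ 2 * ‖k (p.1 - p.2)‖ ∂(volume.prod volume) =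
      (∫ y, ‖k y‖) * ∫ y, ‖f y‖ ^ 2 := by
    rw [integral_prod _ i2]
    simp only [integral_const_mul]
    simp_rw [integral_sub_left_eq_self (fun y => ‖k y‖)]
    rw [integral_mul_const, mul_comm]
  have := norm_integral_le_of_norm_le ((i1.add i2).const_mul (1 / 2))
    (f := fun p : V × V => k (p.1 - p.2) * f p.2 * (starRingEnd ℂ) (f p.1)) (ae_of_all _ fun p => by
      simp only [norm_mul, RCLike.norm_conj, Pi.add_apply]
      nlinarith [sq_nonneg (‖f p.1‖ - ‖f p.2‖), norm_nonneg (k (p.1 - p.2)),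
        mul_nonneg (norm_nonneg (k (p.1 - p.2))) (sq_nonneg (‖f p.1‖ - ‖f p.2‖))])
  refine this.trans_eq ?_
  rw [integral_const_mul, integral_add' i1 i2, e1, e2]
  ring

variable (V) in
/-- A constant for the `L²` bound of the Fourier transform. -/
noncomputable def plancherelConst : ℝ := (∫ y : V, Real.exp (-‖y‖)) / mulConst dim

theorem plancherelConst_nonneg : 0 ≤ plancherelConst V :=
  div_nonneg (by positivity) (mulConst_pos (by positivity)).le

theorem expMultiplier_ofReal {a : ℝ} (ξ : V) : expMultiplier (a : ℂ) ξ =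
    ((mulConst dim * a * (a ^ 2 + (2 * π * ‖ξ‖) ^ 2) ^ (-((dim + 1) / 2)) : ℝ) : ℂ) := by
  rw [expMultiplier]
  push_cast [Complex.ofReal_cpow (show 0 ≤ a ^ 2 + (2 * π * ‖ξ‖) ^ 2 by positivity)]
  rfl

theorem norm_fourierInv_le (f : V → ℂ) (ξ : V) : ‖𝓕⁻ f ξ‖ ≤ ∫ y, ‖f y‖ := by
  rw [Real.fourierInv_eq_fourier_neg]
  exact VectorFourier.norm_fourierIntegral_le_integral_norm _ _ _ _ _

theorem IsNice.integrable_mul_fourierInv_sq {f : V → ℂ} (hf : IsNice f) {m : V → ℂ}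
    (hm : Integrable m) : Integrable (fun ξ => m ξ * ((‖𝓕⁻ f ξ‖ ^ 2 : ℝ) : ℂ)) := by
  refine hm.mul_bdd (c := (∫ y, ‖f y‖) ^ 2) ?_ (ae_of_all _ fun ξ => ?_)
  · have := hf.continuous_fourierInv
    fun_prop
  · rw [Complex.norm_real, Real.norm_of_nonneg (by positivity)]
    gcongr
    exact norm_fourierInv_le f ξ

/-- For the kernel e^{-a|y|}, Schur's bound is a^{-d} times a fixed integral, while a^d times its
multiplier is `mulConst` times a function tending to 1 as a → ∞. Fatou's lemma gives the claim. The
sharp constant 1 is not needed. -/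
theorem lintegral_fourierInv_sq_le {f : V → ℂ} (hf : IsNice f) :
    ∫⁻ ξ, ENNReal.ofReal (‖𝓕⁻ f ξ‖ ^ 2) ≤ ENNReal.ofReal (plancherelConst V * ∫ y, ‖f y‖ ^ 2) := by
  set c := mulConst dim with hc
  have hc0 : 0 < c := mulConst_pos (by positivity)
  set d := dim with hd
  set φ : ℕ → V → ℝ := fun m ξ => (1 + (2 * π * ‖ξ‖ / (m + 1)) ^ 2) ^ (-((d + 1) / 2)) with hφ
  have hfc := hf.continuous_fourierInv
  have hφm : ∀ (m : ℕ) (ξ : V), (((m : ℝ) + 1) ^ Module.finrank ℝ V) *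
      (c * ((m : ℝ) + 1) * (((m : ℝ) + 1) ^ 2 + (2 * π * ‖ξ‖) ^ 2) ^ (-((d + 1) / 2))) = c * φ m ξ := by
    intro m ξ
    have hm : (0 : ℝ) < m + 1 := by positivity
    have h1 : ((m : ℝ) + 1) ^ 2 + (2 * π * ‖ξ‖) ^ 2 =
        ((m : ℝ) + 1) ^ 2 * (1 + (2 * π * ‖ξ‖ / (m + 1)) ^ 2) := by field_simp
    rw [h1, Real.mul_rpow (by positivity) (by positivity), ← Real.rpow_natCast ((m : ℝ) + 1) 2,
      ← Real.rpow_mul hm.le, ← Real.rpow_natCast]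
    have h2 : ((m : ℝ) + 1) ^ d * ((m : ℝ) + 1) * ((m : ℝ) + 1) ^ (((2 : ℕ) : ℝ) * (-((d + 1) / 2))) = 1 := by
      rw [← Real.rpow_add_one hm.ne', ← Real.rpow_add hm]
      convert Real.rpow_zero _ using 2
      push_cast; ring
    calc _ = c * (((m : ℝ) + 1) ^ d * ((m : ℝ) + 1) * ((m : ℝ) + 1) ^ (((2 : ℕ) : ℝ) * (-((d + 1) / 2)))) *
          φ m ξ := by simp only [hφ, hd]; ring
      _ = _ := by rw [h2, mul_one]
  have hφ0 : ∀ m ξ, 0 ≤ φ m ξ := fun m ξ => by simp only [hφ]; positivity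
  have hbound : ∀ m : ℕ, ∫⁻ ξ, ENNReal.ofReal (φ m ξ * ‖𝓕⁻ f ξ‖ ^ 2) ≤
      ENNReal.ofReal (plancherelConst V * ∫ y, ‖f y‖ ^ 2) := by
    intro m
    have hm : (0 : ℝ) < m + 1 := by positivity
    set a : ℝ := m + 1 with ha
    have h1 := form_expKernel_conj (V := V) (a := (a : ℂ)) (by simpa using hm) hf
    have hint : Integrable (fun ξ : V => φ m ξ * ‖𝓕⁻ f ξ‖ ^ 2) := by
      have h := ((hf.integrable_mul_fourierInv_sq (integrable_expMultiplier (V := V) (a := (a : ℂ))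
        (by simpa using hm))).norm).const_mul (a ^ Module.finrank ℝ V / c)
      refine h.congr (ae_of_all _ fun ξ => ?_)
      simp only
      rw [expMultiplier_ofReal, norm_mul, Complex.norm_real, Complex.norm_real,
        Real.norm_of_nonneg (by positivity), Real.norm_of_nonneg (by positivity), ← mul_assoc,
        div_mul_eq_mul_div, hφm, mul_div_cancel_left₀ _ hc0.ne']
    have h2 : form (expKernel (a : ℂ)) f (fun y => (starRingEnd ℂ) (f y)) =
        (((a ^ Module.finrank ℝ V)⁻¹ * (c * ∫ ξ, φ m ξ * ‖𝓕⁻ f ξ‖ ^ 2) : ℝ) : ℂ) := by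
      rw [h1, ← integral_const_mul, ← integral_const_mul, ← integral_complex_ofReal]
      refine integral_congr_ae (ae_of_all _ fun ξ => ?_)
      simp only
      rw [expMultiplier_ofReal, ← Complex.ofReal_mul, ← mul_assoc c, ← hφm]
      have h0 : ∀ X Y : ℝ, (a ^ Module.finrank ℝ V)⁻¹ * (a ^ Module.finrank ℝ V * X * Y) = X * Y := by
        intro X Y; field_simp
      rw [h0]
    have h3 := norm_form_conj_le (k := expKernel (a : ℂ)) (f := f) ?_ hf
    · rw [h2, Complex.norm_real, Real.norm_of_nonneg (by
        have : 0 ≤ ∫ ξ, φ m ξ * ‖𝓕⁻ f ξ‖ ^ 2 :=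
          integral_nonneg fun ξ => mul_nonneg (hφ0 _ _) (by positivity)
        positivity)] at h3
      simp only [norm_expKernel, Complex.ofReal_re] at h3
      rw [integral_exp_neg_mul_norm hm, mul_assoc, mul_le_mul_iff_right₀ (by positivity)] at h3
      rw [← ofReal_integral_eq_lintegral_ofReal hint
        (ae_of_all _ fun ξ => mul_nonneg (hφ0 _ _) (by positivity))]
      refine ENNReal.ofReal_le_ofReal ?_
      rw [plancherelConst, div_mul_eq_mul_div, le_div_iff₀ hc0]
      linarith
    · refine (integrable_norm_iff (continuous_expKernel _).aestronglyMeasurable).1 ?_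
      simp only [norm_expKernel, Complex.ofReal_re]
      exact integrable_exp_neg_mul_norm hm
  have hlim : ∀ ξ : V, Tendsto (fun m : ℕ => ENNReal.ofReal (φ m ξ * ‖𝓕⁻ f ξ‖ ^ 2)) atTop
      (𝓝 (ENNReal.ofReal (‖𝓕⁻ f ξ‖ ^ 2))) := by
    intro ξ
    refine ENNReal.tendsto_ofReal ?_
    have h1 : Tendsto (fun m : ℕ => 2 * π * ‖ξ‖ / ((m : ℝ) + 1)) atTop (𝓝 0) := by
      have := (tendsto_one_div_add_atTop_nhds_zero_nat (𝕜 := ℝ)).const_mul (2 * π * ‖ξ‖)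
      simpa [div_eq_mul_inv] using this
    have h2 : Tendsto (fun m : ℕ => φ m ξ) atTop (𝓝 1) := by
      have h3 : Tendsto (fun m : ℕ => 1 + (2 * π * ‖ξ‖ / ((m : ℝ) + 1)) ^ 2) atTop (𝓝 1) := by
        simpa using (h1.pow 2).const_add 1
      have := h3.rpow_const (p := -((d + 1) / 2)) (Or.inl one_ne_zero)
      simpa using this
    simpa using h2.mul_const (‖𝓕⁻ f ξ‖ ^ 2)
  calc ∫⁻ ξ, ENNReal.ofReal (‖𝓕⁻ f ξ‖ ^ 2)
      = ∫⁻ ξ, liminf (fun m : ℕ => ENNReal.ofReal (φ m ξ * ‖𝓕⁻ f ξ‖ ^ 2)) atTop :=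
        lintegral_congr fun ξ => ((hlim ξ).liminf_eq).symm
    _ ≤ liminf (fun m : ℕ => ∫⁻ ξ, ENNReal.ofReal (φ m ξ * ‖𝓕⁻ f ξ‖ ^ 2)) atTop :=
        lintegral_liminf_le fun m => by
          have := hfc.measurable
          simp only [hφ]
          fun_prop
    _ ≤ _ := by
        refine (liminf_le_liminf (Eventually.of_forall hbound)).trans_eq ?_
        simp

theorem IsNice.integrable_fourierInv_sq {f : V → ℂ} (hf : IsNice f) :
    Integrable (fun ξ => ‖𝓕⁻ f ξ‖ ^ 2) := by
  refine ⟨(hf.continuous_fourierInv.norm.pow 2).aestronglyMeasurable, ?_⟩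
  rw [hasFiniteIntegral_iff_ofReal (ae_of_all _ fun ξ => by positivity)]
  exact (lintegral_fourierInv_sq_le hf).trans_lt ENNReal.ofReal_lt_top

theorem integral_fourierInv_sq_le {f : V → ℂ} (hf : IsNice f) :
    ∫ ξ, ‖𝓕⁻ f ξ‖ ^ 2 ≤ plancherelConst V * recipNorm (1 / 2) f ^ 2 := by
  rw [recipNorm_half_sq]
  refine (ENNReal.ofReal_le_ofReal_iff
    (mul_nonneg plancherelConst_nonneg (by positivity))).1 ?_
  rw [ofReal_integral_eq_lintegral_ofReal hf.integrable_fourierInv_sq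
    (ae_of_all _ fun ξ => by positivity)]
  exact lintegral_fourierInv_sq_le hf

theorem norm_fourier_eq (f : V → ℂ) (ξ : V) : ‖𝓕 f ξ‖ = ‖𝓕⁻ f (-ξ)‖ := by
  rw [Real.fourierInv_eq_fourier_neg, neg_neg]

theorem IsNice.integrable_fourier_sq {f : V → ℂ} (hf : IsNice f) :
    Integrable (fun ξ => ‖𝓕 f ξ‖ ^ 2) := by
  simp only [norm_fourier_eq]
  exact hf.integrable_fourierInv_sq.comp_neg

theorem integral_fourier_sq_le {f : V → ℂ} (hf : IsNice f) :
    ∫ ξ, ‖𝓕 f ξ‖ ^ 2 ≤ plancherelConst V * recipNorm (1 / 2) f ^ 2 := by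
  simp only [norm_fourier_eq]
  rw [integral_neg_eq_self (fun ξ => ‖𝓕⁻ f ξ‖ ^ 2)]
  exact integral_fourierInv_sq_le hf

theorem integral_mul_le_sqrt {α : Type*} [MeasurableSpace α] {μ : Measure α} {u v : α → ℝ}
    (hu0 : ∀ x, 0 ≤ u x) (hv0 : ∀ x, 0 ≤ v x) (hu : AEStronglyMeasurable u μ)
    (hv : AEStronglyMeasurable v μ)
    (hu2 : Integrable (fun x => u x ^ 2) μ) (hv2 : Integrable (fun x => v x ^ 2) μ) :
    Integrable (fun x => u x * v x) μ ∧
    ∫ x, u x * v x ∂μ ≤ √(∫ x, u x ^ 2 ∂μ) * √(∫ x, v x ^ 2 ∂μ) := by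
  have h1 : MemLp u 2 μ := (memLp_two_iff_integrable_sq hu).2 hu2
  have h2 : MemLp v 2 μ := (memLp_two_iff_integrable_sq hv).2 hv2
  refine ⟨h1.integrable_mul h2, ?_⟩
  have := integral_mul_le_Lp_mul_Lq_of_nonneg (μ := μ) Real.HolderConjugate.two_two
    (ae_of_all _ hu0) (ae_of_all _ hv0) (by simpa using h1) (by simpa using h2)
  simpa [Real.sqrt_eq_rpow] using this

/-- `L²` bound for a form given by a weight on the Fourier side. -/
theorem integral_weight_mul_le {W : V → ℝ} (hW : Measurable W) (hW0 : ∀ ξ, 0 ≤ W ξ) {f g : V → ℂ}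
    (hf : IsNice f) (hg : IsNice g) (hi : Integrable (fun ξ => W ξ ^ 2 * ‖𝓕⁻ f ξ‖ ^ 2)) :
    Integrable (fun ξ => W ξ * (‖𝓕⁻ f ξ‖ * ‖𝓕 g ξ‖)) ∧
    ∫ ξ, W ξ * (‖𝓕⁻ f ξ‖ * ‖𝓕 g ξ‖) ≤
      √(∫ ξ, W ξ ^ 2 * ‖𝓕⁻ f ξ‖ ^ 2) * (√(plancherelConst V) * recipNorm (1 / 2) g) := by
  have hfm := hf.continuous_fourierInv.measurable
  have hgm := hg.continuous_fourier.measurable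
  have h := integral_mul_le_sqrt (μ := (volume : Measure V)) (u := fun ξ => W ξ * ‖𝓕⁻ f ξ‖)
    (v := fun ξ => ‖𝓕 g ξ‖) (fun ξ => mul_nonneg (hW0 ξ) (norm_nonneg _)) (fun ξ => norm_nonneg _)
    (by fun_prop) (by fun_prop) (by simpa only [mul_pow] using hi) hg.integrable_fourier_sq
  simp only [mul_pow, mul_assoc] at h
  refine ⟨h.1, h.2.trans ?_⟩
  gcongr
  calc √(∫ ξ, ‖𝓕 g ξ‖ ^ 2) ≤ √(plancherelConst V * recipNorm (1 / 2) g ^ 2) :=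
        Real.sqrt_le_sqrt (integral_fourier_sq_le hg)
    _ = _ := by rw [Real.sqrt_mul plancherelConst_nonneg, Real.sqrt_sq (recipNorm_nonneg _ _)]

theorem formBound_half {a : ℂ} (ha : 0 < a.re) {S : ℝ} (hS : ∀ ξ : V, ‖expMultiplier a ξ‖ ≤ S) :
    FormBound (expKernel a : V → ℂ) (1 / 2) (1 / 2) (plancherelConst V * S) := by
  intro f g hf hg
  have hS0 : 0 ≤ S := (norm_nonneg _).trans (hS 0)
  have h := integral_weight_mul_le (W := fun _ => S) measurable_const (fun _ => hS0) hf hg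
    (hf.integrable_fourierInv_sq.const_mul _)
  rw [form_expKernel ha hf hg]
  calc _ ≤ ∫ ξ, S * (‖𝓕⁻ f ξ‖ * ‖𝓕 g ξ‖) := by
        refine norm_integral_le_of_norm_le h.1 (ae_of_all _ fun ξ => ?_)
        rw [norm_mul, norm_mul]
        gcongr
        exact hS ξ
    _ ≤ _ := h.2
    _ ≤ √(S ^ 2 * (plancherelConst V * recipNorm (1 / 2) f ^ 2)) *
        (√(plancherelConst V) * recipNorm (1 / 2) g) := by
        gcongr
        · exact mul_nonneg (Real.sqrt_nonneg _) (recipNorm_nonneg _ _)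
        · rw [integral_const_mul]
          gcongr
          exact integral_fourierInv_sq_le hf
    _ = (S * (√(plancherelConst V) * recipNorm (1 / 2) f)) *
        (√(plancherelConst V) * recipNorm (1 / 2) g) := by
        rw [Real.sqrt_mul (by positivity), Real.sqrt_sq hS0, Real.sqrt_mul plancherelConst_nonneg,
          Real.sqrt_sq (recipNorm_nonneg _ _)]
    _ = (√(plancherelConst V) * √(plancherelConst V)) * S * recipNorm (1 / 2) f *
          recipNorm (1 / 2) g := by ring
    _ = _ := by rw [Real.mul_self_sqrt plancherelConst_nonneg]

/-- Riesz–Thorin between the point (1,1), with constant 1 since the kernel is bounded by 1, and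
(1/2,1/2), with constant given by the supremum of the multiplier. The parameter 2x-1 leaves the
power 2-2x on the latter. -/
theorem formBound_expKernel {a : ℂ} (ha : 0 < a.re) {S : ℝ} (hS : ∀ ξ : V, ‖expMultiplier a ξ‖ ≤ S)
    {x : ℝ} (hx₀ : 1 / 2 ≤ x) (hx₁ : x ≤ 1) :
    FormBound (expKernel a : V → ℂ) x x (4 * (plancherelConst V * S) ^ (2 - 2 * x)) := by
  have h1 : FormBound (expKernel a : V → ℂ) 1 1 1 := fun f g hf hg => by
    rw [one_mul]; exact norm_form_le_of_norm_le_one (norm_expKernel_le_one ha.le) hf hg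
  have hS0 : 0 ≤ S := (norm_nonneg _).trans (hS 0)
  have h := FormBound.interpolate (continuous_expKernel a).measurable
    (continuous_expKernel a).locallyIntegrable (by norm_num) one_pos (by norm_num) one_pos
    (mul_nonneg plancherelConst_nonneg hS0) zero_le_one (formBound_half ha hS) h1
    (θ := 2 * x - 1) (by linarith) (by linarith)
  convert h using 1
  · ring
  · ring
  · rw [Real.one_rpow, mul_one]; congr 2; ring

theorem norm_expMultiplier_ofReal_le {t : ℝ} (ht : 0 < t) (ξ : V) :
    ‖expMultiplier (t : ℂ) ξ‖ ≤ mulConst dim * t ^ (-dim) := by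
  have hc := mulConst_pos (d := dim) (by positivity)
  have hd : 0 ≤ dim := by positivity
  rw [expMultiplier_ofReal, Complex.norm_real, Real.norm_of_nonneg (by positivity), mul_assoc]
  gcongr
  calc t * (t ^ 2 + (2 * π * ‖ξ‖) ^ 2) ^ (-((dim + 1) / 2)) ≤ t * (t ^ 2) ^ (-((dim + 1) / 2)) := by
        gcongr t * ?_
        refine Real.rpow_le_rpow_of_nonpos (by positivity) ?_ (by linarith)
        nlinarith [sq_nonneg (2 * π * ‖ξ‖)]
    _ = _ := by
        rw [← Real.rpow_natCast, ← Real.rpow_mul ht.le, mul_comm, ← Real.rpow_add_one ht.ne']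
        congr 1; push_cast; ring

/-- With a = t - i, the factor a + iρ is at least t, and a - iρ is at least both t and 1, hence at
least their average. -/
theorem le_norm_sq_add_sq {t ρ : ℝ} (ht : 0 < t) (hρ : 0 ≤ ρ) :
    t * ((1 + t) / 2) ≤ ‖((t : ℂ) - Complex.I) ^ 2 + (ρ : ℂ) ^ 2‖ := by
  rw [norm_sq_add_sq]
  have h1 : t ≤ ‖(t : ℂ) - Complex.I + ρ * Complex.I‖ := by
    simpa using Complex.re_le_norm ((t : ℂ) - Complex.I + ρ * Complex.I)
  have h2 : t ≤ ‖(t : ℂ) - Complex.I - ρ * Complex.I‖ := by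
    simpa using Complex.re_le_norm ((t : ℂ) - Complex.I - ρ * Complex.I)
  have h3 : 1 ≤ ‖(t : ℂ) - Complex.I - ρ * Complex.I‖ := by
    have := Complex.abs_im_le_norm ((t : ℂ) - Complex.I - ρ * Complex.I)
    simp only [Complex.sub_im, Complex.ofReal_im, Complex.I_im, Complex.mul_im, Complex.ofReal_re,
      Complex.I_re, mul_zero, mul_one, add_zero] at this
    have h4 := neg_abs_le (0 - 1 - ρ)
    linarith
  exact mul_le_mul h1 (by linarith) (by positivity) (norm_nonneg _)

theorem norm_ofReal_sub_I_le {t : ℝ} (ht : 0 < t) : ‖(t : ℂ) - Complex.I‖ ≤ 1 + t := by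
  refine (norm_sub_le _ _).trans ?_
  rw [Complex.norm_real, Complex.norm_I, Real.norm_of_nonneg ht.le, add_comm]

theorem norm_expMultiplier_sub_I_le {t : ℝ} (ht : 0 < t) (ξ : V) :
    ‖expMultiplier ((t : ℂ) - Complex.I) ξ‖ ≤
      mulConst dim * 2 ^ ((dim + 1) / 2) * (t ^ (-((dim + 1) / 2)) * (1 + t) ^ (-((dim - 1) / 2))) := by
  have hc := mulConst_pos (d := dim) (by positivity)
  have hd : 0 ≤ dim := by positivity
  rw [norm_expMultiplier]
  calc _ ≤ mulConst dim * (1 + t) * (t * ((1 + t) / 2)) ^ (-((dim + 1) / 2)) := by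
        gcongr mulConst dim * ?_ * ?_
        · exact norm_ofReal_sub_I_le ht
        · exact Real.rpow_le_rpow_of_nonpos (by positivity)
            (le_norm_sq_add_sq ht (by positivity)) (by linarith)
    _ = _ := by
        have h1 : (1 + t) ^ (-((dim - 1) / 2)) = (1 + t) * (1 + t) ^ (-((dim + 1) / 2)) := by
          rw [mul_comm, ← Real.rpow_add_one (by positivity)]; congr 1; ring
        rw [h1, Real.mul_rpow ht.le (by positivity), Real.div_rpow (by positivity) zero_le_two,
          Real.rpow_neg zero_le_two, div_inv_eq_mul]
        ring

end Plancherel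

/-! ### The resolvent as a superposition of multipliers -/

section Resolvent

open scoped FourierTransform Real

/-- The density representing the resolvent `1 / (z² + ρ²)` as a superposition of powers. -/
noncomputable def resolventDensity (κ : ℝ) (z : ℂ) (ρ μ : ℝ) : ℂ :=
  2 * ((μ + z) * ((μ + z) ^ 2 + (ρ : ℂ) ^ 2) ^ ((-(κ + 1) : ℝ) : ℂ)) *
    ((μ : ℂ) ^ 2 + 2 * z * μ) ^ ((κ - 1 : ℝ) : ℂ)

/-- With u = μ² + 2zμ, the primitive is (u/(u+A))^κ/(κA). The two powers are kept apart so that each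
base stays in the slit plane and no branch of a quotient has to be chosen. -/
theorem hasDerivAt_resolvent_primitive {κ : ℝ} (hκ : 0 < κ) {z A : ℂ} {μ : ℝ}
    (h1 : (μ : ℂ) ^ 2 + 2 * z * μ ∈ Complex.slitPlane)
    (h2 : (μ : ℂ) ^ 2 + 2 * z * μ + A ∈ Complex.slitPlane) (hA : A ≠ 0) :
    HasDerivAt (fun μ : ℝ => ((μ : ℂ) ^ 2 + 2 * z * μ) ^ (κ : ℂ) *
      ((μ : ℂ) ^ 2 + 2 * z * μ + A) ^ (-κ : ℂ) / (κ * A))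
      (2 * ((μ + z) * ((μ : ℂ) ^ 2 + 2 * z * μ + A) ^ ((-(κ + 1) : ℝ) : ℂ)) *
        ((μ : ℂ) ^ 2 + 2 * z * μ) ^ ((κ - 1 : ℝ) : ℂ)) μ := by
  have hu : HasDerivAt (fun w : ℂ => w ^ 2 + 2 * z * w) (2 * (μ + z)) (μ : ℂ) := by
    have := ((hasDerivAt_id (μ : ℂ)).pow 2).add ((hasDerivAt_id (μ : ℂ)).const_mul (2 * z))
    exact this.congr_deriv (by simp; ring)
  have hv : HasDerivAt (fun w : ℂ => w ^ 2 + 2 * z * w + A) (2 * (μ + z)) (μ : ℂ) := hu.add_const A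
  have := (((hu.cpow_const (c := (κ : ℂ)) h1).mul (hv.cpow_const (c := (-κ : ℂ)) h2)).div_const
    (κ * A)).comp_ofReal
  refine this.congr_deriv ?_
  have hκ' : (κ : ℂ) ≠ 0 := by exact_mod_cast hκ.ne'
  have e1 := Complex.cpow_sub (κ : ℂ) 1 (Complex.slitPlane_ne_zero h1)
  have e2 := Complex.cpow_sub (-κ : ℂ) 1 (Complex.slitPlane_ne_zero h2)
  have e3 : ((-(κ + 1) : ℝ) : ℂ) = -κ - 1 := by push_cast; ring
  have e4 : ((κ - 1 : ℝ) : ℂ) = κ - 1 := by push_cast; ring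
  rw [Complex.cpow_one] at e1 e2
  simp only [e3, e4, e1, e2]
  have n1 := Complex.slitPlane_ne_zero h1
  have n2 := Complex.slitPlane_ne_zero h2
  generalize ((μ : ℂ) ^ 2 + 2 * z * μ + A) ^ (-κ : ℂ) = Q
  generalize ((μ : ℂ) ^ 2 + 2 * z * μ) ^ (κ : ℂ) = P
  generalize (μ : ℂ) ^ 2 + 2 * z * μ = u at n1 n2 ⊢
  field_simp
  ring

/-- The positive factor μ² comes out of both logarithms and cancels. The remaining bases tend to 1.
-/
theorem tendsto_resolvent_primitive (κ : ℝ) (z A : ℂ) :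
    Tendsto (fun μ : ℝ => ((μ : ℂ) ^ 2 + 2 * z * μ) ^ (κ : ℂ) *
      ((μ : ℂ) ^ 2 + 2 * z * μ + A) ^ (-κ : ℂ)) atTop (𝓝 1) := by
  have hinv : Tendsto (fun μ : ℝ => (μ : ℂ)⁻¹) atTop (𝓝 0) := by
    have := (Complex.continuous_ofReal.tendsto 0).comp tendsto_inv_atTop_zero
    simpa [Function.comp_def] using this
  have hv : Tendsto (fun μ : ℝ => 1 + 2 * z * (μ : ℂ)⁻¹) atTop (𝓝 1) := by
    simpa using (hinv.const_mul (2 * z)).const_add 1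
  have hw : Tendsto (fun μ : ℝ => 1 + 2 * z * (μ : ℂ)⁻¹ + A * (μ : ℂ)⁻¹ ^ 2) atTop (𝓝 1) := by
    simpa using hv.add ((hinv.pow 2).const_mul A)
  have hlog : Tendsto (fun μ : ℝ => Complex.exp (κ * (Complex.log (1 + 2 * z * (μ : ℂ)⁻¹) -
      Complex.log (1 + 2 * z * (μ : ℂ)⁻¹ + A * (μ : ℂ)⁻¹ ^ 2)))) atTop (𝓝 1) := by
    have h := ((hv.clog (by simp)).sub (hw.clog (by simp))).const_mul (κ : ℂ)
    have := (Complex.continuous_exp.tendsto _).comp h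
    simpa [Function.comp_def] using this
  refine hlog.congr' ?_
  filter_upwards [eventually_gt_atTop 0, hv.eventually_ne one_ne_zero,
    hw.eventually_ne one_ne_zero] with μ hμ hv0 hw0
  have hμ' : (μ : ℂ) ≠ 0 := by exact_mod_cast hμ.ne'
  have hμ2 : 0 < μ ^ 2 := by positivity
  have e1 : (μ : ℂ) ^ 2 + 2 * z * μ = ((μ ^ 2 : ℝ) : ℂ) * (1 + 2 * z * (μ : ℂ)⁻¹) := by
    push_cast; field_simp
  have e2 : (μ : ℂ) ^ 2 + 2 * z * μ + A =
      ((μ ^ 2 : ℝ) : ℂ) * (1 + 2 * z * (μ : ℂ)⁻¹ + A * (μ : ℂ)⁻¹ ^ 2) := by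
    push_cast; field_simp
  have n : ((μ ^ 2 : ℝ) : ℂ) ≠ 0 := by exact_mod_cast hμ2.ne'
  rw [e2, e1, Complex.cpow_def_of_ne_zero (mul_ne_zero n hv0),
    Complex.cpow_def_of_ne_zero (mul_ne_zero n hw0), ← Complex.exp_add,
    Complex.log_ofReal_mul hμ2 hv0, Complex.log_ofReal_mul hμ2 hw0]
  congr 1
  ring

theorem add_sq_add_sq (z : ℂ) (ρ μ : ℝ) : ((μ : ℂ) + z) ^ 2 + (ρ : ℂ) ^ 2 =
    (μ : ℂ) ^ 2 + 2 * z * μ + (z ^ 2 + (ρ : ℂ) ^ 2) := by ring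

theorem norm_sq_add_two_mul_le {l μ : ℝ} (hl : 0 < l) (hl1 : l ≤ 1) (hμ : 0 < μ) :
    ‖(μ : ℂ) ^ 2 + 2 * ((l : ℂ) - Complex.I) * μ‖ ≤ 4 * ((μ + l) * (1 + μ)) := by
  rw [show (μ : ℂ) ^ 2 + 2 * ((l : ℂ) - Complex.I) * μ = μ * (μ + 2 * ((l : ℂ) - Complex.I)) by ring,
    norm_mul, Complex.norm_real, Real.norm_of_nonneg hμ.le]
  have : ‖(μ : ℂ) + 2 * ((l : ℂ) - Complex.I)‖ ≤ μ + 2 * (1 + l) := by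
    refine (norm_add_le _ _).trans ?_
    rw [norm_mul, Complex.norm_real, Real.norm_of_nonneg hμ.le, Complex.norm_ofNat]
    gcongr
    exact norm_ofReal_sub_I_le hl
  calc μ * ‖(μ : ℂ) + 2 * ((l : ℂ) - Complex.I)‖ ≤ (μ + l) * (4 * (1 + μ)) := by
        gcongr <;> linarith
    _ = _ := by ring

/-- A crude bound that serves for integrability and Fubini only. Here κ ≥ 1 makes κ-1 nonnegative,
so the upper bound for its base can be used. -/
theorem norm_resolventDensity_le {κ l ρ μ : ℝ} (hκ : 1 ≤ κ) (hl : 0 < l) (hl1 : l ≤ 1) (hρ : 0 ≤ ρ)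
    (hμ : 0 < μ) : ‖resolventDensity κ ((l : ℂ) - Complex.I) ρ μ‖ ≤
      4 * 4 ^ (κ - 1) * 2 ^ (κ + 1) * (μ + l) ^ (-2 : ℝ) := by
  have h1 := norm_sq_add_two_mul_le hl hl1 hμ
  have h2 : (μ + l) * ((1 + μ) / 2) ≤ ‖((μ : ℂ) + ((l : ℂ) - Complex.I)) ^ 2 + (ρ : ℂ) ^ 2‖ := by
    have := le_norm_sq_add_sq (t := μ + l) (ρ := ρ) (by positivity) hρ
    rw [show (μ : ℂ) + ((l : ℂ) - Complex.I) = ((μ + l : ℝ) : ℂ) - Complex.I by push_cast; ring]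
    refine le_trans ?_ this
    gcongr
    linarith
  have h3 : ‖(μ : ℂ) + ((l : ℂ) - Complex.I)‖ ≤ 2 * (1 + μ) := by
    have := norm_ofReal_sub_I_le (t := μ + l) (by positivity)
    rw [show (μ : ℂ) + ((l : ℂ) - Complex.I) = ((μ + l : ℝ) : ℂ) - Complex.I by push_cast; ring]
    linarith
  unfold resolventDensity
  rw [norm_mul, norm_mul, norm_mul, Complex.norm_cpow_real, Complex.norm_cpow_real, Complex.norm_ofNat]
  calc _ ≤ 2 * (2 * (1 + μ) * ((μ + l) * ((1 + μ) / 2)) ^ (-(κ + 1))) *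
        (4 * ((μ + l) * (1 + μ))) ^ (κ - 1) := by
        have h4 := Real.rpow_le_rpow_of_nonpos (z := -(κ + 1)) (by positivity) h2 (by linarith)
        have h5 := Real.rpow_le_rpow (z := κ - 1) (norm_nonneg _) h1 (by linarith)
        gcongr
    _ = 4 * 4 ^ (κ - 1) * 2 ^ (κ + 1) * ((μ + l) ^ (-(κ + 1)) * (μ + l) ^ (κ - 1)) *
        ((1 + μ) * (1 + μ) ^ (-(κ + 1)) * (1 + μ) ^ (κ - 1)) := by
        rw [Real.mul_rpow (by positivity) (by positivity), Real.mul_rpow (by positivity) (by positivity),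
          Real.mul_rpow (by positivity) (by positivity), Real.div_rpow (by positivity) zero_le_two,
          Real.rpow_neg zero_le_two, div_inv_eq_mul]
        ring
    _ = 4 * 4 ^ (κ - 1) * 2 ^ (κ + 1) * (μ + l) ^ (-2 : ℝ) * (1 + μ) ^ (-1 : ℝ) := by
        have h4 : (μ + l) ^ (-(κ + 1)) * (μ + l) ^ (κ - 1) = (μ + l) ^ (-2 : ℝ) := by
          rw [← Real.rpow_add (by positivity)]; congr 1; ring
        have h5 : (1 + μ) * (1 + μ) ^ (-(κ + 1)) * (1 + μ) ^ (κ - 1) = (1 + μ) ^ (-1 : ℝ) := by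
          rw [mul_comm (1 + μ), ← Real.rpow_add_one (by positivity), ← Real.rpow_add (by positivity)]
          congr 1; ring
        rw [h4, h5]
    _ ≤ _ := by
        refine mul_le_of_le_one_right (by positivity) ?_
        exact Real.rpow_le_one_of_one_le_of_nonpos (by linarith) (by norm_num)

theorem measurable_resolventDensity (κ : ℝ) (z : ℂ) :
    Measurable (fun p : ℝ × ℝ => resolventDensity κ z p.1 p.2) := by
  unfold resolventDensity; fun_prop

theorem integrableOn_add_rpow {A l : ℝ} (hA : A < -1) (hl : 0 < l) :
    IntegrableOn (fun μ : ℝ => (μ + l) ^ A) (Ioi 0) :=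
  integrableOn_add_rpow_Ioi_of_lt hA (by linarith)

theorem integral_add_rpow {A l : ℝ} (hA : A < -1) (hl : 0 < l) :
    ∫ μ in Ioi (0 : ℝ), (μ + l) ^ A = l ^ (A + 1) / (-(A + 1)) := by
  have h := integral_Ioi_rpow_of_lt hA hl
  have hm : MeasurePreserving (fun μ : ℝ => μ + l) := measurePreserving_add_right volume l
  have := hm.setIntegral_preimage_emb (MeasurableEquiv.addRight l).measurableEmbedding
    (fun t : ℝ => t ^ A) (Ioi l)
  rw [h] at this
  have hpre : (fun μ : ℝ => μ + l) ⁻¹' (Ioi l) = Ioi 0 := by ext; simp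
  rw [hpre] at this
  rw [this, neg_div, div_neg]

theorem integrableOn_resolventDensity {κ l ρ : ℝ} (hκ : 1 ≤ κ) (hl : 0 < l) (hl1 : l ≤ 1)
    (hρ : 0 ≤ ρ) : IntegrableOn (resolventDensity κ ((l : ℂ) - Complex.I) ρ) (Ioi 0) := by
  refine ((integrableOn_add_rpow (A := -2) (by norm_num) hl).const_mul
    (4 * 4 ^ (κ - 1) * 2 ^ (κ + 1))).mono' ?_ ?_
  · exact ((measurable_resolventDensity κ _).comp measurable_prodMk_left).aestronglyMeasurable
  · filter_upwards [ae_restrict_mem measurableSet_Ioi] with μ hμ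
    exact norm_resolventDensity_le hκ hl hl1 hρ hμ

theorem integral_resolventDensity {κ l ρ : ℝ} (hκ : 1 ≤ κ) (hl : 0 < l) (hl1 : l ≤ 1)
    (hρ : 0 ≤ ρ) : ∫ μ in Ioi (0 : ℝ), resolventDensity κ ((l : ℂ) - Complex.I) ρ μ =
      1 / (κ * (((l : ℂ) - Complex.I) ^ 2 + (ρ : ℂ) ^ 2)) := by
  set z : ℂ := (l : ℂ) - Complex.I with hz
  set A : ℂ := z ^ 2 + (ρ : ℂ) ^ 2 with hA
  have hκ0 : 0 < κ := by linarith
  have hzre : 0 < z.re := by simpa [hz] using hl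
  have hA0 : A ≠ 0 := Complex.slitPlane_ne_zero (sq_add_sq_mem_slitPlane hzre ρ)
  have hint := integrableOn_resolventDensity hκ hl hl1 hρ
  have hslit : ∀ μ : ℝ, 0 < μ → (μ : ℂ) ^ 2 + 2 * z * μ ∈ Complex.slitPlane := by
    intro μ hμ
    rw [Complex.mem_slitPlane_iff]
    right
    simp [hz, sq]
    exact hμ.ne'
  have hslit2 : ∀ μ : ℝ, 0 < μ → (μ : ℂ) ^ 2 + 2 * z * μ + A ∈ Complex.slitPlane := by
    intro μ hμ
    rw [hA, ← add_sq_add_sq]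
    exact sq_add_sq_mem_slitPlane (by simp [hz]; linarith) ρ
  have hcont : ContinuousWithinAt (fun μ : ℝ => ((μ : ℂ) ^ 2 + 2 * z * μ) ^ (κ : ℂ) *
      ((μ : ℂ) ^ 2 + 2 * z * μ + A) ^ (-κ : ℂ) / (κ * A)) (Ici 0) 0 := by
    refine ContinuousAt.continuousWithinAt ?_
    refine ContinuousAt.div_const (ContinuousAt.mul ?_ ?_) _
    -- At μ = 0 the base is 0, outside the slit plane, so continuity of the power is read off from
    -- its norm, which tends to 0.
    · rw [ContinuousAt, tendsto_iff_norm_sub_tendsto_zero]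
      have h0 : ((((0 : ℝ) : ℂ)) ^ 2 + 2 * z * ((0 : ℝ) : ℂ)) ^ (κ : ℂ) = 0 := by
        rw [show (((0 : ℝ) : ℂ)) ^ 2 + 2 * z * ((0 : ℝ) : ℂ) = 0 by simp,
          Complex.zero_cpow (by exact_mod_cast hκ0.ne')]
      simp only [h0, sub_zero, Complex.norm_cpow_real]
      have hc : Continuous (fun μ : ℝ => ‖(μ : ℂ) ^ 2 + 2 * z * μ‖ ^ κ) :=
        Continuous.rpow_const (by fun_prop) fun _ => Or.inr hκ0.le
      have := hc.tendsto 0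
      simpa [Real.zero_rpow hκ0.ne'] using this
    · refine ContinuousAt.cpow (by fun_prop) continuousAt_const ?_
      simpa using sq_add_sq_mem_slitPlane hzre ρ
  have key := integral_Ioi_of_hasDerivAt_of_tendsto hcont
    (fun μ hμ => hasDerivAt_resolvent_primitive hκ0 (hslit μ hμ) (hslit2 μ hμ) hA0)
    (f' := fun μ : ℝ => 2 * ((μ + z) * ((μ : ℂ) ^ 2 + 2 * z * μ + A) ^ ((-(κ + 1) : ℝ) : ℂ)) *
        ((μ : ℂ) ^ 2 + 2 * z * μ) ^ ((κ - 1 : ℝ) : ℂ))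
    (by
      unfold resolventDensity at hint
      simpa only [add_sq_add_sq, hA] using hint)
    ((tendsto_resolvent_primitive κ z A).div_const _)
  simp only [resolventDensity, add_sq_add_sq]
  rw [key]
  simp [hκ0.ne']

/-- The denominator has imaginary part -2l and, on the annulus, real part at most 4l in size. The
imaginary part of the inverse is therefore at least 2l/(20l²). -/
theorem im_resolvent_ge {l ρ : ℝ} (hl : 0 < l) (hl1 : l ≤ 1) (h : |ρ - 1| < l) :
    1 / (10 * l) ≤ (1 / (((l : ℂ) - Complex.I) ^ 2 + (ρ : ℂ) ^ 2)).im := by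
  have hre : (((l : ℂ) - Complex.I) ^ 2 + (ρ : ℂ) ^ 2).re = l ^ 2 - 1 + ρ ^ 2 := by
    simp [sq]
  have him : (((l : ℂ) - Complex.I) ^ 2 + (ρ : ℂ) ^ 2).im = -(2 * l) := by
    simp [sq]; ring
  rw [one_div, one_div, Complex.inv_im, Complex.normSq_apply, hre, him, neg_neg]
  rw [abs_lt] at h
  have h1 : (l ^ 2 - 1 + ρ ^ 2) * (l ^ 2 - 1 + ρ ^ 2) ≤ (4 * l) * (4 * l) := by
    rw [← sq, ← sq]
    apply sq_le_sq'
    · nlinarith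
    · nlinarith
  rw [inv_eq_one_div, div_le_div_iff₀ (by positivity) (by nlinarith [mul_self_nonneg (l ^ 2 - 1 + ρ ^ 2)])]
  nlinarith

theorem im_resolvent_nonneg {l : ℝ} (hl : 0 < l) (ρ : ℝ) :
    0 ≤ (1 / (((l : ℂ) - Complex.I) ^ 2 + (ρ : ℂ) ^ 2)).im := by
  have him : (((l : ℂ) - Complex.I) ^ 2 + (ρ : ℂ) ^ 2).im = -(2 * l) := by
    simp [sq]; ring
  rw [one_div, Complex.inv_im, him, neg_neg]
  exact div_nonneg (by linarith) (Complex.normSq_nonneg _)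

end Resolvent

/-! ### Restriction estimate for a thin annulus -/

section Annulus

open scoped FourierTransform Real

variable {V : Type*} [NormedAddCommGroup V] [InnerProductSpace ℝ V] [FiniteDimensional ℝ V]
  [MeasurableSpace V] [BorelSpace V]

local notation "dim" => (Module.finrank ℝ V : ℝ)

variable (V) in
/-- The annulus of width `l` around the characteristic sphere. -/
def annulus (l : ℝ) : Set V := {ξ | |2 * π * ‖ξ‖ - 1| < l}

theorem measurableSet_annulus (l : ℝ) : MeasurableSet (annulus V l) :=
  measurableSet_lt (by fun_prop) measurable_const

theorem resolventDensity_eq (z : ℂ) (ξ : V) (μ : ℝ) :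
    resolventDensity ((dim - 1) / 2) z (2 * π * ‖ξ‖) μ =
      ((2 / mulConst dim : ℝ) : ℂ) * ((μ : ℂ) ^ 2 + 2 * z * μ) ^ (((dim - 1) / 2 - 1 : ℝ) : ℂ) *
        expMultiplier (μ + z) ξ := by
  have hc : (mulConst dim : ℂ) ≠ 0 := by exact_mod_cast (mulConst_pos (d := dim) (by positivity)).ne'
  rw [resolventDensity, expMultiplier, show -((dim - 1) / 2 + 1) = -((dim + 1) / 2) by ring]
  push_cast
  field_simp

theorem measurable_resolventDensity_norm (κ : ℝ) (z : ℂ) :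
    Measurable (fun p : V × ℝ => resolventDensity κ z (2 * π * ‖p.1‖) p.2) := by
  unfold resolventDensity; fun_prop

/-- Expanding the resolvent in μ gives a superposition of the quadratic forms of e^{-(μ+l-i)|y|}.
Each is bounded by interpolation before the integration in μ, so the restriction gain comes from the
decay of the multipliers' suprema. -/
theorem norm_resolvent_integral_le (hd : 3 ≤ dim) {x : ℝ} (hx : 1 / 2 < x)
    (hx' : x < 1 / 2 + 1 / (dim + 1)) : ∃ C : ℝ, 0 ≤ C ∧ ∀ l : ℝ, 0 < l → l ≤ 1 →
    ∀ f : V → ℂ, IsNice f →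
    Integrable (fun ξ : V => 1 / ((((dim - 1) / 2 : ℝ) : ℂ) * (((l : ℂ) - Complex.I) ^ 2 +
        ((2 * π * ‖ξ‖ : ℝ) : ℂ) ^ 2)) * ((‖𝓕⁻ f ξ‖ ^ 2 : ℝ) : ℂ)) ∧
      ‖∫ ξ : V, 1 / ((((dim - 1) / 2 : ℝ) : ℂ) * (((l : ℂ) - Complex.I) ^ 2 +
        ((2 * π * ‖ξ‖ : ℝ) : ℂ) ^ 2)) * ((‖𝓕⁻ f ξ‖ ^ 2 : ℝ) : ℂ)‖ ≤
        C * l ^ (-1 + (dim + 1) * (x - 1 / 2)) * recipNorm x f ^ 2 := by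
  set d := dim with hdd
  set κ := (d - 1) / 2 with hκd
  have hκ : 1 ≤ κ := by rw [hκd]; linarith
  have hd1 : 0 < d + 1 := by linarith
  have hx1 : (d + 1) * (x - 1 / 2) < 1 := by
    have : x - 1 / 2 < 1 / (d + 1) := by linarith
    rwa [lt_div_iff₀ hd1, mul_comm] at this
  have hxle : x ≤ 1 := by
    have : (1 : ℝ) / (d + 1) ≤ 1 / 4 := one_div_le_one_div_of_le (by norm_num) (by linarith)
    linarith
  set c := mulConst d with hc
  have hc0 : 0 < c := mulConst_pos (by linarith)
  set P := plancherelConst V with hP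
  have hP0 : 0 ≤ P := plancherelConst_nonneg
  -- The power of μ + l left after interpolation: κ - 1 - (d+1)(1-x). The condition A < -1, needed
  -- for convergence with a power of `l`, is exactly the upper bound on `x`.
  set A := -2 + (d + 1) * (x - 1 / 2) with hA
  have hA1 : A < -1 := by rw [hA]; linarith
  set K := (2 / c) * (4 ^ (κ - 1) * (4 * (P * (c * 2 ^ ((d + 1) / 2))) ^ (2 - 2 * x))) with hK
  have hK0 : 0 ≤ K := by positivity
  refine ⟨K / (-(A + 1)), div_nonneg hK0 (by linarith), fun l hl hl1 f hf => ?_⟩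
  set z : ℂ := (l : ℂ) - Complex.I with hz
  set D : V → ℝ → ℂ := fun ξ μ => resolventDensity κ z (2 * π * ‖ξ‖) μ *
    ((‖𝓕⁻ f ξ‖ ^ 2 : ℝ) : ℂ) with hD
  have hDm : Measurable (Function.uncurry D) := by
    have h1 : Measurable (fun p : V × ℝ => ((‖𝓕⁻ f p.1‖ ^ 2 : ℝ) : ℂ)) := by
      have := hf.continuous_fourierInv.measurable
      fun_prop
    exact (measurable_resolventDensity_norm κ z).mul h1
  have hDint : Integrable (Function.uncurry D) (volume.prod (volume.restrict (Ioi (0 : ℝ)))) := by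
    have h1 := (hf.integrable_fourierInv_sq.mul_prod
      (integrableOn_add_rpow (A := -2) (by norm_num) hl)).const_mul (4 * 4 ^ (κ - 1) * 2 ^ (κ + 1))
    refine h1.mono' hDm.aestronglyMeasurable ?_
    have : ∀ᵐ p ∂((volume : Measure V).prod (volume.restrict (Ioi (0 : ℝ)))), p.2 ∈ Ioi (0 : ℝ) :=
      Measure.quasiMeasurePreserving_snd.ae (ae_restrict_mem measurableSet_Ioi)
    filter_upwards [this] with p hp
    have h2 := norm_resolventDensity_le (κ := κ) (ρ := 2 * π * ‖p.1‖) hκ hl hl1 (by positivity) hp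
    simp only [Function.uncurry, hD, norm_mul, Complex.norm_real,
      Real.norm_of_nonneg (sq_nonneg ‖𝓕⁻ f p.1‖)]
    calc _ ≤ (4 * 4 ^ (κ - 1) * 2 ^ (κ + 1) * (p.2 + l) ^ (-2 : ℝ)) * ‖𝓕⁻ f p.1‖ ^ 2 := by gcongr
      _ = _ := by ring
  have hinner : ∀ ξ : V, ∫ μ in Ioi (0 : ℝ), D ξ μ = 1 / ((κ : ℂ) * (z ^ 2 +
        ((2 * π * ‖ξ‖ : ℝ) : ℂ) ^ 2)) * ((‖𝓕⁻ f ξ‖ ^ 2 : ℝ) : ℂ) := by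
    intro ξ
    simp only [hD]
    rw [integral_mul_const, integral_resolventDensity hκ hl hl1 (by positivity)]
  have hint := hDint.integral_prod_left
  simp only [Function.uncurry, hinner] at hint
  refine ⟨hint, ?_⟩
  simp_rw [← hinner]
  rw [integral_integral_swap hDint]
  have hform : ∀ μ ∈ Ioi (0 : ℝ), ∫ ξ, D ξ μ = ((2 / c : ℝ) : ℂ) *
      ((μ : ℂ) ^ 2 + 2 * z * μ) ^ ((κ - 1 : ℝ) : ℂ) *
        form (expKernel (((μ + l : ℝ) : ℂ) - Complex.I)) f (fun y => (starRingEnd ℂ) (f y)) := by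
    intro μ hμ
    have hμ : 0 < μ := hμ
    rw [form_expKernel_conj (by simp; linarith) hf, ← integral_const_mul]
    refine integral_congr_ae (ae_of_all _ fun ξ => ?_)
    simp only [hD, hκd, hdd, resolventDensity_eq, hc]
    rw [show (((μ + l : ℝ) : ℂ) - Complex.I) = μ + z by rw [hz]; push_cast; ring]
    ring
  rw [setIntegral_congr_fun measurableSet_Ioi hform]
  have hbound : ∀ μ ∈ Ioi (0 : ℝ), ‖((2 / c : ℝ) : ℂ) *
      ((μ : ℂ) ^ 2 + 2 * z * μ) ^ ((κ - 1 : ℝ) : ℂ) *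
        form (expKernel (((μ + l : ℝ) : ℂ) - Complex.I)) f (fun y => (starRingEnd ℂ) (f y))‖ ≤
      K * recipNorm x f ^ 2 * (μ + l) ^ A := by
    intro μ hμ
    have hμ : 0 < μ := hμ
    have ht : 0 < μ + l := by positivity
    have h1 := formBound_expKernel (V := V) (a := ((μ + l : ℝ) : ℂ) - Complex.I) (by simp; linarith)
      (norm_expMultiplier_sub_I_le ht) hx.le hxle f _ hf hf.conj
    rw [recipNorm_conj] at h1
    have h2 := norm_sq_add_two_mul_le hl hl1 hμ
    have h3 : (1 + (μ + l)) ^ (-((d - 1) / 2)) ≤ (1 + μ) ^ (-((d - 1) / 2)) :=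
      Real.rpow_le_rpow_of_nonpos (by positivity) (by linarith) (by linarith)
    have hN := recipNorm_nonneg x f
    rw [norm_mul, norm_mul, Complex.norm_cpow_real, Complex.norm_real,
      Real.norm_of_nonneg (by positivity)]
    have h4 := Real.rpow_le_rpow (z := κ - 1) (norm_nonneg _) h2 (by linarith)
    have h5 : (P * (c * 2 ^ ((d + 1) / 2) * ((μ + l) ^ (-((d + 1) / 2)) *
        (1 + (μ + l)) ^ (-((d - 1) / 2))))) ^ (2 - 2 * x) ≤
        (P * (c * 2 ^ ((d + 1) / 2))) ^ (2 - 2 * x) * ((μ + l) ^ (-((d + 1) * (1 - x))) *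
          (1 + μ) ^ (-((d - 1) * (1 - x)))) := by
      calc _ ≤ (P * (c * 2 ^ ((d + 1) / 2) * ((μ + l) ^ (-((d + 1) / 2)) *
              (1 + μ) ^ (-((d - 1) / 2))))) ^ (2 - 2 * x) := by
            refine Real.rpow_le_rpow (by positivity) ?_ (by linarith)
            gcongr
        _ = ((P * (c * 2 ^ ((d + 1) / 2))) * ((μ + l) ^ (-((d + 1) / 2)) *
              (1 + μ) ^ (-((d - 1) / 2)))) ^ (2 - 2 * x) := by ring_nf
        _ = _ := by
            rw [Real.mul_rpow (x := P * (c * 2 ^ ((d + 1) / 2))) (by positivity) (by positivity),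
              Real.mul_rpow (x := (μ + l) ^ _) (by positivity) (by positivity), ← Real.rpow_mul ht.le,
              ← Real.rpow_mul (by positivity)]
            congr 3 <;> ring
    calc _ ≤ (2 / c) * (4 * ((μ + l) * (1 + μ))) ^ (κ - 1) *
          (4 * ((P * (c * 2 ^ ((d + 1) / 2))) ^ (2 - 2 * x) * ((μ + l) ^ (-((d + 1) * (1 - x))) *
          (1 + μ) ^ (-((d - 1) * (1 - x))))) * recipNorm x f * recipNorm x f) := by
          gcongr (2 / c) * ?_ * ?_
          refine h1.trans ?_
          gcongr 4 * ?_ * _ * _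
      _ = K * recipNorm x f ^ 2 * ((μ + l) ^ (κ - 1) * (μ + l) ^ (-((d + 1) * (1 - x)))) *
          ((1 + μ) ^ (κ - 1) * (1 + μ) ^ (-((d - 1) * (1 - x)))) := by
          rw [Real.mul_rpow (by norm_num) (by positivity), Real.mul_rpow (by positivity) (by positivity), hK]
          ring
      _ = K * recipNorm x f ^ 2 * (μ + l) ^ A * (1 + μ) ^ (κ - 1 - (d - 1) * (1 - x)) := by
          rw [← Real.rpow_add ht, ← Real.rpow_add (by positivity)]
          congr 3
          rw [hA, hκd]; ring
      -- The leftover exponent of 1 + μ is (d-1)(x-1/2) - 1, which is not positive.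
      _ ≤ _ := by
          refine mul_le_of_le_one_right (by positivity) ?_
          refine Real.rpow_le_one_of_one_le_of_nonpos (by linarith) ?_
          rw [hκd]
          nlinarith
  refine (norm_integral_le_of_norm_le ((integrableOn_add_rpow hA1 hl).const_mul _)
    (by filter_upwards [ae_restrict_mem measurableSet_Ioi] with μ hμ using hbound μ hμ)).trans_eq ?_
  rw [integral_const_mul, integral_add_rpow hA1 hl, show A + 1 = -1 + (d + 1) * (x - 1 / 2) by rw [hA]; ring]
  ring

/-- The discrete restriction estimate for an annulus of width `l`. -/
theorem annulus_bound (hd : 3 ≤ dim) {x : ℝ} (hx : 1 / 2 < x)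
    (hx' : x < 1 / 2 + 1 / (dim + 1)) : ∃ C : ℝ, 0 ≤ C ∧ ∀ l : ℝ, 0 < l → l ≤ 1 →
    ∀ f : V → ℂ, IsNice f →
      ∫ ξ in annulus V l, ‖𝓕⁻ f ξ‖ ^ 2 ≤ C * l ^ ((dim + 1) * (x - 1 / 2)) * recipNorm x f ^ 2 := by
  obtain ⟨C, hC, h⟩ := norm_resolvent_integral_le hd hx hx'
  have hκ : 0 < (dim - 1) / 2 := by linarith
  refine ⟨10 * ((dim - 1) / 2) * C, by positivity, fun l hl hl1 f hf => ?_⟩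
  obtain ⟨hi, hb⟩ := h l hl hl1 f hf
  set F : V → ℂ := fun ξ => 1 / ((((dim - 1) / 2 : ℝ) : ℂ) * (((l : ℂ) - Complex.I) ^ 2 +
        ((2 * π * ‖ξ‖ : ℝ) : ℂ) ^ 2)) * ((‖𝓕⁻ f ξ‖ ^ 2 : ℝ) : ℂ) with hF
  have him : ∀ ξ, (F ξ).im = ((dim - 1) / 2)⁻¹ * (1 / (((l : ℂ) - Complex.I) ^ 2 +
        ((2 * π * ‖ξ‖ : ℝ) : ℂ) ^ 2)).im * ‖𝓕⁻ f ξ‖ ^ 2 := by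
    intro ξ
    rw [hF, Complex.im_mul_ofReal, ← one_div_mul_one_div, ← Complex.ofReal_one, ← Complex.ofReal_div,
      Complex.im_ofReal_mul, one_div]
  -- On the annulus the imaginary part of the resolvent is at least 1/(10l), and elsewhere it is
  -- nonnegative. The factor (dim-1)/2 cancels the κ in the resolvent formula.
  have h1 : ∫ ξ in annulus V l, ‖𝓕⁻ f ξ‖ ^ 2 ≤ ∫ ξ, 10 * ((dim - 1) / 2) * l * (F ξ).im := by
    rw [← integral_indicator (measurableSet_annulus l)]
    refine integral_mono_of_nonneg (ae_of_all _ fun ξ => indicator_nonneg (fun _ _ => by positivity) _)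
      (hi.im.const_mul _) (ae_of_all _ fun ξ => ?_)
    simp only [him]
    have e : 10 * ((dim - 1) / 2) * l * (((dim - 1) / 2)⁻¹ * (1 / (((l : ℂ) - Complex.I) ^ 2 +
        ((2 * π * ‖ξ‖ : ℝ) : ℂ) ^ 2)).im * ‖𝓕⁻ f ξ‖ ^ 2) = (10 * l) * (1 / (((l : ℂ) - Complex.I) ^ 2 +
        ((2 * π * ‖ξ‖ : ℝ) : ℂ) ^ 2)).im * ‖𝓕⁻ f ξ‖ ^ 2 := by
      have hk := mul_inv_cancel₀ hκ.ne'
      generalize (1 / (((l : ℂ) - Complex.I) ^ 2 + ((2 * π * ‖ξ‖ : ℝ) : ℂ) ^ 2)).im = J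
      linear_combination (10 * l * J * ‖𝓕⁻ f ξ‖ ^ 2) * hk
    rw [e]
    by_cases hξ : ξ ∈ annulus V l
    · rw [indicator_of_mem hξ]
      refine le_mul_of_one_le_left (by positivity) ?_
      have := im_resolvent_ge hl hl1 hξ
      rwa [div_le_iff₀ (by positivity), mul_comm] at this
    · rw [indicator_of_notMem hξ]
      have := im_resolvent_nonneg hl (2 * π * ‖ξ‖)
      positivity
  refine h1.trans ?_
  rw [integral_const_mul]
  have h2 : ∫ ξ, (F ξ).im = (∫ ξ, F ξ).im := Complex.imCLM.integral_comp_comm hi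
  have h3 : (∫ ξ, F ξ).im ≤ ‖∫ ξ, F ξ‖ := (le_abs_self _).trans (Complex.abs_im_le_norm _)
  rw [h2]
  calc _ ≤ 10 * ((dim - 1) / 2) * l * (C * l ^ (-1 + (dim + 1) * (x - 1 / 2)) * recipNorm x f ^ 2) := by
        gcongr
        exact h3.trans hb
    _ = 10 * ((dim - 1) / 2) * C * (l ^ (-1 + (dim + 1) * (x - 1 / 2)) * l) * recipNorm x f ^ 2 := by ring
    _ = _ := by
        rw [← Real.rpow_add_one hl.ne']
        congr 3; ring

end Annulus

/-! ### Summing over annuli at the critical exponent -/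

section Splitting

open scoped FourierTransform Real

/-- For a fixed height `u` the constraint means l ≥ u^{1/γ}, which cuts off the divergence of
l^{-σ-1} at 0. -/
theorem lintegral_small_le {u σ γ : ℝ} (hu : 0 ≤ u) (hσ : 0 < σ) (hγ : 0 < γ) :
    ∫⁻ l in Ioi (0 : ℝ), ENNReal.ofReal (if u ≤ l ^ γ then l ^ (-σ - 1) * u ^ 2 else 0) ≤
      ENNReal.ofReal (σ⁻¹ * u ^ (2 - σ / γ)) := by
  rcases hu.eq_or_lt with rfl | hu
  · simp
  set a := u ^ γ⁻¹ with ha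
  have ha0 : 0 < a := by positivity
  have hint : IntegrableOn (fun l : ℝ => l ^ (-σ - 1) * u ^ 2) (Ioi a) :=
    (integrableOn_Ioi_rpow_of_lt (by linarith) ha0).mul_const _
  calc _ ≤ ∫⁻ l in Ioi (0 : ℝ), (Ici a).indicator
        (fun l => ENNReal.ofReal (l ^ (-σ - 1) * u ^ 2)) l := by
        refine setLIntegral_mono' measurableSet_Ioi fun l hl => ?_
        have hl : 0 < l := hl
        split_ifs with h
        · rw [indicator_of_mem]
          rw [mem_Ici, ha]
          calc u ^ γ⁻¹ ≤ (l ^ γ) ^ γ⁻¹ := Real.rpow_le_rpow hu.le h (by positivity)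
            _ = l := by rw [← Real.rpow_mul hl.le, mul_inv_cancel₀ hγ.ne', Real.rpow_one]
        · simp
    _ ≤ ∫⁻ l, (Ici a).indicator (fun l => ENNReal.ofReal (l ^ (-σ - 1) * u ^ 2)) l :=
        setLIntegral_le_lintegral _ _
    _ = ∫⁻ l in Ioi a, ENNReal.ofReal (l ^ (-σ - 1) * u ^ 2) := by
        rw [lintegral_indicator measurableSet_Ici, setLIntegral_congr Ioi_ae_eq_Ici]
    _ = ENNReal.ofReal (∫ l in Ioi a, l ^ (-σ - 1) * u ^ 2) := by
        rw [ofReal_integral_eq_lintegral_ofReal hint]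
        filter_upwards [ae_restrict_mem measurableSet_Ioi] with l hl
        have : 0 < l := ha0.trans hl
        positivity
    _ = _ := by
        congr 1
        rw [integral_mul_const, integral_Ioi_rpow_of_lt (by linarith) ha0, Real.rpow_sub hu,
          Real.rpow_two, show -σ - 1 + 1 = -σ by ring, ha, ← Real.rpow_mul hu.le, neg_div_neg_eq,
          show γ⁻¹ * -σ = -(σ / γ) by ring, Real.rpow_neg hu.le]
        field_simp

/-- The complementary range l < u^{1/γ}, where positivity of `e` gives convergence at 0. -/
theorem lintegral_large_le {u p e γ : ℝ} (hu : 0 ≤ u) (he : 0 < e) (hγ : 0 < γ) :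
    ∫⁻ l in Ioi (0 : ℝ), ENNReal.ofReal (if l ^ γ < u then l ^ (e - 1) * u ^ p else 0) ≤
      ENNReal.ofReal (e⁻¹ * u ^ (p + e / γ)) := by
  rcases hu.eq_or_lt with rfl | hu
  · refine le_of_eq_of_le ?_ zero_le
    rw [← lintegral_zero (μ := volume.restrict (Ioi (0 : ℝ)))]
    refine setLIntegral_congr_fun measurableSet_Ioi fun l hl => ?_
    have hl : 0 < l := hl
    have : ¬ l ^ γ < 0 := not_lt.2 (by positivity)
    simp [this]
  set a := u ^ γ⁻¹ with ha
  have ha0 : 0 < a := by positivity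
  have hint : IntervalIntegrable (fun l : ℝ => l ^ (e - 1) * u ^ p) volume 0 a :=
    (intervalIntegral.intervalIntegrable_rpow' (by linarith)).mul_const _
  rw [intervalIntegrable_iff_integrableOn_Ioc_of_le ha0.le] at hint
  calc _ ≤ ∫⁻ l in Ioi (0 : ℝ), (Iic a).indicator
        (fun l => ENNReal.ofReal (l ^ (e - 1) * u ^ p)) l := by
        refine setLIntegral_mono' measurableSet_Ioi fun l hl => ?_
        have hl : 0 < l := hl
        split_ifs with h
        · rw [indicator_of_mem]
          rw [mem_Iic, ha]
          calc l = (l ^ γ) ^ γ⁻¹ := by rw [← Real.rpow_mul hl.le, mul_inv_cancel₀ hγ.ne', Real.rpow_one]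
            _ ≤ u ^ γ⁻¹ := Real.rpow_le_rpow (by positivity) h.le (by positivity)
        · simp
    _ = ∫⁻ l in Ioc 0 a, ENNReal.ofReal (l ^ (e - 1) * u ^ p) := by
        rw [lintegral_indicator measurableSet_Iic, Measure.restrict_restrict measurableSet_Iic,
          inter_comm, Ioi_inter_Iic]
    _ = ENNReal.ofReal (∫ l in Ioc 0 a, l ^ (e - 1) * u ^ p) := by
        rw [ofReal_integral_eq_lintegral_ofReal hint]
        filter_upwards [ae_restrict_mem measurableSet_Ioc] with l hl
        have : 0 < l := hl.1
        positivity
    _ = _ := by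
        congr 1
        rw [← intervalIntegral.integral_of_le ha0.le, intervalIntegral.integral_mul_const,
          integral_rpow (Or.inl (by linarith)), sub_add_cancel, Real.zero_rpow he.ne', sub_zero, ha,
          ← Real.rpow_mul hu.le, Real.rpow_add hu, show γ⁻¹ * e = e / γ by ring]
        ring

variable {V : Type*} [NormedAddCommGroup V] [InnerProductSpace ℝ V] [FiniteDimensional ℝ V]
  [MeasurableSpace V] [BorelSpace V]

local notation "dim" => (Module.finrank ℝ V : ℝ)

theorem fourierInv_add {f g : V → ℂ} (hf : IsNice f) (hg : IsNice g) (ξ : V) :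
    𝓕⁻ (fun y => f y + g y) ξ = 𝓕⁻ f ξ + 𝓕⁻ g ξ := by
  have h : ∀ {φ : V → ℂ}, IsNice φ → Integrable (fun v : V =>
      Complex.exp ((2 * π * inner ℝ v ξ : ℝ) * Complex.I) • φ v) := fun {φ} hφ => by
    refine hφ.integrable.norm.mono' ?_ (ae_of_all _ fun v => ?_)
    · have := hφ.measurable
      exact ((by fun_prop : Measurable fun v : V => Complex.exp ((2 * π * inner ℝ v ξ : ℝ) *
        Complex.I)).smul this).aestronglyMeasurable
    · rw [norm_smul, Complex.norm_exp_ofReal_mul_I, one_mul]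
  simp only [Real.fourierInv_eq', smul_add]
  exact integral_add (h hf) (h hg)

theorem fourierInv_const_mul (c : ℂ) (f : V → ℂ) (ξ : V) :
    𝓕⁻ (fun y => c * f y) ξ = c * 𝓕⁻ f ξ := by
  simp only [Real.fourierInv_eq', smul_eq_mul, ← integral_const_mul]
  congr 1; ext; ring

theorem annulus_add_le {f g : V → ℂ} (hf : IsNice f) (hg : IsNice g) (l : ℝ) :
    ∫ ξ in annulus V l, ‖𝓕⁻ (fun y => f y + g y) ξ‖ ^ 2 ≤
      2 * (∫ ξ in annulus V l, ‖𝓕⁻ f ξ‖ ^ 2) + 2 * ∫ ξ in annulus V l, ‖𝓕⁻ g ξ‖ ^ 2 := by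
  have h1 := (hf.integrable_fourierInv_sq.const_mul 2).integrableOn (s := annulus V l)
  have h2 := (hg.integrable_fourierInv_sq.const_mul 2).integrableOn (s := annulus V l)
  rw [← integral_const_mul, ← integral_const_mul, ← integral_add h1 h2]
  refine integral_mono_of_nonneg (ae_of_all _ fun ξ => by positivity) (h1.add h2)
    (ae_of_all _ fun ξ => ?_)
  simp only [fourierInv_add hf hg]
  have := norm_add_le (𝓕⁻ f ξ) (𝓕⁻ g ξ)
  nlinarith [sq_nonneg (‖𝓕⁻ f ξ‖ - ‖𝓕⁻ g ξ‖), norm_nonneg (𝓕⁻ f ξ + 𝓕⁻ g ξ)]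

theorem annulus_le_sq {f : V → ℂ} (hf : IsNice f) (l : ℝ) :
    ∫ ξ in annulus V l, ‖𝓕⁻ f ξ‖ ^ 2 ≤ plancherelConst V * ∫ y, ‖f y‖ ^ 2 := by
  have h := integral_fourierInv_sq_le hf
  rw [recipNorm_half_sq] at h
  exact (setIntegral_le_integral hf.integrable_fourierInv_sq
    (ae_of_all _ fun ξ => by positivity)).trans h

/-- `f` is cut at height l^γ: Plancherel handles the low part, the annulus bound at `x₀` the high
part. Both resulting terms are integrals over `y` of functions of |f(y)| and `l`, ready for Tonelli.
-/
theorem annulus_split_bound {x₀ x C₀ σ₀ σ γ e l : ℝ} {f : V → ℂ} (hf : IsNice f) (hx₀ : 1 / 2 < x₀)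
    (hx0 : 0 < x) (hx : x < x₀) (hl : 0 < l) (hC₀ : 0 ≤ C₀)
    (hN : ∫ y, ‖f y‖ ^ x⁻¹ = 1)
    (hann : ∀ g : V → ℂ, IsNice g →
      ∫ ξ in annulus V l, ‖𝓕⁻ g ξ‖ ^ 2 ≤ C₀ * l ^ σ₀ * recipNorm x₀ g ^ 2)
    (he : e = σ₀ - σ + γ * (x₀⁻¹ - x⁻¹) * (2 * x₀ - 1)) :
    ENNReal.ofReal (l ^ (-σ - 1) * ∫ ξ in annulus V l, ‖𝓕⁻ f ξ‖ ^ 2) ≤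
      ENNReal.ofReal (2 * plancherelConst V) * (∫⁻ y, ENNReal.ofReal
        (if ‖f y‖ ≤ l ^ γ then l ^ (-σ - 1) * ‖f y‖ ^ 2 else 0)) +
      ENNReal.ofReal (2 * C₀) * ∫⁻ y, ENNReal.ofReal
        (if l ^ γ < ‖f y‖ then l ^ (e - 1) * ‖f y‖ ^ x₀⁻¹ else 0) := by
  have hP := plancherelConst_nonneg (V := V)
  have hx₀0 : 0 < x₀ := by linarith
  set S : Set V := {y | ‖f y‖ ≤ l ^ γ} with hS
  have hSm : MeasurableSet S := measurableSet_le hf.measurable.norm measurable_const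
  set g := S.indicator f with hg
  set h := Sᶜ.indicator f with hh
  have hgn : IsNice g := hf.indicator hSm
  have hhn : IsNice h := hf.indicator hSm.compl
  have hfe : f = fun y => g y + h y := by
    ext y; exact (congrFun (indicator_self_add_compl S f) y).symm
  have e1 : ∀ y, (if ‖f y‖ ≤ l ^ γ then l ^ (-σ - 1) * ‖f y‖ ^ 2 else 0) =
      l ^ (-σ - 1) * ‖g y‖ ^ 2 := by
    intro y
    by_cases hy : ‖f y‖ ≤ l ^ γ
    · rw [if_pos hy, hg, indicator_of_mem (show y ∈ S from hy)]
    · rw [if_neg hy, hg, indicator_of_notMem (show y ∉ S from hy)]; simp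
  have e2 : ∀ y, (if l ^ γ < ‖f y‖ then l ^ (e - 1) * ‖f y‖ ^ x₀⁻¹ else 0) =
      l ^ (e - 1) * ‖h y‖ ^ x₀⁻¹ := by
    intro y
    by_cases hy : l ^ γ < ‖f y‖
    · rw [if_pos hy, hh, indicator_of_mem (show y ∈ Sᶜ from not_le.2 hy)]
    · rw [if_neg hy, hh, indicator_of_notMem (show y ∉ Sᶜ from fun hc => hc (not_lt.1 hy)), norm_zero,
        Real.zero_rpow (by positivity), mul_zero]
  simp only [e1, e2]
  rw [← ofReal_integral_eq_lintegral_ofReal (hgn.integrable_norm_sq.const_mul _)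
    (ae_of_all _ fun y => by positivity), ← ofReal_integral_eq_lintegral_ofReal
    ((hhn.integrable_norm_rpow (by positivity)).const_mul _) (ae_of_all _ fun y => by positivity),
    ← ENNReal.ofReal_mul (by positivity), ← ENNReal.ofReal_mul (by positivity),
    ← ENNReal.ofReal_add (by positivity) (by positivity)]
  refine ENNReal.ofReal_le_ofReal ?_
  rw [integral_const_mul, integral_const_mul]
  set X := ∫ y, ‖h y‖ ^ x₀⁻¹ with hX
  have hX0 : 0 ≤ X := by positivity
  -- Chebyshev: where |f| > l^γ, the negative power x₀⁻¹ - x⁻¹ of |f| is at most that of l^γ, and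
  -- the remaining integral is normalised to 1.
  have hXle : X ≤ l ^ (γ * (x₀⁻¹ - x⁻¹)) := by
    have hexp : x₀⁻¹ - x⁻¹ ≤ 0 := by
      have := inv_anti₀ hx0 hx.le
      linarith
    rw [← mul_one (l ^ _), ← hN, ← integral_const_mul]
    refine integral_mono_of_nonneg (ae_of_all _ fun y => by positivity)
      ((hf.integrable_norm_rpow (by positivity)).const_mul _) (ae_of_all _ fun y => ?_)
    simp only
    by_cases hy : l ^ γ < ‖f y‖
    · have hy0 : 0 < ‖f y‖ := lt_of_le_of_lt (by positivity) hy
      rw [hh, indicator_of_mem (show y ∈ Sᶜ from not_le.2 hy), Real.rpow_mul hl.le]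
      calc ‖f y‖ ^ x₀⁻¹ = ‖f y‖ ^ (x₀⁻¹ - x⁻¹) * ‖f y‖ ^ x⁻¹ := by
            rw [← Real.rpow_add hy0]; congr 1; ring
        _ ≤ _ := by
            gcongr ?_ * _
            exact Real.rpow_le_rpow_of_nonpos (by positivity) hy.le hexp
    · rw [hh, indicator_of_notMem (show y ∉ Sᶜ from fun hc => hc (not_lt.1 hy)), norm_zero,
        Real.zero_rpow (by positivity)]
      positivity
  -- In X^{2x₀} = X · X^{2x₀-1} only the second factor is estimated. Keeping `X` to the first power
  -- preserves an integral over `y`.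
  have hN2 : recipNorm x₀ h ^ 2 ≤ X * l ^ (γ * (x₀⁻¹ - x⁻¹) * (2 * x₀ - 1)) := by
    have : recipNorm x₀ h ^ 2 = X * X ^ (2 * x₀ - 1) := by
      rw [recipNorm, ← Real.rpow_natCast, ← Real.rpow_mul hX0, mul_comm X,
        ← Real.rpow_add_one' hX0 (by linarith)]
      congr 1; push_cast; ring
    rw [this, Real.rpow_mul hl.le (γ * _)]
    gcongr
    linarith
  have hA := annulus_add_le hgn hhn l
  rw [← hfe] at hA
  have h1 := annulus_le_sq hgn l
  have h2 := hann h hhn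
  calc _ ≤ l ^ (-σ - 1) * (2 * (plancherelConst V * ∫ y, ‖g y‖ ^ 2) +
        2 * (C₀ * l ^ σ₀ * (X * l ^ (γ * (x₀⁻¹ - x⁻¹) * (2 * x₀ - 1))))) := by
        gcongr
        refine hA.trans ?_
        gcongr
        refine h2.trans ?_
        gcongr
    _ = 2 * plancherelConst V * (l ^ (-σ - 1) * ∫ y, ‖g y‖ ^ 2) +
        2 * C₀ * ((l ^ (-σ - 1) * l ^ σ₀ * l ^ (γ * (x₀⁻¹ - x⁻¹) * (2 * x₀ - 1))) * X) := by ring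
    _ = _ := by
        rw [← Real.rpow_add hl, ← Real.rpow_add hl]
        congr 4
        rw [he]; ring

/-- The exponent γ is chosen so that after the integration in `l` both terms carry the same power
|f|^{1/x}, of integral 1: 2 - σ/γ = 1/x and 1/x₀ + e/γ = 1/x. -/
theorem lintegral_annulus_le_of_normalized {x₀ x C₀ : ℝ} (hx : 1 / 2 < x) (hxx : x < x₀) (hC₀ : 0 ≤ C₀)
    (hd : 0 < dim + 1)
    (hann : ∀ l : ℝ, 0 < l → l ≤ 1 → ∀ g : V → ℂ, IsNice g →
      ∫ ξ in annulus V l, ‖𝓕⁻ g ξ‖ ^ 2 ≤ C₀ * l ^ ((dim + 1) * (x₀ - 1 / 2)) * recipNorm x₀ g ^ 2)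
    {f : V → ℂ} (hf : IsNice f) (hN : ∫ y, ‖f y‖ ^ x⁻¹ = 1) :
    ∫⁻ l in Ioc (0 : ℝ) 1, ENNReal.ofReal (l ^ (-((dim + 1) * (x - 1 / 2)) - 1) *
      ∫ ξ in annulus V l, ‖𝓕⁻ f ξ‖ ^ 2) ≤
      ENNReal.ofReal (2 * plancherelConst V * ((dim + 1) * (x - 1 / 2))⁻¹ +
        2 * C₀ * ((dim + 1) * (x₀ - x) / (2 * x₀))⁻¹) := by
  set d := dim
  set σ := (d + 1) * (x - 1 / 2) with hσ
  set σ₀ := (d + 1) * (x₀ - 1 / 2) with hσ₀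
  set γ := (d + 1) * x / 2 with hγ
  set e := (d + 1) * (x₀ - x) / (2 * x₀) with he
  have hx0 : 0 < x := by linarith
  have hx₀0 : 0 < x₀ := by linarith
  have hσ0 : 0 < σ := mul_pos hd (by linarith)
  have hγ0 : 0 < γ := by positivity
  have he0 : 0 < e := div_pos (mul_pos hd (by linarith)) (by linarith)
  have hP := plancherelConst_nonneg (V := V)
  have hee : e = σ₀ - σ + γ * (x₀⁻¹ - x⁻¹) * (2 * x₀ - 1) := by
    rw [he, hσ₀, hσ, hγ]; field_simp; ring
  have hfm := hf.measurable
  have hone : ∫⁻ y, ENNReal.ofReal (‖f y‖ ^ x⁻¹) = 1 := by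
    rw [← ofReal_integral_eq_lintegral_ofReal (hf.integrable_norm_rpow (by positivity))
      (ae_of_all _ fun y => by positivity), hN, ENNReal.ofReal_one]
  have m1 : Measurable (Function.uncurry fun (l : ℝ) (y : V) => ENNReal.ofReal
        (if ‖f y‖ ≤ l ^ γ then l ^ (-σ - 1) * ‖f y‖ ^ 2 else 0)) := by
    refine ENNReal.measurable_ofReal.comp (Measurable.ite (measurableSet_le ?_ ?_) ?_ measurable_const)
      <;> fun_prop
  have m2 : Measurable (Function.uncurry fun (l : ℝ) (y : V) => ENNReal.ofReal
        (if l ^ γ < ‖f y‖ then l ^ (e - 1) * ‖f y‖ ^ x₀⁻¹ else 0)) := by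
    refine ENNReal.measurable_ofReal.comp (Measurable.ite (measurableSet_lt ?_ ?_) ?_ measurable_const)
      <;> fun_prop
  have b1 : ∫⁻ l in Ioi (0 : ℝ), ∫⁻ y, ENNReal.ofReal
        (if ‖f y‖ ≤ l ^ γ then l ^ (-σ - 1) * ‖f y‖ ^ 2 else 0) ≤ ENNReal.ofReal σ⁻¹ := by
    rw [lintegral_lintegral_swap m1.aemeasurable]
    calc _ ≤ ∫⁻ y, ENNReal.ofReal (σ⁻¹ * ‖f y‖ ^ (2 - σ / γ)) :=
          lintegral_mono fun y => lintegral_small_le (norm_nonneg _) hσ0 hγ0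
      _ = ∫⁻ y, ENNReal.ofReal σ⁻¹ * ENNReal.ofReal (‖f y‖ ^ x⁻¹) := by
          refine lintegral_congr fun y => ?_
          rw [ENNReal.ofReal_mul (by positivity), show 2 - σ / γ = x⁻¹ by
            rw [hσ, hγ]; field_simp; ring]
      _ = _ := by rw [lintegral_const_mul _ (by fun_prop), hone, mul_one]
  have b2 : ∫⁻ l in Ioi (0 : ℝ), ∫⁻ y, ENNReal.ofReal
        (if l ^ γ < ‖f y‖ then l ^ (e - 1) * ‖f y‖ ^ x₀⁻¹ else 0) ≤ ENNReal.ofReal e⁻¹ := by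
    rw [lintegral_lintegral_swap m2.aemeasurable]
    calc _ ≤ ∫⁻ y, ENNReal.ofReal (e⁻¹ * ‖f y‖ ^ (x₀⁻¹ + e / γ)) :=
          lintegral_mono fun y => lintegral_large_le (norm_nonneg _) he0 hγ0
      _ = ∫⁻ y, ENNReal.ofReal e⁻¹ * ENNReal.ofReal (‖f y‖ ^ x⁻¹) := by
          refine lintegral_congr fun y => ?_
          rw [ENNReal.ofReal_mul (by positivity), show x₀⁻¹ + e / γ = x⁻¹ by
            rw [he, hγ]; field_simp; ring]
      _ = _ := by rw [lintegral_const_mul _ (by fun_prop), hone, mul_one]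
  calc _ ≤ ∫⁻ l in Ioc (0 : ℝ) 1, (ENNReal.ofReal (2 * plancherelConst V) * (∫⁻ y, ENNReal.ofReal
        (if ‖f y‖ ≤ l ^ γ then l ^ (-σ - 1) * ‖f y‖ ^ 2 else 0)) +
      ENNReal.ofReal (2 * C₀) * ∫⁻ y, ENNReal.ofReal
        (if l ^ γ < ‖f y‖ then l ^ (e - 1) * ‖f y‖ ^ x₀⁻¹ else 0)) :=
        setLIntegral_mono' measurableSet_Ioc fun l hl => annulus_split_bound hf (by linarith) hx0 hxx
          hl.1 hC₀ hN (hann l hl.1 hl.2) hee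
    _ ≤ ∫⁻ l in Ioi (0 : ℝ), (ENNReal.ofReal (2 * plancherelConst V) * (∫⁻ y, ENNReal.ofReal
        (if ‖f y‖ ≤ l ^ γ then l ^ (-σ - 1) * ‖f y‖ ^ 2 else 0)) +
      ENNReal.ofReal (2 * C₀) * ∫⁻ y, ENNReal.ofReal
        (if l ^ γ < ‖f y‖ then l ^ (e - 1) * ‖f y‖ ^ x₀⁻¹ else 0)) :=
        lintegral_mono_set Ioc_subset_Ioi_self
    _ ≤ ENNReal.ofReal (2 * plancherelConst V) * ENNReal.ofReal σ⁻¹ +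
        ENNReal.ofReal (2 * C₀) * ENNReal.ofReal e⁻¹ := by
        have n1 : Measurable fun l : ℝ => ∫⁻ y, ENNReal.ofReal
          (if ‖f y‖ ≤ l ^ γ then l ^ (-σ - 1) * ‖f y‖ ^ 2 else 0) := m1.lintegral_prod_right'
        have n2 : Measurable fun l : ℝ => ∫⁻ y, ENNReal.ofReal
          (if l ^ γ < ‖f y‖ then l ^ (e - 1) * ‖f y‖ ^ x₀⁻¹ else 0) := m2.lintegral_prod_right'
        rw [lintegral_add_left (n1.const_mul _), lintegral_const_mul _ n1, lintegral_const_mul _ n2]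
        gcongr
    _ = _ := by
        rw [← ENNReal.ofReal_mul (by positivity), ← ENNReal.ofReal_mul (by positivity),
          ← ENNReal.ofReal_add (by positivity) (by positivity)]

/-- Summation of the annulus estimates over all widths. -/
theorem lintegral_annulus_le (hd : 3 ≤ dim) {x : ℝ} (hx : 1 / 2 < x)
    (hx' : x < 1 / 2 + 1 / (dim + 1)) : ∃ C : ℝ, 0 ≤ C ∧ ∀ f : V → ℂ, IsNice f →
    ∫⁻ l in Ioc (0 : ℝ) 1, ENNReal.ofReal (l ^ (-((dim + 1) * (x - 1 / 2)) - 1) *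
      ∫ ξ in annulus V l, ‖𝓕⁻ f ξ‖ ^ 2) ≤ ENNReal.ofReal (C * recipNorm x f ^ 2) := by
  -- The restriction range is open, so some `x₀ > x` is available. Strictness is what makes `e`
  -- positive.
  obtain ⟨x₀, hxx, hx₀⟩ := exists_between hx'
  obtain ⟨C₀, hC₀, hann⟩ := annulus_bound hd (by linarith) hx₀
  have hx0 : 0 < x := by linarith
  have hP := plancherelConst_nonneg (V := V)
  set C := 2 * plancherelConst V * ((dim + 1) * (x - 1 / 2))⁻¹ +
        2 * C₀ * ((dim + 1) * (x₀ - x) / (2 * x₀))⁻¹ with hC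
  have hC0 : 0 ≤ C := by
    have h1 : 0 < (dim + 1) * (x - 1 / 2) := mul_pos (by linarith) (by linarith)
    have h2 : 0 < (dim + 1) * (x₀ - x) / (2 * x₀) :=
      div_pos (mul_pos (by linarith) (by linarith)) (by linarith)
    positivity
  refine ⟨C, hC0, fun f hf => ?_⟩
  set N := recipNorm x f with hN
  -- Normalisation needs a nonzero norm. If the norm vanishes, then f = 0 almost everywhere and so
  -- does its transform.
  rcases (recipNorm_nonneg x f).eq_or_lt with h0 | h0
  · have hS : ∫ y, ‖f y‖ ^ x⁻¹ = 0 := by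
      by_contra hne
      have : 0 < ∫ y, ‖f y‖ ^ x⁻¹ := lt_of_le_of_ne (by positivity) (Ne.symm hne)
      have : 0 < recipNorm x f := by unfold recipNorm; positivity
      linarith
    have hf0 : f =ᵐ[volume] 0 := by
      rw [integral_eq_zero_iff_of_nonneg (fun y => by positivity)
        (hf.integrable_norm_rpow (by positivity))] at hS
      filter_upwards [hS] with y hy
      have hy : ‖f y‖ ^ x⁻¹ = 0 := hy
      rw [Real.rpow_eq_zero (norm_nonneg _) (by positivity)] at hy
      simpa using hy
    have hF : ∀ ξ, 𝓕⁻ f ξ = 0 := fun ξ => by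
      rw [Real.fourierInv_eq']
      refine integral_eq_zero_of_ae ?_
      filter_upwards [hf0] with y hy
      simp [hy]
    simp [hF]
  · have hN0 : N ≠ 0 := h0.ne'
    set g : V → ℂ := fun y => ((N⁻¹ : ℝ) : ℂ) * f y with hg
    have hgn : IsNice g := hf.const_mul _
    have hgN : ∫ y, ‖g y‖ ^ x⁻¹ = 1 := by
      have : ∀ y, ‖g y‖ ^ x⁻¹ = (N⁻¹) ^ x⁻¹ * ‖f y‖ ^ x⁻¹ := fun y => by
        rw [hg, norm_mul, Complex.norm_real, Real.norm_of_nonneg (by positivity),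
          Real.mul_rpow (by positivity) (norm_nonneg _)]
      simp only [this]
      rw [integral_const_mul]
      have h1 : ∫ y, ‖f y‖ ^ x⁻¹ = N ^ x⁻¹ := by
        rw [hN, recipNorm, ← Real.rpow_mul (by positivity), mul_inv_cancel₀ hx0.ne', Real.rpow_one]
      rw [h1, ← Real.mul_rpow (by positivity) (by positivity), inv_mul_cancel₀ h0.ne', Real.one_rpow]
    have key := lintegral_annulus_le_of_normalized hx hxx hC₀ (by linarith) hann hgn hgN
    have hFf : ∀ ξ, ‖𝓕⁻ f ξ‖ ^ 2 = N ^ 2 * ‖𝓕⁻ g ξ‖ ^ 2 := fun ξ => by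
      rw [hg, fourierInv_const_mul, norm_mul, Complex.norm_real, Real.norm_of_nonneg (by positivity)]
      field_simp
    simp only [hFf, integral_const_mul]
    calc _ = ∫⁻ l in Ioc (0 : ℝ) 1, ENNReal.ofReal (N ^ 2) *
          ENNReal.ofReal (l ^ (-((dim + 1) * (x - 1 / 2)) - 1) *
            ∫ ξ in annulus V l, ‖𝓕⁻ g ξ‖ ^ 2) := by
          refine lintegral_congr fun l => ?_
          rw [← ENNReal.ofReal_mul (by positivity)]
          congr 1; ring
      _ = ENNReal.ofReal (N ^ 2) * ∫⁻ l in Ioc (0 : ℝ) 1,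
          ENNReal.ofReal (l ^ (-((dim + 1) * (x - 1 / 2)) - 1) *
            ∫ ξ in annulus V l, ‖𝓕⁻ g ξ‖ ^ 2) := lintegral_const_mul' _ _ ENNReal.ofReal_ne_top
      _ ≤ ENNReal.ofReal (N ^ 2) * ENNReal.ofReal C := by gcongr
      _ = _ := by rw [← ENNReal.ofReal_mul (by positivity), mul_comm]

end Splitting

/-! ### The kernels e^{i|y|}|y|^{-b} as Mellin transforms -/

section PowKernel

variable {V : Type*} [NormedAddCommGroup V] [InnerProductSpace ℝ V] [FiniteDimensional ℝ V]
  [MeasurableSpace V] [BorelSpace V]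

local notation "dim" => (Module.finrank ℝ V : ℝ)

/-- The oscillating kernel `exp (i|y|) |y|^(-b)` for a complex exponent `b`. -/
noncomputable def powKernel (b : ℂ) (y : V) : ℂ :=
  Complex.exp (Complex.I * (‖y‖ : ℂ)) * (‖y‖ : ℂ) ^ (-b)

theorem measurable_powKernel (b : ℂ) : Measurable (powKernel b : V → ℂ) := by
  unfold powKernel; fun_prop

theorem powKernel_neg (b : ℂ) (y : V) : powKernel b (-y) = powKernel b y := by
  simp [powKernel]

theorem norm_powKernel (b : ℂ) {y : V} (hy : y ≠ 0) : ‖powKernel b y‖ = ‖y‖ ^ (-b.re) := by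
  rw [powKernel, norm_mul, mul_comm Complex.I, Complex.norm_exp_ofReal_mul_I, one_mul,
    Complex.norm_cpow_eq_rpow_re_of_pos (norm_pos_iff.2 hy), Complex.neg_re]

theorem locallyIntegrable_norm_rpow {β : ℝ} (hd : 1 ≤ dim) (hβ : β < dim) :
    LocallyIntegrable (fun y : V => ‖y‖ ^ (-β)) :=
  locallyIntegrable_of_norm_le_rpow (C := 1) (by exact_mod_cast hd) hβ (ae_of_all _ fun y => by
    rw [one_mul, Real.norm_of_nonneg (by positivity)])
    (measurable_norm.pow_const _).aestronglyMeasurable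

theorem locallyIntegrable_powKernel {b : ℂ} (hd : 1 ≤ dim) (hb : b.re < dim) :
    LocallyIntegrable (powKernel b : V → ℂ) := by
  have : Nontrivial V := Module.nontrivial_of_finrank_pos (R := ℝ) (by exact_mod_cast hd)
  refine locallyIntegrable_of_norm_le_rpow (C := 1) (by exact_mod_cast hd) hb ?_
    (measurable_powKernel b).aestronglyMeasurable
  filter_upwards [compl_mem_ae_iff.2 (measure_singleton (0 : V))] with y hy
  rw [norm_powKernel b hy, one_mul]

theorem integral_cpow_mul_expKernel {b : ℂ} (hb : 0 < b.re) {y : V} (hy : y ≠ 0) :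
    ∫ t in Ioi (0 : ℝ), (t : ℂ) ^ (b - 1) * expKernel ((t : ℂ) - Complex.I) y =
      Complex.Gamma b * powKernel b y := by
  have hr : 0 < ‖y‖ := norm_pos_iff.2 hy
  have h := Complex.integral_cpow_mul_exp_neg_mul_Ioi hb (r := ‖y‖) hr
  have e : ∀ t : ℝ, (t : ℂ) ^ (b - 1) * expKernel ((t : ℂ) - Complex.I) y =
      Complex.exp (Complex.I * (‖y‖ : ℂ)) *
        ((t : ℂ) ^ (b - 1) * Complex.exp (-((‖y‖ : ℂ) * (t : ℂ)))) := fun t => by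
    rw [expKernel, mul_left_comm, ← Complex.exp_add]
    congr 2; ring
  simp only [e]
  rw [integral_const_mul, h, powKernel, Complex.cpow_neg, one_div, Complex.inv_cpow]
  · ring
  · rw [Complex.arg_ofReal_of_nonneg hr.le]; exact Real.pi_pos.ne

theorem norm_cpow_mul_expKernel (b : ℂ) {t : ℝ} (ht : 0 < t) (y : V) :
    ‖(t : ℂ) ^ (b - 1) * expKernel ((t : ℂ) - Complex.I) y‖ =
      t ^ (b.re - 1) * Real.exp (-(‖y‖ * t)) := by
  rw [norm_mul, norm_expKernel, Complex.norm_cpow_eq_rpow_re_of_pos ht]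
  simp [mul_comm]

/-- The forms of the power kernels are Mellin transforms of the forms of the exponential kernels. -/
theorem gamma_mul_form_powKernel {b : ℂ} (hd : 1 ≤ dim) (hb : 0 < b.re) (hbd : b.re < dim)
    {f g : V → ℂ} (hf : IsNice f) (hg : IsNice g) :
    Complex.Gamma b * form (powKernel b) f g =
      ∫ t in Ioi (0 : ℝ), (t : ℂ) ^ (b - 1) * form (expKernel ((t : ℂ) - Complex.I)) f g := by
  have : Nontrivial V := Module.nontrivial_of_finrank_pos (R := ℝ) (by exact_mod_cast hd)
  have hne : ∀ᵐ p : V × V, p.1 - p.2 ≠ 0 := by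
    have h := (quasiMeasurePreserving_sub (volume : Measure V) volume).ae
      (compl_mem_ae_iff.2 (measure_singleton (0 : V)))
    exact h
  set F : V × V → ℝ → ℂ := fun p t =>
    (t : ℂ) ^ (b - 1) * expKernel ((t : ℂ) - Complex.I) (p.1 - p.2) * (f p.2 * g p.1) with hF
  have hfm := hf.measurable
  have hgm := hg.measurable
  have hFm : Measurable (Function.uncurry F) := by
    simp only [hF, Function.uncurry_def, expKernel]; fun_prop
  have hint : Integrable (Function.uncurry F)
      ((volume : Measure (V × V)).prod (volume.restrict (Ioi (0 : ℝ)))) := by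
    have hG : ∀ r : ℝ, 0 < r → IntegrableOn (fun t : ℝ => t ^ (b.re - 1) * Real.exp (-(r * t))) (Ioi 0) :=
      fun r hr => integrableOn_rpow_mul_exp hr (by linarith)
    refine (integrable_prod_iff hFm.aestronglyMeasurable).2 ⟨?_, ?_⟩
    · filter_upwards [hne] with p hp
      simp only [Function.uncurry_apply_pair, hF]
      refine Integrable.mul_const ?_ _
      refine (integrable_norm_iff (by unfold expKernel; fun_prop)).1 ?_
      refine (hG ‖p.1 - p.2‖ (norm_pos_iff.2 hp)).congr ?_
      filter_upwards [ae_restrict_mem measurableSet_Ioi] with t ht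
      exact (norm_cpow_mul_expKernel b ht _).symm
    -- The absolute integral in `t` is Γ(re b)|y|^{-re b}, which is locally integrable because re b
    -- < dim. This justifies Fubini.
    · have h1 := (integrable_form (k := fun y : V => ((‖y‖ ^ (-b.re) : ℝ) : ℂ)) (by fun_prop)
        (fun x => by
          obtain ⟨U, hU, h⟩ := locallyIntegrable_norm_rpow hd hbd x
          exact ⟨U, hU, h.ofReal⟩) hf hg).norm.const_mul (Real.Gamma b.re)
      refine h1.congr ?_
      filter_upwards [hne] with p hp
      have hr : 0 < ‖p.1 - p.2‖ := norm_pos_iff.2 hp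
      simp only [Function.uncurry_apply_pair, hF, norm_mul _ (f p.2 * g p.1)]
      rw [integral_mul_const, setIntegral_congr_fun measurableSet_Ioi
        (fun t ht => norm_cpow_mul_expKernel b ht (p.1 - p.2)),
        Real.integral_rpow_mul_exp_neg_mul_Ioi hb hr, norm_mul, norm_mul, norm_mul,
        Complex.norm_real, Real.norm_of_nonneg (by positivity), one_div, Real.inv_rpow hr.le,
        Real.rpow_neg hr.le]
      ring
  have h2 := integral_integral_swap hint
  calc Complex.Gamma b * form (powKernel b) f g
      = ∫ p, ∫ t in Ioi (0 : ℝ), F p t := by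
        rw [form, ← integral_const_mul]
        refine integral_congr_ae ?_
        filter_upwards [hne] with p hp
        simp only [hF]
        rw [integral_mul_const, integral_cpow_mul_expKernel hb hp]
        ring
    _ = _ := h2
    _ = _ := by
        refine integral_congr_ae (ae_of_all _ fun t => ?_)
        simp only [hF, form, ← integral_const_mul]
        refine integral_congr_ae (ae_of_all _ fun p => ?_)
        ring

end PowKernel

/-! ### Weighted estimates on the Fourier side -/

section WeightedBounds

open scoped FourierTransform Real

variable {V : Type*} [NormedAddCommGroup V] [InnerProductSpace ℝ V] [FiniteDimensional ℝ V]
  [MeasurableSpace V] [BorelSpace V]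

local notation "dim" => (Module.finrank ℝ V : ℝ)

/-- For real `t` the multiplier is positive, so the form at (f, conj f) is exactly this weighted
integral and `formBound_expKernel` applies. -/
theorem integral_norm_expMultiplier_ofReal_le {t : ℝ} (ht : 0 < t) {x : ℝ} (hx₀ : 1 / 2 ≤ x)
    (hx₁ : x ≤ 1) {f : V → ℂ} (hf : IsNice f) :
    ∫ ξ, ‖expMultiplier (t : ℂ) ξ‖ * ‖𝓕⁻ f ξ‖ ^ 2 ≤
      4 * (plancherelConst V * (mulConst dim * t ^ (-dim))) ^ (2 - 2 * x) * recipNorm x f ^ 2 := by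
  have hc := mulConst_pos (d := dim) (by positivity)
  have h := formBound_expKernel (V := V) (a := (t : ℂ)) (by simpa using ht)
    (norm_expMultiplier_ofReal_le ht) hx₀ hx₁ f _ hf hf.conj
  rw [recipNorm_conj, form_expKernel_conj (by simpa using ht) hf, mul_assoc, ← sq] at h
  refine le_trans (le_of_eq ?_) h
  have e : ∀ ξ : V, expMultiplier (t : ℂ) ξ * ((‖𝓕⁻ f ξ‖ ^ 2 : ℝ) : ℂ) =
      ((‖expMultiplier (t : ℂ) ξ‖ * ‖𝓕⁻ f ξ‖ ^ 2 : ℝ) : ℂ) := fun ξ => by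
    rw [expMultiplier_ofReal, Complex.norm_real, Real.norm_of_nonneg (by positivity)]
    push_cast; rfl
  simp only [e]
  rw [integral_complex_ofReal, Complex.norm_real, Real.norm_of_nonneg
    (integral_nonneg fun ξ => by positivity)]

theorem lintegral_one_add_sq_rpow_le {x : ℝ} (hx₀ : 1 / 2 ≤ x) (hx₁ : x ≤ 1) :
    ∃ C : ℝ, 0 ≤ C ∧ ∀ f : V → ℂ, IsNice f →
      ∫⁻ ξ, ENNReal.ofReal ((1 + (2 * π * ‖ξ‖) ^ 2) ^ (-((dim + 1) / 2)) * ‖𝓕⁻ f ξ‖ ^ 2) ≤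
        ENNReal.ofReal (C * recipNorm x f ^ 2) := by
  have hc := mulConst_pos (d := dim) (by positivity)
  have hP := plancherelConst_nonneg (V := V)
  refine ⟨4 * (plancherelConst V * mulConst dim) ^ (2 - 2 * x) / mulConst dim, by positivity,
    fun f hf => ?_⟩
  have h := integral_norm_expMultiplier_ofReal_le (V := V) one_pos hx₀ hx₁ hf
  have e : ∀ ξ : V, ‖expMultiplier ((1 : ℝ) : ℂ) ξ‖ * ‖𝓕⁻ f ξ‖ ^ 2 =
      mulConst dim * ((1 + (2 * π * ‖ξ‖) ^ 2) ^ (-((dim + 1) / 2)) * ‖𝓕⁻ f ξ‖ ^ 2) := fun ξ => by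
    rw [expMultiplier_ofReal, Complex.norm_real, Real.norm_of_nonneg (by positivity)]
    norm_num; ring
  have hi : Integrable (fun ξ : V => ‖expMultiplier ((1 : ℝ) : ℂ) ξ‖ * ‖𝓕⁻ f ξ‖ ^ 2) := by
    refine ((hf.integrable_mul_fourierInv_sq (integrable_expMultiplier (V := V)
      (a := ((1 : ℝ) : ℂ)) (by simp))).norm).congr (ae_of_all _ fun ξ => ?_)
    simp
  simp only [e] at h hi
  rw [integral_const_mul, Real.one_rpow, mul_one] at h
  have hi' := (hi.const_mul (mulConst dim)⁻¹)
  simp only [inv_mul_cancel_left₀ hc.ne'] at hi'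
  rw [← ofReal_integral_eq_lintegral_ofReal hi' (ae_of_all _ fun ξ => by positivity)]
  refine ENNReal.ofReal_le_ofReal ?_
  rw [div_mul_eq_mul_div, le_div_iff₀ hc]
  linarith

/-- Cauchy–Schwarz and Plancherel. The weight takes values in `ℝ≥0∞`, so it need not be finite on
the critical sphere. -/
theorem lintegral_mul_fourier_le {w : V → ℝ≥0∞} (hw : Measurable w) {f g : V → ℂ} (hf : IsNice f)
    (hg : IsNice g) {B : ℝ} (hB : 0 ≤ B)
    (h : ∫⁻ ξ, w ξ ^ 2 * ENNReal.ofReal (‖𝓕⁻ f ξ‖ ^ 2) ≤ ENNReal.ofReal B) :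
    ∫⁻ ξ, w ξ * ENNReal.ofReal (‖𝓕⁻ f ξ‖ * ‖𝓕 g ξ‖) ≤
      ENNReal.ofReal (√B * (√(plancherelConst V) * recipNorm (1 / 2) g)) := by
  have hfm := hf.continuous_fourierInv.measurable
  have hgm := hg.continuous_fourier.measurable
  have hP := plancherelConst_nonneg (V := V)
  have h1 := ENNReal.lintegral_mul_le_Lp_mul_Lq (volume : Measure V) Real.HolderConjugate.two_two
    (f := fun ξ => w ξ * ENNReal.ofReal ‖𝓕⁻ f ξ‖) (g := fun ξ => ENNReal.ofReal ‖𝓕 g ξ‖)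
    (by fun_prop) (by fun_prop)
  have e1 : ∀ ξ, (w ξ * ENNReal.ofReal ‖𝓕⁻ f ξ‖) ^ (2 : ℝ) =
      w ξ ^ 2 * ENNReal.ofReal (‖𝓕⁻ f ξ‖ ^ 2) := fun ξ => by
    rw [ENNReal.rpow_two, mul_pow, ENNReal.ofReal_pow (norm_nonneg _)]
  have e2 : ∀ ξ, (ENNReal.ofReal ‖𝓕 g ξ‖) ^ (2 : ℝ) = ENNReal.ofReal (‖𝓕 g ξ‖ ^ 2) := fun ξ => by
    rw [ENNReal.rpow_two, ENNReal.ofReal_pow (norm_nonneg _)]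
  have h2 : ∫⁻ ξ, ENNReal.ofReal (‖𝓕 g ξ‖ ^ 2) ≤
      ENNReal.ofReal (plancherelConst V * recipNorm (1 / 2) g ^ 2) := by
    rw [← ofReal_integral_eq_lintegral_ofReal hg.integrable_fourier_sq
      (ae_of_all _ fun ξ => by positivity)]
    exact ENNReal.ofReal_le_ofReal (integral_fourier_sq_le hg)
  simp only [Pi.mul_apply, e1, e2] at h1
  calc _ = ∫⁻ ξ, w ξ * ENNReal.ofReal ‖𝓕⁻ f ξ‖ * ENNReal.ofReal ‖𝓕 g ξ‖ :=
        lintegral_congr fun ξ => by rw [ENNReal.ofReal_mul (norm_nonneg _), mul_assoc]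
    _ ≤ _ := h1
    _ ≤ (ENNReal.ofReal B) ^ (1 / 2 : ℝ) *
        (ENNReal.ofReal (plancherelConst V * recipNorm (1 / 2) g ^ 2)) ^ (1 / 2 : ℝ) := by
        gcongr
    _ = _ := by
        rw [ENNReal.ofReal_rpow_of_nonneg hB (by norm_num),
          ENNReal.ofReal_rpow_of_nonneg (by positivity) (by norm_num), ← ENNReal.ofReal_mul
          (by positivity), ← Real.sqrt_eq_rpow, ← Real.sqrt_eq_rpow, Real.sqrt_mul hP,
          Real.sqrt_sq (recipNorm_nonneg _ _)]

/-- The first factor has real part t and imaginary part ρ - 1. The second has imaginary part -(1+ρ).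
-/
theorem add_abs_mul_le_norm {t ρ : ℝ} (hρ : 0 ≤ ρ) :
    (t + |ρ - 1|) * (1 + ρ) / 2 ≤ ‖((t : ℂ) - Complex.I) ^ 2 + (ρ : ℂ) ^ 2‖ := by
  rw [norm_sq_add_sq]
  have h1 : (t + |ρ - 1|) / 2 ≤ ‖(t : ℂ) - Complex.I + ρ * Complex.I‖ := by
    have h2 := Complex.re_le_norm ((t : ℂ) - Complex.I + ρ * Complex.I)
    have h3 := Complex.abs_im_le_norm ((t : ℂ) - Complex.I + ρ * Complex.I)
    simp only [Complex.add_re, Complex.add_im, Complex.sub_re, Complex.sub_im, Complex.ofReal_im,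
      Complex.I_im, Complex.I_re, Complex.mul_im, Complex.mul_re, Complex.ofReal_re, mul_zero,
      mul_one, add_zero, zero_sub, sub_zero] at h2 h3
    rw [show -1 + ρ = ρ - 1 by ring] at h3
    linarith
  have h4 : 1 + ρ ≤ ‖(t : ℂ) - Complex.I - ρ * Complex.I‖ := by
    have := Complex.abs_im_le_norm ((t : ℂ) - Complex.I - ρ * Complex.I)
    simp only [Complex.sub_im, Complex.ofReal_im, Complex.I_im, Complex.mul_im, Complex.ofReal_re,
      Complex.I_re, mul_zero, mul_one, add_zero] at this
    have h4 := neg_abs_le (0 - 1 - ρ)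
    linarith
  calc _ = (t + |ρ - 1|) / 2 * (1 + ρ) := by ring
    _ ≤ _ := mul_le_mul h1 h4 (by positivity) (norm_nonneg _)

/-- For t ≥ 1 the shift by -i costs only a factor 2, so multipliers at t - i are comparable with the
positive ones at t. -/
theorem sq_add_sq_le_norm {t : ℝ} (ht : 1 ≤ t) (ρ : ℝ) :
    (t ^ 2 + ρ ^ 2) / 2 ≤ ‖((t : ℂ) - Complex.I) ^ 2 + (ρ : ℂ) ^ 2‖ := by
  have h : ((t ^ 2 + ρ ^ 2) / 2) ^ 2 ≤ ‖((t : ℂ) - Complex.I) ^ 2 + (ρ : ℂ) ^ 2‖ ^ 2 := by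
    rw [← Complex.normSq_eq_norm_sq, Complex.normSq_apply]
    simp only [sq, Complex.add_re, Complex.add_im, Complex.sub_re, Complex.sub_im, Complex.ofReal_im,
      Complex.I_im, Complex.I_re, Complex.mul_im, Complex.mul_re, Complex.ofReal_re]
    nlinarith [sq_nonneg (ρ ^ 2 - 2), sq_nonneg (t ^ 2 - 1),
      mul_nonneg (sub_nonneg.2 ht) (sub_nonneg.2 ht), sq_nonneg (ρ * t), sq_nonneg (ρ ^ 2 - t ^ 2),
      mul_nonneg (mul_self_nonneg ρ) (show 0 ≤ t * t - 1 by nlinarith)]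
  exact le_of_sq_le_sq h (norm_nonneg _)

theorem norm_expMultiplier_sub_I_le_of_le_one {t : ℝ} (ht : 0 < t) (ht1 : t ≤ 1) (ξ : V) :
    ‖expMultiplier ((t : ℂ) - Complex.I) ξ‖ ≤ mulConst dim * 2 * 2 ^ ((dim + 1) / 2) *
      (1 + 2 * π * ‖ξ‖) ^ (-((dim + 1) / 2)) * (t + |2 * π * ‖ξ‖ - 1|) ^ (-((dim + 1) / 2)) := by
  have hc := mulConst_pos (d := dim) (by positivity)
  have hd : 0 ≤ dim := by positivity
  rw [norm_expMultiplier]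
  calc _ ≤ mulConst dim * 2 * ((t + |2 * π * ‖ξ‖ - 1|) * (1 + 2 * π * ‖ξ‖) / 2) ^ (-((dim + 1) / 2)) := by
        gcongr mulConst dim * ?_ * ?_
        · exact (norm_ofReal_sub_I_le ht).trans (by linarith)
        · exact Real.rpow_le_rpow_of_nonpos (by positivity)
            (add_abs_mul_le_norm (by positivity)) (by linarith)
    _ = _ := by
        rw [Real.div_rpow (by positivity) zero_le_two, Real.mul_rpow (by positivity) (by positivity),
          Real.rpow_neg zero_le_two, div_inv_eq_mul]
        ring

theorem norm_expMultiplier_sub_I_le_of_one_le {t : ℝ} (ht : 1 ≤ t) (ξ : V) :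
    ‖expMultiplier ((t : ℂ) - Complex.I) ξ‖ ≤
      2 * 2 ^ ((dim + 1) / 2) * ‖expMultiplier (t : ℂ) ξ‖ := by
  have hc := mulConst_pos (d := dim) (by positivity)
  have hd : 0 ≤ dim := by positivity
  have ht0 : 0 < t := by linarith
  rw [norm_expMultiplier, expMultiplier_ofReal, Complex.norm_real, Real.norm_of_nonneg (by positivity)]
  calc _ ≤ mulConst dim * (2 * t) * ((t ^ 2 + (2 * π * ‖ξ‖) ^ 2) / 2) ^ (-((dim + 1) / 2)) := by
        gcongr mulConst dim * ?_ * ?_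
        · exact (norm_ofReal_sub_I_le ht0).trans (by linarith)
        · exact Real.rpow_le_rpow_of_nonpos (by positivity)
            (sq_add_sq_le_norm ht _) (by linarith)
    _ = _ := by
        rw [Real.div_rpow (by positivity) zero_le_two,
          Real.rpow_neg zero_le_two, div_inv_eq_mul]
        ring

/-- Layer-cake formula: for r ≤ 1, r^{-s} = 1 + s ∫_r^1 l^{-s-1} dl. It resolves a power of the
distance to the sphere into annuli. -/
theorem ofReal_rpow_le_lintegral {s r : ℝ} (hs : 0 < s) (hr : 0 < r) :
    ENNReal.ofReal (r ^ (-s)) ≤ 1 + ENNReal.ofReal s *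
      ∫⁻ l in Ioc (0 : ℝ) 1, (if r < l then ENNReal.ofReal (l ^ (-s - 1)) else 0) := by
  rcases le_total 1 r with h | h
  · refine le_trans ?_ le_self_add
    rw [← ENNReal.ofReal_one]
    exact ENNReal.ofReal_le_ofReal (Real.rpow_le_one_of_one_le_of_nonpos h (by linarith))
  have h1 : ENNReal.ofReal ((r ^ (-s) - 1) / s) = ∫⁻ l in Ioc r 1, ENNReal.ofReal (l ^ (-s - 1)) := by
    have hn : (0 : ℝ) ∉ uIcc r 1 := by rw [uIcc_of_le h]; exact fun hc => absurd hc.1 (not_le.2 hr)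
    rw [← ofReal_integral_eq_lintegral_ofReal, ← intervalIntegral.integral_of_le h,
      integral_rpow (Or.inr ⟨by linarith, hn⟩)]
    · congr 1
      rw [show -s - 1 + 1 = -s by ring, Real.one_rpow]
      field_simp; ring
    · exact (intervalIntegrable_iff_integrableOn_Ioc_of_le h).1
        (intervalIntegral.intervalIntegrable_rpow (Or.inr hn))
    · filter_upwards [ae_restrict_mem measurableSet_Ioc] with l hl
      have : 0 < l := hr.trans hl.1
      positivity
  have h2 : ∫⁻ l in Ioc r 1, ENNReal.ofReal (l ^ (-s - 1)) ≤
      ∫⁻ l in Ioc (0 : ℝ) 1, (if r < l then ENNReal.ofReal (l ^ (-s - 1)) else 0) := by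
    calc _ = ∫⁻ l in Ioc r 1, (if r < l then ENNReal.ofReal (l ^ (-s - 1)) else 0) :=
          setLIntegral_congr_fun measurableSet_Ioc fun l hl => by simp only [if_pos hl.1]
      _ ≤ _ := lintegral_mono_set (Ioc_subset_Ioc_left hr.le)
  calc ENNReal.ofReal (r ^ (-s)) = ENNReal.ofReal (1 + s * ((r ^ (-s) - 1) / s)) := by
        congr 1; field_simp; ring
    _ = 1 + ENNReal.ofReal s * ENNReal.ofReal ((r ^ (-s) - 1) / s) := by
        rw [ENNReal.ofReal_add zero_le_one, ENNReal.ofReal_mul hs.le, ENNReal.ofReal_one]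
        rw [mul_div_cancel₀ _ hs.ne', sub_nonneg]
        exact Real.one_le_rpow_of_pos_of_le_one_of_nonpos hr h (by linarith)
    _ ≤ _ := by rw [h1]; gcongr

end WeightedBounds

/-! ### The endpoint bound on vertical lines -/

section HalfLine

open scoped FourierTransform Real

variable {V : Type*} [NormedAddCommGroup V] [InnerProductSpace ℝ V] [FiniteDimensional ℝ V]
  [MeasurableSpace V] [BorelSpace V]

local notation "dim" => (Module.finrank ℝ V : ℝ)

/-- The Mellin transform over `(0, 1]` of the size of the multipliers of `exp (-(t - i)|y|)`. -/
noncomputable def mellinWeight (β : ℝ) (ξ : V) : ℝ≥0∞ :=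
  ∫⁻ t in Ioc (0 : ℝ) 1, ENNReal.ofReal (t ^ (β - 1) * ‖expMultiplier ((t : ℂ) - Complex.I) ξ‖)

theorem measurable_uncurry_expMultiplier :
    Measurable fun p : V × ℝ => expMultiplier ((p.2 : ℂ) - Complex.I) p.1 := by
  unfold expMultiplier; fun_prop

theorem measurable_mellinWeight (β : ℝ) : Measurable (mellinWeight β : V → ℝ≥0∞) := by
  have h := measurable_uncurry_expMultiplier (V := V)
  have h2 : Measurable (Function.uncurry fun (ξ : V) (t : ℝ) =>
      ENNReal.ofReal (t ^ (β - 1) * ‖expMultiplier ((t : ℂ) - Complex.I) ξ‖)) := by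
    simp only [Function.uncurry_def]
    fun_prop
  exact h2.lintegral_prod_right'

/-- With r = |ρ - 1|, the power (dim+1)/2 - s - 1 is positive, so `t` may be replaced by t + r
there. What remains is ∫ (t+r)^{-s-1} dt = r^{-s}/s. -/
theorem mellinWeight_le (hd : 3 ≤ dim) {s : ℝ} (hs : 0 < s) (hs' : s < 1 / 2) {ξ : V}
    (hξ : 2 * π * ‖ξ‖ ≠ 1) :
    mellinWeight ((dim + 1) / 2 - s) ξ ≤
      ENNReal.ofReal (mulConst dim * 2 * 2 ^ ((dim + 1) / 2) * s⁻¹ *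
        (1 + 2 * π * ‖ξ‖) ^ (-((dim + 1) / 2)) * |2 * π * ‖ξ‖ - 1| ^ (-s)) := by
  have hc := mulConst_pos (d := dim) (by positivity)
  set ρ := 2 * π * ‖ξ‖ with hρ
  have hρ0 : 0 ≤ ρ := by positivity
  set r := |ρ - 1| with hr
  have hr0 : 0 < r := abs_pos.2 (sub_ne_zero.2 hξ)
  set D := mulConst dim * 2 * 2 ^ ((dim + 1) / 2) * (1 + ρ) ^ (-((dim + 1) / 2)) with hD
  have hD0 : 0 ≤ D := by positivity
  calc mellinWeight ((dim + 1) / 2 - s) ξ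
      ≤ ∫⁻ t in Ioc (0 : ℝ) 1, ENNReal.ofReal (D * (t + r) ^ (-s - 1)) := by
        refine setLIntegral_mono' measurableSet_Ioc fun t ht => ENNReal.ofReal_le_ofReal ?_
        have ht0 : 0 < t := ht.1
        calc _ ≤ (t + r) ^ ((dim + 1) / 2 - s - 1) * (D * (t + r) ^ (-((dim + 1) / 2))) := by
              gcongr
              · linarith
              · linarith
              · exact norm_expMultiplier_sub_I_le_of_le_one ht0 ht.2 ξ
          _ = D * ((t + r) ^ ((dim + 1) / 2 - s - 1) * (t + r) ^ (-((dim + 1) / 2))) := by ring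
          _ = _ := by
              rw [← Real.rpow_add (by positivity)]; congr 2; ring
    _ ≤ ∫⁻ t in Ioi (0 : ℝ), ENNReal.ofReal (D * (t + r) ^ (-s - 1)) :=
        lintegral_mono_set Ioc_subset_Ioi_self
    _ = ENNReal.ofReal (D * (r ^ (-s) / s)) := by
        have hA : -s - 1 < -1 := by linarith
        rw [← ofReal_integral_eq_lintegral_ofReal ((integrableOn_add_rpow hA hr0).const_mul D),
          integral_const_mul, integral_add_rpow hA hr0]
        · rw [show -s - 1 + 1 = -s by ring, neg_neg]
        · filter_upwards [ae_restrict_mem measurableSet_Ioi] with t ht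
          have : 0 < t := ht
          positivity
    _ = _ := by congr 1; rw [hD]; ring

theorem mellinWeight_sq_le (hd : 3 ≤ dim) {s : ℝ} (hs : 0 < s) (hs' : s < 1 / 2) :
    ∃ E : ℝ, 0 ≤ E ∧ ∀ ξ : V, 2 * π * ‖ξ‖ ≠ 1 →
      mellinWeight ((dim + 1) / 2 - s) ξ ^ 2 ≤ ENNReal.ofReal E *
        (ENNReal.ofReal ((1 + (2 * π * ‖ξ‖) ^ 2) ^ (-((dim + 1) / 2))) +
          ENNReal.ofReal (2 * s) * ∫⁻ l in Ioc (0 : ℝ) 1,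
            (if |2 * π * ‖ξ‖ - 1| < l then ENNReal.ofReal (l ^ (-(2 * s) - 1)) else 0)) := by
  have hc := mulConst_pos (d := dim) (by positivity)
  refine ⟨(mulConst dim * 2 * 2 ^ ((dim + 1) / 2) * s⁻¹) ^ 2, by positivity, fun ξ hξ => ?_⟩
  set A := mulConst dim * 2 * 2 ^ ((dim + 1) / 2) * s⁻¹ with hA
  have hA0 : 0 ≤ A := by positivity
  set ρ := 2 * π * ‖ξ‖ with hρ
  have hρ0 : 0 ≤ ρ := by positivity
  have hr0 : 0 < |ρ - 1| := abs_pos.2 (sub_ne_zero.2 hξ)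
  have h1 : ((1 + ρ) ^ (-((dim + 1) / 2))) ^ 2 ≤ (1 + ρ ^ 2) ^ (-((dim + 1) / 2)) := by
    rw [← Real.rpow_natCast, ← Real.rpow_mul (by positivity), mul_comm, Real.rpow_mul (by positivity)]
    refine Real.rpow_le_rpow_of_nonpos (by positivity) ?_ (by linarith)
    rw [Real.rpow_natCast]
    nlinarith
  have h2 : (1 + ρ ^ 2) ^ (-((dim + 1) / 2)) ≤ 1 :=
    Real.rpow_le_one_of_one_le_of_nonpos (by nlinarith) (by linarith)
  have h3 : (|ρ - 1| ^ (-s)) ^ 2 = |ρ - 1| ^ (-(2 * s)) := by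
    rw [← Real.rpow_natCast, ← Real.rpow_mul (by positivity)]; congr 1; push_cast; ring
  set U := ∫⁻ l in Ioc (0 : ℝ) 1, (if |ρ - 1| < l then ENNReal.ofReal (l ^ (-(2 * s) - 1)) else 0)
  calc _ ≤ ENNReal.ofReal (A * (1 + ρ) ^ (-((dim + 1) / 2)) * |ρ - 1| ^ (-s)) ^ 2 := by
        gcongr; exact mellinWeight_le hd hs hs' hξ
    _ = ENNReal.ofReal (A ^ 2) * (ENNReal.ofReal (((1 + ρ) ^ (-((dim + 1) / 2))) ^ 2) *
          ENNReal.ofReal (|ρ - 1| ^ (-(2 * s)))) := by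
        rw [← ENNReal.ofReal_pow (by positivity), mul_pow, mul_pow, h3, mul_assoc,
          ENNReal.ofReal_mul (by positivity), ENNReal.ofReal_mul (by positivity)]
    _ ≤ ENNReal.ofReal (A ^ 2) * (ENNReal.ofReal ((1 + ρ ^ 2) ^ (-((dim + 1) / 2))) *
          (1 + ENNReal.ofReal (2 * s) * U)) := by
        gcongr
        exact ofReal_rpow_le_lintegral (by positivity) hr0
    _ ≤ _ := by
        rw [mul_add, mul_one]
        refine mul_le_mul_right (add_le_add le_rfl ?_) _
        calc _ ≤ ENNReal.ofReal 1 * (ENNReal.ofReal (2 * s) * U) := by gcongr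
          _ = _ := by rw [ENNReal.ofReal_one, one_mul]

/-- The annular part of the squared weight is summed by `lintegral_annulus_le` at the critical
exponent, (dim+1)(x-1/2) = 2s. The rest is the multiplier of e^{-|y|}. -/
theorem lintegral_mellinWeight_le (hd : 3 ≤ dim) {s : ℝ} (hs : 0 < s) (hs' : s < 1 / 2) :
    ∃ C : ℝ, 0 ≤ C ∧ ∀ f : V → ℂ, IsNice f →
      ∫⁻ ξ, mellinWeight ((dim + 1) / 2 - s) ξ ^ 2 * ENNReal.ofReal (‖𝓕⁻ f ξ‖ ^ 2) ≤
        ENNReal.ofReal (C * recipNorm (1 / 2 + 2 * s / (dim + 1)) f ^ 2) := by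
  have hd1 : 0 < dim + 1 := by linarith
  have hx : 1 / 2 < 1 / 2 + 2 * s / (dim + 1) := by
    have : 0 < 2 * s / (dim + 1) := by positivity
    linarith
  have hx' : 1 / 2 + 2 * s / (dim + 1) < 1 / 2 + 1 / (dim + 1) := by
    gcongr; linarith
  have hx1 : 1 / 2 + 2 * s / (dim + 1) ≤ 1 := by
    have : 1 / (dim + 1) ≤ 1 / 4 := one_div_le_one_div_of_le (by norm_num) (by linarith)
    linarith
  have hex : (dim + 1) * (1 / 2 + 2 * s / (dim + 1) - 1 / 2) = 2 * s := by field_simp; ring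
  obtain ⟨E, hE, hE'⟩ := mellinWeight_sq_le hd hs hs'
  obtain ⟨C₁, hC₁, h₁⟩ := lintegral_one_add_sq_rpow_le (V := V) hx.le hx1
  obtain ⟨C₂, hC₂, h₂⟩ := lintegral_annulus_le hd hx hx'
  rw [hex] at h₂
  refine ⟨E * (C₁ + 2 * s * C₂), by positivity, fun f hf => ?_⟩
  set N := recipNorm (1 / 2 + 2 * s / (dim + 1)) f
  have hfm := hf.continuous_fourierInv.measurable
  have hae : ∀ᵐ ξ : V, 2 * π * ‖ξ‖ ≠ 1 := by
    have h := Measure.addHaar_sphere_of_ne_zero (volume : Measure V) 0 (r := (2 * π)⁻¹) (by positivity)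
    filter_upwards [compl_mem_ae_iff.2 h] with ξ hξ hc
    refine hξ (mem_sphere_zero_iff_norm.2 ?_)
    rw [eq_comm, inv_eq_of_mul_eq_one_right hc]
  have hswap : ∫⁻ ξ, (∫⁻ l in Ioc (0 : ℝ) 1,
        (if |2 * π * ‖ξ‖ - 1| < l then ENNReal.ofReal (l ^ (-(2 * s) - 1)) else 0)) *
          ENNReal.ofReal (‖𝓕⁻ f ξ‖ ^ 2) =
      ∫⁻ l in Ioc (0 : ℝ) 1, ENNReal.ofReal (l ^ (-(2 * s) - 1) *
        ∫ ξ in annulus V l, ‖𝓕⁻ f ξ‖ ^ 2) := by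
    have hm : Measurable (Function.uncurry fun (ξ : V) (l : ℝ) =>
        (if |2 * π * ‖ξ‖ - 1| < l then ENNReal.ofReal (l ^ (-(2 * s) - 1)) else 0) *
          ENNReal.ofReal (‖𝓕⁻ f ξ‖ ^ 2)) := by
      simp only [Function.uncurry_def]
      refine Measurable.mul (Measurable.ite ?_ (by fun_prop) measurable_const) (by fun_prop)
      exact measurableSet_lt (by fun_prop) (by fun_prop)
    calc _ = ∫⁻ ξ, ∫⁻ l in Ioc (0 : ℝ) 1,
        (if |2 * π * ‖ξ‖ - 1| < l then ENNReal.ofReal (l ^ (-(2 * s) - 1)) else 0) *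
          ENNReal.ofReal (‖𝓕⁻ f ξ‖ ^ 2) :=
          lintegral_congr fun ξ => (lintegral_mul_const' _ _ ENNReal.ofReal_ne_top).symm
      _ = ∫⁻ l in Ioc (0 : ℝ) 1, ∫⁻ ξ,
        (if |2 * π * ‖ξ‖ - 1| < l then ENNReal.ofReal (l ^ (-(2 * s) - 1)) else 0) *
          ENNReal.ofReal (‖𝓕⁻ f ξ‖ ^ 2) := lintegral_lintegral_swap hm.aemeasurable
      _ = _ := by
        refine setLIntegral_congr_fun measurableSet_Ioc fun l hl => ?_
        have hl0 : 0 < l := hl.1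
        rw [ENNReal.ofReal_mul (by positivity), ofReal_integral_eq_lintegral_ofReal
          hf.integrable_fourierInv_sq.integrableOn (ae_of_all _ fun ξ => by positivity),
          ← lintegral_const_mul' _ _ ENNReal.ofReal_ne_top,
          ← lintegral_indicator (measurableSet_annulus l)]
        refine lintegral_congr fun ξ => ?_
        simp only [indicator, show ξ ∈ annulus V l ↔ |2 * Real.pi * ‖ξ‖ - 1| < l from Iff.rfl]
        split_ifs <;> simp
  have hm2 : Measurable fun ξ : V => ∫⁻ l in Ioc (0 : ℝ) 1,
        (if |2 * π * ‖ξ‖ - 1| < l then ENNReal.ofReal (l ^ (-(2 * s) - 1)) else 0) := by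
    have hm : Measurable (Function.uncurry fun (ξ : V) (l : ℝ) =>
        (if |2 * π * ‖ξ‖ - 1| < l then ENNReal.ofReal (l ^ (-(2 * s) - 1)) else 0)) := by
      simp only [Function.uncurry_def]
      refine (Measurable.ite ?_ (by fun_prop) measurable_const)
      exact measurableSet_lt (by fun_prop) (by fun_prop)
    exact hm.lintegral_prod_right'
  calc _ ≤ ∫⁻ ξ, ENNReal.ofReal E *
        (ENNReal.ofReal ((1 + (2 * π * ‖ξ‖) ^ 2) ^ (-((dim + 1) / 2)) * ‖𝓕⁻ f ξ‖ ^ 2) +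
          ENNReal.ofReal (2 * s) * ((∫⁻ l in Ioc (0 : ℝ) 1,
            (if |2 * π * ‖ξ‖ - 1| < l then ENNReal.ofReal (l ^ (-(2 * s) - 1)) else 0)) *
          ENNReal.ofReal (‖𝓕⁻ f ξ‖ ^ 2))) := by
        refine lintegral_mono_ae ?_
        filter_upwards [hae] with ξ hξ
        rw [ENNReal.ofReal_mul (by positivity), ← mul_assoc (ENNReal.ofReal (2 * s)), ← add_mul,
          ← mul_assoc]
        gcongr
        exact hE' ξ hξ
    _ ≤ ENNReal.ofReal E * (ENNReal.ofReal (C₁ * N ^ 2) +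
          ENNReal.ofReal (2 * s) * ENNReal.ofReal (C₂ * N ^ 2)) := by
        rw [lintegral_const_mul' _ _ ENNReal.ofReal_ne_top, lintegral_add_left (by fun_prop),
          lintegral_const_mul' _ _ ENNReal.ofReal_ne_top, hswap]
        gcongr
        · exact h₁ f hf
        · exact h₂ f hf
    _ = _ := by
        rw [← ENNReal.ofReal_mul (by positivity), ← ENNReal.ofReal_add (by positivity) (by positivity),
          ← ENNReal.ofReal_mul hE]
        congr 1; ring

theorem lintegral_form_expKernel_Ioc_le (hd : 3 ≤ dim) {s : ℝ} (hs : 0 < s) (hs' : s < 1 / 2) :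
    ∃ C : ℝ, 0 ≤ C ∧ ∀ f g : V → ℂ, IsNice f → IsNice g →
      ∫⁻ t in Ioc (0 : ℝ) 1, ENNReal.ofReal (t ^ ((dim + 1) / 2 - s - 1) *
        ‖form (expKernel ((t : ℂ) - Complex.I)) f g‖) ≤
      ENNReal.ofReal (C * recipNorm (1 / 2 + 2 * s / (dim + 1)) f * recipNorm (1 / 2) g) := by
  obtain ⟨C, hC, h⟩ := lintegral_mellinWeight_le hd hs hs'
  refine ⟨√C * √(plancherelConst V), by positivity, fun f g hf hg => ?_⟩
  set β := (dim + 1) / 2 - s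
  have hfm := hf.continuous_fourierInv.measurable
  have hgm := hg.continuous_fourier.measurable
  have hmm := measurable_uncurry_expMultiplier (V := V)
  have h1 := lintegral_mul_fourier_le (measurable_mellinWeight β) hf hg (by positivity) (h f hf)
  have hm : Measurable (Function.uncurry fun (ξ : V) (t : ℝ) => ENNReal.ofReal (t ^ (β - 1) *
      ‖expMultiplier ((t : ℂ) - Complex.I) ξ‖) * ENNReal.ofReal (‖𝓕⁻ f ξ‖ * ‖𝓕 g ξ‖)) := by
    simp only [Function.uncurry_def]; fun_prop
  calc _ ≤ ∫⁻ t in Ioc (0 : ℝ) 1, ∫⁻ ξ, ENNReal.ofReal (t ^ (β - 1) *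
        ‖expMultiplier ((t : ℂ) - Complex.I) ξ‖) * ENNReal.ofReal (‖𝓕⁻ f ξ‖ * ‖𝓕 g ξ‖) := by
        refine setLIntegral_mono' measurableSet_Ioc fun t ht => ?_
        have ht0 : 0 < t := ht.1
        rw [form_expKernel (by simpa using ht0) hf hg, ENNReal.ofReal_mul (by positivity), ofReal_norm]
        refine (mul_le_mul_right (enorm_integral_le_lintegral_enorm _) _).trans_eq ?_
        rw [← lintegral_const_mul' _ _ ENNReal.ofReal_ne_top]
        refine lintegral_congr fun ξ => ?_
        rw [enorm_mul, enorm_mul, ENNReal.ofReal_mul (by positivity), ENNReal.ofReal_mul (by positivity),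
          ofReal_norm, ofReal_norm, ofReal_norm, mul_assoc]
    _ = ∫⁻ ξ, ∫⁻ t in Ioc (0 : ℝ) 1, ENNReal.ofReal (t ^ (β - 1) *
        ‖expMultiplier ((t : ℂ) - Complex.I) ξ‖) * ENNReal.ofReal (‖𝓕⁻ f ξ‖ * ‖𝓕 g ξ‖) :=
        (lintegral_lintegral_swap hm.aemeasurable).symm
    _ = ∫⁻ ξ, mellinWeight β ξ * ENNReal.ofReal (‖𝓕⁻ f ξ‖ * ‖𝓕 g ξ‖) :=
        lintegral_congr fun ξ => lintegral_mul_const' _ _ ENNReal.ofReal_ne_top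
    _ ≤ _ := h1
    _ = _ := by
        rw [Real.sqrt_mul hC, Real.sqrt_sq (recipNorm_nonneg _ _)]
        congr 1; ring

/-- Cauchy–Schwarz with |m_{t-i}|² ≤ M² sup|m_t| · |m_t|. The supremum supplies t^{-d}, the positive
form of m_t supplies t^{-d(2-2x)}, and the square root gives the stated decay. -/
theorem norm_form_expKernel_le_of_one_le {x : ℝ} (hx₀ : 1 / 2 ≤ x) (hx₁ : x ≤ 1) :
    ∃ C : ℝ, 0 ≤ C ∧ ∀ t : ℝ, 1 ≤ t → ∀ f g : V → ℂ, IsNice f → IsNice g →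
      ‖form (expKernel ((t : ℂ) - Complex.I)) f g‖ ≤
        C * t ^ (-(dim / 2 + dim * (1 - x))) * recipNorm x f * recipNorm (1 / 2) g := by
  have hc := mulConst_pos (d := dim) (by positivity)
  have hP := plancherelConst_nonneg (V := V)
  set M : ℝ := 2 * 2 ^ ((dim + 1) / 2) with hM
  set B : ℝ := M ^ 2 * mulConst dim * (4 * (plancherelConst V * mulConst dim) ^ (2 - 2 * x)) with hB
  have hB0 : 0 ≤ B := by positivity
  refine ⟨√B * √(plancherelConst V), by positivity, fun t ht f g hf hg => ?_⟩
  have ht0 : 0 < t := by linarith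
  have hi0 : Integrable (fun ξ : V => ‖expMultiplier (t : ℂ) ξ‖ * ‖𝓕⁻ f ξ‖ ^ 2) := by
    refine ((hf.integrable_mul_fourierInv_sq (integrable_expMultiplier (V := V)
      (a := (t : ℂ)) (by simpa using ht0))).norm).congr (ae_of_all _ fun ξ => ?_)
    simp
  have hle : ∀ ξ : V, ‖expMultiplier ((t : ℂ) - Complex.I) ξ‖ ^ 2 * ‖𝓕⁻ f ξ‖ ^ 2 ≤
      M ^ 2 * (mulConst dim * t ^ (-dim)) * (‖expMultiplier (t : ℂ) ξ‖ * ‖𝓕⁻ f ξ‖ ^ 2) := fun ξ => by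
    calc _ ≤ (M * ‖expMultiplier (t : ℂ) ξ‖) ^ 2 * ‖𝓕⁻ f ξ‖ ^ 2 := by
          gcongr; exact norm_expMultiplier_sub_I_le_of_one_le ht ξ
      _ = M ^ 2 * ‖expMultiplier (t : ℂ) ξ‖ * (‖expMultiplier (t : ℂ) ξ‖ * ‖𝓕⁻ f ξ‖ ^ 2) := by ring
      _ ≤ _ := by gcongr; exact norm_expMultiplier_ofReal_le ht0 ξ
  have hi : Integrable (fun ξ : V => ‖expMultiplier ((t : ℂ) - Complex.I) ξ‖ ^ 2 * ‖𝓕⁻ f ξ‖ ^ 2) := by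
    refine (hi0.const_mul (M ^ 2 * (mulConst dim * t ^ (-dim)))).mono' ?_ (ae_of_all _ fun ξ => ?_)
    · have h1 := measurable_expMultiplier (V := V) ((t : ℂ) - Complex.I)
      have h2 := hf.continuous_fourierInv.measurable
      fun_prop
    · rw [Real.norm_of_nonneg (by positivity)]; exact hle ξ
  have h := integral_weight_mul_le (measurable_expMultiplier (V := V) ((t : ℂ) - Complex.I)).norm
    (fun ξ => norm_nonneg _) hf hg hi
  rw [form_expKernel (by simpa using ht0) hf hg]
  have hpow : (mulConst dim * t ^ (-dim)) * (4 * (plancherelConst V * (mulConst dim * t ^ (-dim)))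
      ^ (2 - 2 * x)) * M ^ 2 = B * (t ^ (-(dim / 2 + dim * (1 - x)))) ^ 2 := by
    rw [hB, ← mul_assoc (plancherelConst V), Real.mul_rpow (by positivity) (by positivity),
      ← Real.rpow_mul ht0.le, ← Real.rpow_natCast (t ^ _), ← Real.rpow_mul ht0.le]
    have : t ^ (-(dim / 2 + dim * (1 - x)) * ((2 : ℕ) : ℝ)) =
      t ^ (-dim) * t ^ (-dim * (2 - 2 * x)) := by
      rw [← Real.rpow_add ht0]; congr 1; push_cast; ring
    rw [this]; ring
  have hint : ∫ ξ, ‖expMultiplier ((t : ℂ) - Complex.I) ξ‖ ^ 2 * ‖𝓕⁻ f ξ‖ ^ 2 ≤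
      B * (t ^ (-(dim / 2 + dim * (1 - x))) * recipNorm x f) ^ 2 := by
    calc _ ≤ ∫ ξ, M ^ 2 * (mulConst dim * t ^ (-dim)) * (‖expMultiplier (t : ℂ) ξ‖ * ‖𝓕⁻ f ξ‖ ^ 2) :=
          integral_mono hi (hi0.const_mul _) hle
      _ ≤ M ^ 2 * (mulConst dim * t ^ (-dim)) * (4 * (plancherelConst V *
          (mulConst dim * t ^ (-dim))) ^ (2 - 2 * x) * recipNorm x f ^ 2) := by
          rw [integral_const_mul]
          exact mul_le_mul_of_nonneg_left (integral_norm_expMultiplier_ofReal_le ht0 hx₀ hx₁ hf)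
            (by positivity)
      _ = ((mulConst dim * t ^ (-dim)) * (4 * (plancherelConst V * (mulConst dim * t ^ (-dim)))
            ^ (2 - 2 * x)) * M ^ 2) * recipNorm x f ^ 2 := by ring
      _ = _ := by rw [hpow]; ring
  calc _ ≤ ∫ ξ, ‖expMultiplier ((t : ℂ) - Complex.I) ξ‖ * (‖𝓕⁻ f ξ‖ * ‖𝓕 g ξ‖) := by
        refine norm_integral_le_of_norm_le h.1 (ae_of_all _ fun ξ => ?_)
        rw [norm_mul, norm_mul]
    _ ≤ _ := h.2
    _ ≤ √(B * (t ^ (-(dim / 2 + dim * (1 - x))) * recipNorm x f) ^ 2) *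
        (√(plancherelConst V) * recipNorm (1 / 2) g) := by
        gcongr
        exact mul_nonneg (Real.sqrt_nonneg _) (recipNorm_nonneg _ _)
    _ = _ := by
        rw [Real.sqrt_mul hB0, Real.sqrt_sq (mul_nonneg (by positivity) (recipNorm_nonneg _ _))]
        ring

theorem lintegral_form_expKernel_Ioi_le (hd : 3 ≤ dim) {s : ℝ} (hs : 0 < s) (hs' : s < 1 / 2) :
    ∃ C : ℝ, 0 ≤ C ∧ ∀ f g : V → ℂ, IsNice f → IsNice g →
      ∫⁻ t in Ioi (1 : ℝ), ENNReal.ofReal (t ^ ((dim + 1) / 2 - s - 1) *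
        ‖form (expKernel ((t : ℂ) - Complex.I)) f g‖) ≤
      ENNReal.ofReal (C * recipNorm (1 / 2 + 2 * s / (dim + 1)) f * recipNorm (1 / 2) g) := by
  have hx : 1 / 2 ≤ 1 / 2 + 2 * s / (dim + 1) := by
    have : 0 < 2 * s / (dim + 1) := by positivity
    linarith
  have hx1 : 2 * s / (dim + 1) ≤ 1 / 4 := by
    rw [div_le_iff₀ (by positivity)]; linarith
  obtain ⟨C, hC, h⟩ := norm_form_expKernel_le_of_one_le (V := V) hx (by linarith)
  set x := 1 / 2 + 2 * s / (dim + 1) with hxd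
  set A := (dim + 1) / 2 - s - 1 - (dim / 2 + dim * (1 - x)) with hA
  -- Here A = -1/2 - s - dim(1-x), and 1 - x ≥ 1/4 with dim ≥ 3.
  have hA1 : A < -1 := by
    have : 3 * (1 / 4) ≤ dim * (1 - x) := by gcongr; linarith
    linarith
  refine ⟨C * (-1 / (A + 1)), mul_nonneg hC (div_nonneg_of_nonpos (by norm_num) (by linarith)),
    fun f g hf hg => ?_⟩
  have hN : 0 ≤ recipNorm x f := recipNorm_nonneg _ _
  have hN' : 0 ≤ recipNorm (1 / 2) g := recipNorm_nonneg _ _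
  calc _ ≤ ∫⁻ t in Ioi (1 : ℝ), ENNReal.ofReal (C * recipNorm x f * recipNorm (1 / 2) g * t ^ A) := by
        refine setLIntegral_mono' measurableSet_Ioi fun t ht => ENNReal.ofReal_le_ofReal ?_
        have ht1 : 1 < t := ht
        have ht0 : 0 < t := by linarith
        calc _ ≤ t ^ ((dim + 1) / 2 - s - 1) *
              (C * t ^ (-(dim / 2 + dim * (1 - x))) * recipNorm x f * recipNorm (1 / 2) g) := by
              gcongr; exact h t ht1.le f g hf hg
          _ = C * recipNorm x f * recipNorm (1 / 2) g *
              (t ^ ((dim + 1) / 2 - s - 1) * t ^ (-(dim / 2 + dim * (1 - x)))) := by ring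
          _ = _ := by rw [← Real.rpow_add ht0]; rfl
    _ = _ := by
        rw [← ofReal_integral_eq_lintegral_ofReal
          ((integrableOn_Ioi_rpow_of_lt hA1 one_pos).const_mul _), integral_const_mul,
          integral_Ioi_rpow_of_lt hA1 one_pos, Real.one_rpow]
        · congr 1; ring
        · filter_upwards [ae_restrict_mem measurableSet_Ioi] with t ht
          have : (0 : ℝ) < t := one_pos.trans ht
          positivity

/-- The endpoint bound for the power kernels, uniform along vertical lines. -/
theorem formBound_powKernel_half (hd : 3 ≤ dim) {s : ℝ} (hs : 0 < s) (hs' : s < 1 / 2) :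
    ∃ C : ℝ, 0 ≤ C ∧ ∀ b : ℂ, b.re = (dim + 1) / 2 - s →
      FormBound (fun y : V => Complex.Gamma b * powKernel b y)
        (1 / 2 + 2 * s / (dim + 1)) (1 / 2) C := by
  obtain ⟨C₁, hC₁, h₁⟩ := lintegral_form_expKernel_Ioc_le hd hs hs'
  obtain ⟨C₂, hC₂, h₂⟩ := lintegral_form_expKernel_Ioi_le hd hs hs'
  refine ⟨C₁ + C₂, by positivity, fun b hb f g hf hg => ?_⟩
  have hN : 0 ≤ recipNorm (1 / 2 + 2 * s / (dim + 1)) f := recipNorm_nonneg _ _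
  have hN' : 0 ≤ recipNorm (1 / 2) g := recipNorm_nonneg _ _
  have e : form (fun y : V => Complex.Gamma b * powKernel b y) f g =
      Complex.Gamma b * form (powKernel b) f g := by
    simp only [form, ← integral_const_mul, mul_assoc]
  rw [e, gamma_mul_form_powKernel (by linarith) (by linarith) (by linarith) hf hg]
  refine (ENNReal.ofReal_le_ofReal_iff (by positivity)).1 ?_
  rw [ofReal_norm]
  -- Absolute values inside the Mellin integral see only re b, so the constant is uniform in im b.
  refine (enorm_integral_le_lintegral_enorm _).trans ?_
  calc _ = ∫⁻ t in Ioi (0 : ℝ), ENNReal.ofReal (t ^ ((dim + 1) / 2 - s - 1) *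
        ‖form (expKernel ((t : ℂ) - Complex.I)) f g‖) := by
        refine setLIntegral_congr_fun measurableSet_Ioi fun t ht => ?_
        rw [← ofReal_norm, norm_mul, Complex.norm_cpow_eq_rpow_re_of_pos ht, Complex.sub_re, hb,
          Complex.one_re]
    _ ≤ _ := by
        rw [← Ioc_union_Ioi_eq_Ioi zero_le_one]
        exact lintegral_union_le _ _ _
    _ ≤ _ := add_le_add (h₁ f g hf hg) (h₂ f g hf hg)
    _ = _ := by
        rw [← ENNReal.ofReal_add (by positivity) (by positivity)]
        congr 1; ring

end HalfLine

/-! ### The analytic family in the exponent b -/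

section PowFamily

open Complex.HadamardThreeLines

variable {V : Type*} [NormedAddCommGroup V] [InnerProductSpace ℝ V] [FiniteDimensional ℝ V]
  [MeasurableSpace V] [BorelSpace V]

local notation "dim" => (Module.finrank ℝ V : ℝ)

theorem norm_Gamma_le {z : ℂ} (hz : 0 < z.re) : ‖Complex.Gamma z‖ ≤ Real.Gamma z.re := by
  rw [Complex.Gamma_eq_integral hz, Real.Gamma_eq_integral hz, Complex.GammaIntegral]
  refine norm_integral_le_of_norm_le (Real.GammaIntegral_convergent hz) ?_
  filter_upwards [ae_restrict_mem measurableSet_Ioi] with t ht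
  rw [norm_mul, Complex.norm_real, Real.norm_of_nonneg (Real.exp_pos _).le,
    Complex.norm_cpow_eq_rpow_re_of_pos ht, Complex.sub_re, Complex.one_re]

theorem norm_powKernel_le_add {w : ℂ} {e : ℝ} (h1 : -1 ≤ w.re) (h2 : w.re ≤ e) {y : V} (hy : y ≠ 0) :
    ‖powKernel w y‖ ≤ ‖y‖ + ‖y‖ ^ (-e) := by
  have hr : 0 < ‖y‖ := norm_pos_iff.2 hy
  rw [norm_powKernel w hy]
  rcases le_total 1 ‖y‖ with h | h
  · calc ‖y‖ ^ (-w.re) ≤ ‖y‖ ^ (1 : ℝ) := Real.rpow_le_rpow_of_exponent_le h (by linarith)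
      _ ≤ _ := by rw [Real.rpow_one]; exact le_add_of_nonneg_right (by positivity)
  · exact (Real.rpow_le_rpow_of_exponent_ge hr h (by linarith)).trans
      (le_add_of_nonneg_left hr.le)

theorem ae_sub_ne_zero (hd : 1 ≤ dim) : ∀ᵐ p : V × V, p.1 - p.2 ≠ 0 := by
  have : Nontrivial V := Module.nontrivial_of_finrank_pos (R := ℝ) (by exact_mod_cast hd)
  exact (quasiMeasurePreserving_sub (volume : Measure V) volume).ae
    (compl_mem_ae_iff.2 (measure_singleton (0 : V)))

theorem integrable_dominating_form (hd : 1 ≤ dim) {e : ℝ} (he : e < dim) {f g : V → ℂ}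
    (hf : IsNice f) (hg : IsNice g) :
    Integrable fun p : V × V => (‖p.1 - p.2‖ + ‖p.1 - p.2‖ ^ (-e)) * ‖f p.2‖ * ‖g p.1‖ := by
  have hl : LocallyIntegrable fun y : V => ‖y‖ + ‖y‖ ^ (-e) :=
    continuous_norm.locallyIntegrable.add (locallyIntegrable_norm_rpow hd he)
  have h := (integrable_form (k := fun y : V => ((‖y‖ + ‖y‖ ^ (-e) : ℝ) : ℂ)) (by fun_prop)
    (fun x => by
      obtain ⟨U, hU, h⟩ := hl x
      exact ⟨U, hU, h.ofReal⟩) hf hg).norm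
  refine h.congr (ae_of_all _ fun p => ?_)
  simp only
  rw [norm_mul, norm_mul, Complex.norm_real, Real.norm_of_nonneg (by positivity)]

theorem norm_form_integrand_le {w : ℂ} {e : ℝ} (h1 : -1 ≤ w.re) (h2 : w.re ≤ e) {f g : V → ℂ}
    {p : V × V} (hp : p.1 - p.2 ≠ 0) : ‖powKernel w (p.1 - p.2) * f p.2 * g p.1‖ ≤
      (‖p.1 - p.2‖ + ‖p.1 - p.2‖ ^ (-e)) * ‖f p.2‖ * ‖g p.1‖ := by
  rw [norm_mul, norm_mul]
  gcongr
  exact norm_powKernel_le_add h1 h2 hp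

/-- The strip reaches left to -1 so that the line re w = 0, an edge of the interpolation strip, lies
inside the domain of holomorphy. -/
theorem differentiableOn_form_powKernel (hd : 1 ≤ dim) {f g : V → ℂ} (hf : IsNice f)
    (hg : IsNice g) : DifferentiableOn ℂ (fun w => form (powKernel w) f g)
      {w : ℂ | -1 < w.re ∧ w.re < dim} := by
  have hfm := hf.measurable
  have hgm := hg.measurable
  have hopen : ∀ a b : ℝ, IsOpen {w : ℂ | a < w.re ∧ w.re < b} := fun a b =>
    (isOpen_lt continuous_const Complex.continuous_re).inter
      (isOpen_lt Complex.continuous_re continuous_const)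
  refine differentiableOn_integral (hopen _ _) (fun w _ => ?_) ?_ fun w hw => ?_
  · have := measurable_powKernel (V := V) w
    fun_prop
  · filter_upwards [ae_sub_ne_zero hd] with p hp
    have hr : (‖p.1 - p.2‖ : ℂ) ≠ 0 := by exact_mod_cast (norm_pos_iff.2 hp).ne'
    simp only [powKernel]
    refine Differentiable.differentiableOn ?_
    refine ((Differentiable.const_mul ?_ _).mul_const _).mul_const _
    exact fun z => (differentiableAt_id.neg).const_cpow (Or.inl hr)
  · obtain ⟨e, he, he'⟩ := exists_between hw.2
    refine ⟨{w | -1 < w.re ∧ w.re < e}, (hopen _ _).mem_nhds ⟨hw.1, he⟩, _,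
      integrable_dominating_form hd he' hf hg, ?_⟩
    filter_upwards [ae_sub_ne_zero hd] with p hp z hz
    exact norm_form_integrand_le hz.1.le hz.2.le hp

theorem form_const_mul (c : ℂ) (k f g : V → ℂ) :
    form (fun y => c * k y) f g = c * form k f g := by
  simp only [form, ← integral_const_mul, mul_assoc]

theorem FormBound.const_mul {k : V → ℂ} {x y M : ℝ} (h : FormBound k x y M) (c : ℂ) :
    FormBound (fun v => c * k v) x y (‖c‖ * M) := fun f g hf hg => by
  rw [form_const_mul, norm_mul, mul_assoc, mul_assoc, ← mul_assoc M]
  gcongr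
  exact h f g hf hg

theorem FormBound.symm {k : V → ℂ} (hk : ∀ y, k (-y) = k y) {x y M : ℝ} (h : FormBound k x y M) :
    FormBound k y x M := fun f g hf hg => by
  rw [form_comm hk, mul_right_comm]
  exact h g f hg hf

theorem FormBound.mono {k : V → ℂ} {x y M M' : ℝ} (h : FormBound k x y M) (hM : M ≤ M') :
    FormBound k x y M' := fun f g hf hg => (h f g hf hg).trans (by
  have := recipNorm_nonneg x f
  have := recipNorm_nonneg y g
  gcongr)

/-- Interpolation of a symmetric pair of bounds for an even kernel. -/
theorem FormBound.interpolate_symm {k : V → ℂ} (hk : Measurable k) (hk' : LocallyIntegrable k)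
    (hke : ∀ y, k (-y) = k y) {x y M : ℝ} (hx : 0 < x) (hy : 0 < y) (hM : 0 ≤ M)
    (h : FormBound k x y M) {θ : ℝ} (hθ₀ : 0 ≤ θ) (hθ₁ : θ ≤ 1) :
    FormBound k ((1 - θ) * x + θ * y) ((1 - θ) * y + θ * x) (4 * M) := by
  refine (FormBound.interpolate hk hk' hx hy hy hx hM hM h (h.symm hke) hθ₀ hθ₁).mono (le_of_eq ?_)
  rcases hM.eq_or_lt with rfl | hM
  · rcases hθ₀.eq_or_lt with rfl | h0
    · simp
    · rw [Real.zero_rpow h0.ne', mul_zero]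
  · rw [← Real.rpow_add hM, sub_add_cancel, Real.rpow_one]

/-- The analytic family joining `powKernel` with exponents on `re w = β` to unimodular kernels. -/
theorem analyticFamily_powKernel (hd : 1 ≤ dim) {β : ℝ} (hβ : 0 < β) (hβd : β < dim) :
    AnalyticFamily fun (z : ℂ) (y : V) => Complex.Gamma ((1 - z) * β + 1) / ((1 - z) * β + 1) *
      powKernel ((1 - z) * β) y := by
  have hre : ∀ z : ℂ, ((1 - z) * β).re = (1 - z.re) * β := fun z => by simp
  have hre1 : ∀ z : ℂ, ((1 - z) * β + 1).re = (1 - z.re) * β + 1 := fun z => by simp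
  have hmem : ∀ z ∈ verticalClosedStrip 0 1, 0 ≤ (1 - z.re) * β ∧ (1 - z.re) * β ≤ β := fun z hz =>
    ⟨mul_nonneg (by linarith [hz.2]) hβ.le, mul_le_of_le_one_left hβ.le (by linarith [hz.1])⟩
  refine ⟨fun z => ?_, fun z hz => ?_, fun f g hf hg => ?_, fun f g hf hg => ?_⟩
  · have := measurable_powKernel (V := V) ((1 - z) * β)
    fun_prop
  · have h := locallyIntegrable_powKernel (V := V) (b := (1 - z) * β) hd
      (by rw [hre]; linarith [(hmem z hz).2])
    exact h.smul (Complex.Gamma ((1 - z) * β + 1) / ((1 - z) * β + 1))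
  · simp only [form_const_mul]
    refine DifferentiableOn.diffContOnCl fun z hz => ?_
    have hz' : z ∈ verticalClosedStrip 0 1 :=
      closure_minimal (preimage_mono Ioo_subset_Icc_self)
        (isClosed_Icc.preimage Complex.continuous_re) hz
    have h1 := (hmem z hz').1
    have hU : (1 - z) * (β : ℂ) ∈ {w : ℂ | -1 < w.re ∧ w.re < dim} := by
      refine ⟨?_, ?_⟩ <;> rw [hre]
      · linarith
      · linarith [(hmem z hz').2]
    have h2 : DifferentiableAt ℂ (fun w => form (powKernel w) f g) ((1 - z) * (β : ℂ)) :=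
      (differentiableOn_form_powKernel hd hf hg).differentiableAt
        (((isOpen_lt continuous_const Complex.continuous_re).inter
          (isOpen_lt Complex.continuous_re continuous_const)).mem_nhds hU)
    have h3 : DifferentiableAt ℂ (fun z : ℂ => (1 - z) * (β : ℂ)) z := by fun_prop
    have h4 : DifferentiableAt ℂ Complex.Gamma ((1 - z) * β + 1) := by
      refine Complex.differentiableAt_Gamma _ fun m hm => ?_
      have := congrArg Complex.re hm
      rw [hre1, Complex.neg_re, Complex.natCast_re] at this
      have : (0 : ℝ) ≤ m := m.cast_nonneg
      linarith
    have h5 : (1 - z) * (β : ℂ) + 1 ≠ 0 := fun h => by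
      have := congrArg Complex.re h
      rw [hre1, Complex.zero_re] at this
      linarith
    exact (((h4.comp z (h3.add_const 1)).div (h3.add_const 1) h5).mul
      (h2.comp z h3)).differentiableWithinAt
  · obtain ⟨C, hC⟩ := (isCompact_Icc (a := (1 : ℝ)) (b := β + 1)).exists_bound_of_continuousOn
      (f := Real.Gamma) fun t ht => (Real.differentiableAt_Gamma fun m => by
        have : (0 : ℝ) ≤ m := m.cast_nonneg
        linarith [ht.1]).continuousAt.continuousWithinAt
    set I := ∫ p : V × V, (‖p.1 - p.2‖ + ‖p.1 - p.2‖ ^ (-β)) * ‖f p.2‖ * ‖g p.1‖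
    refine ⟨C * I, fun z hz => ?_⟩
    obtain ⟨h1, h2⟩ := hmem z hz
    rw [form_const_mul, norm_mul, norm_div]
    have hn : 1 ≤ ‖(1 - z) * (β : ℂ) + 1‖ := by
      have := Complex.re_le_norm ((1 - z) * (β : ℂ) + 1)
      rw [hre1] at this
      linarith
    have hG : ‖Complex.Gamma ((1 - z) * β + 1)‖ ≤ C := by
      have h3 := norm_Gamma_le (z := (1 - z) * β + 1) (by rw [hre1]; linarith)
      rw [hre1] at h3
      exact h3.trans ((le_abs_self _).trans (hC _ ⟨by linarith, by linarith⟩))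
    have hC0 : 0 ≤ C := (norm_nonneg _).trans hG
    gcongr
    · exact (div_le_self (norm_nonneg _) hn).trans hG
    · refine norm_integral_le_of_norm_le (integrable_dominating_form hd hβd hf hg) ?_
      filter_upwards [ae_sub_ne_zero hd] with p hp
      exact norm_form_integrand_le (by rw [hre]; linarith) (by rw [hre]; exact h2) hp

theorem norm_powKernel_le_one {w : ℂ} (hw : w.re = 0) (y : V) : ‖powKernel w y‖ ≤ 1 := by
  rcases eq_or_ne y 0 with rfl | hy
  · rcases eq_or_ne w 0 with rfl | hw0
    · simp [powKernel]
    · simp [powKernel, Complex.zero_cpow (neg_ne_zero.2 hw0)]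
  · rw [norm_powKernel w hy, hw, neg_zero, Real.rpow_zero]

/-- Interpolation of a bound on the line `re w = β` with the trivial bound on `re w = 0`. -/
theorem formBound_powKernel_of_line (hd : 1 ≤ dim) {β : ℝ} (hβ : 0 < β) (hβd : β < dim) {x y M : ℝ}
    (hx : 0 < x) (hy : 0 < y) (hM : 0 ≤ M)
    (h : ∀ w : ℂ, w.re = β → FormBound (fun v : V => Complex.Gamma w * powKernel w v) x y M)
    {b : ℝ} (hb : 0 < b) (hbβ : b ≤ β) :
    FormBound (powKernel (b : ℂ) : V → ℂ) (1 - b / β * (1 - x)) (1 - b / β * (1 - y))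
      (‖(Complex.Gamma (b + 1) / (b + 1))⁻¹‖ * (4 * M ^ (b / β))) := by
  -- Γ(w+1)/(w+1) = (w/(w+1)) Γ(w), and |w/(w+1)| ≤ 1. Passing to Γ(w+1) removes the pole at w = 0,
  -- and the division by w + 1 absorbs the growth of w.
  have h₀ : ∀ z : ℂ, z.re = 0 → FormBound (fun v : V => Complex.Gamma ((1 - z) * β + 1) /
      ((1 - z) * β + 1) * powKernel ((1 - z) * β) v) x y M := fun z hz => by
    set w := (1 - z) * (β : ℂ) with hw
    have hwr : w.re = β := by simp [hw, hz]
    have hw0 : w ≠ 0 := fun h0 => by rw [h0] at hwr; simp at hwr; linarith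
    have h1 := (h w hwr).const_mul (w / (w + 1))
    have e : (fun v : V => w / (w + 1) * (Complex.Gamma w * powKernel w v)) =
        fun v => Complex.Gamma (w + 1) / (w + 1) * powKernel w v := by
      ext v; rw [Complex.Gamma_add_one w hw0]; ring
    rw [e] at h1
    refine h1.mono (mul_le_of_le_one_left hM ?_)
    rw [norm_div]
    refine div_le_one_of_le₀ ?_ (norm_nonneg _)
    refine le_of_sq_le_sq ?_ (norm_nonneg _)
    rw [← Complex.normSq_eq_norm_sq, ← Complex.normSq_eq_norm_sq, Complex.normSq_apply,
      Complex.normSq_apply]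
    simp only [Complex.add_re, Complex.one_re, Complex.add_im, Complex.one_im, hwr]
    nlinarith
  -- Now re w = 0, so |Γ(w+1)| ≤ Γ(1) = 1 and the kernel has modulus at most 1.
  have h₁ : ∀ z : ℂ, z.re = 1 → FormBound (fun v : V => Complex.Gamma ((1 - z) * β + 1) /
      ((1 - z) * β + 1) * powKernel ((1 - z) * β) v) 1 1 1 := fun z hz f g hf hg => by
    set w := (1 - z) * (β : ℂ) with hw
    have hwr : w.re = 0 := by simp [hw, hz]
    rw [one_mul]
    refine norm_form_le_of_norm_le_one (fun v => ?_) hf hg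
    rw [norm_mul, norm_div]
    have h1 : 1 ≤ ‖w + 1‖ := by
      have := Complex.re_le_norm (w + 1)
      simp only [Complex.add_re, hwr, Complex.one_re] at this
      linarith
    have h2 : ‖Complex.Gamma (w + 1)‖ ≤ 1 := by
      have := norm_Gamma_le (z := w + 1) (by simp [hwr])
      simpa [hwr] using this
    exact mul_le_one₀ ((div_le_self (norm_nonneg _) h1).trans h2) (norm_nonneg _)
      (norm_powKernel_le_one hwr v)
  have hbβ' : b / β ≤ 1 := div_le_one_of_le₀ hbβ hβ.le
  have hbβ0 : 0 < b / β := by positivity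
  have key := interpolation (analyticFamily_powKernel hd hβ hβd) hx one_pos hy one_pos hM zero_le_one
    h₀ h₁ (θ := 1 - b / β) (by linarith) (by linarith)
  have e0 : (1 - ((1 - b / β : ℝ) : ℂ)) * (β : ℂ) = b := by
    have : (β : ℂ) ≠ 0 := by exact_mod_cast hβ.ne'
    push_cast; field_simp; ring
  simp only [e0] at key
  have hG : Complex.Gamma (b + 1) / (b + 1) ≠ 0 := by
    have h1 : Complex.Gamma ((b : ℂ) + 1) ≠ 0 := Complex.Gamma_ne_zero_of_re_pos (by simp; linarith)
    refine div_ne_zero h1 fun h => ?_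
    have := congrArg Complex.re h
    simp at this
    linarith
  have key2 := key.const_mul (Complex.Gamma (b + 1) / (b + 1))⁻¹
  simp only [inv_mul_cancel_left₀ hG] at key2
  convert key2 using 2
  · ring
  · ring
  · rw [Real.one_rpow, mul_one]; congr 2; ring

end PowFamily

/-! ### Form bounds for real decay exponents -/

section RealExponents

variable {V : Type*} [NormedAddCommGroup V] [InnerProductSpace ℝ V] [FiniteDimensional ℝ V]
  [MeasurableSpace V] [BorelSpace V]

local notation "dim" => (Module.finrank ℝ V : ℝ)

/-- Bounds for the oscillating kernel of decay `dim / 2 < b < (dim + 1) / 2`, uniform along the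
segment joining the two endpoints. -/
theorem formBound_powKernel_of_half_lt (hd : 3 ≤ dim) {b : ℝ} (hb : dim / 2 < b)
    (hb' : b < (dim + 1) / 2) :
    ∃ C : ℝ, 0 ≤ C ∧ ∀ θ : ℝ, 0 ≤ θ → θ ≤ 1 → FormBound (powKernel (b : ℂ) : V → ℂ)
      ((1 - θ) * (1 / 2 + 2 * ((dim + 1) / 2 - b) / (dim + 1)) + θ * (1 / 2))
      ((1 - θ) * (1 / 2) + θ * (1 / 2 + 2 * ((dim + 1) / 2 - b) / (dim + 1))) C := by
  obtain ⟨C, hC, h⟩ := formBound_powKernel_half (V := V) hd (s := (dim + 1) / 2 - b)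
    (by linarith) (by linarith)
  have h1 := (h b (by simp)).const_mul (Complex.Gamma b)⁻¹
  have hG : Complex.Gamma (b : ℂ) ≠ 0 := Complex.Gamma_ne_zero_of_re_pos (by simp; linarith)
  simp only [inv_mul_cancel_left₀ hG] at h1
  refine ⟨4 * (‖(Complex.Gamma (b : ℂ))⁻¹‖ * C), by positivity, fun θ hθ₀ hθ₁ => ?_⟩
  have hs : 0 < 2 * ((dim + 1) / 2 - b) / (dim + 1) := div_pos (by linarith) (by linarith)
  exact FormBound.interpolate_symm (measurable_powKernel _)
    (locallyIntegrable_powKernel (by linarith) (by simp; linarith)) (powKernel_neg _)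
    (by positivity) (by positivity) (by positivity) h1 hθ₀ hθ₁

/-- Bounds for the oscillating kernel of decay `0 < b ≤ dim / 2`. -/
theorem formBound_powKernel_of_le_half (hd : 3 ≤ dim) {b : ℝ} (hb : 0 < b) (hb' : b ≤ dim / 2)
    {x y : ℝ} (hxy : (1 - x) + (1 - y) = 2 * b / (dim + 1)) (hx : 1 - x < b / dim)
    (hy : 1 - y < b / dim) :
    ∃ C : ℝ, 0 ≤ C ∧ FormBound (powKernel (b : ℂ) : V → ℂ) x y C := by
  have hd0 : 0 < dim := by linarith
  -- The number m = b/(2β) encodes β: m < b/dim and m > b/(dim+1) place β between dim/2 and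
  -- (dim+1)/2. Interpolation from re w = β reaches the values of 1-x between 2b/(dim+1) - m and m,
  -- so `m` must also exceed 1-x and 1-y.
  obtain ⟨m, hm, hmb⟩ := exists_between (max_lt (max_lt hx hy)
    (show b / (dim + 1) < b / dim by gcongr; linarith))
  obtain ⟨hm', hm3⟩ := max_lt_iff.1 hm
  obtain ⟨hm1, hm2⟩ := max_lt_iff.1 hm'
  have hm0 : 0 < m := lt_trans (by positivity) hm3
  set β := b / (2 * m) with hβ
  have hβ0 : 0 < β := by positivity
  have hβ1 : dim / 2 < β := by
    rw [lt_div_iff₀ hd0] at hmb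
    rw [hβ, lt_div_iff₀ (by positivity)]; linarith
  have hβ2 : β < (dim + 1) / 2 := by
    rw [div_lt_iff₀ (by positivity)] at hm3
    rw [hβ, div_lt_iff₀ (by positivity)]; linarith
  obtain ⟨C, hC, h⟩ := formBound_powKernel_half (V := V) hd (s := (dim + 1) / 2 - β)
    (by linarith) (by linarith)
  set x₀ := 1 / 2 + 2 * ((dim + 1) / 2 - β) / (dim + 1) with hx₀
  have hx₀0 : 0 < x₀ := by
    have : 0 < 2 * ((dim + 1) / 2 - β) / (dim + 1) := div_pos (by linarith) (by linarith)
    positivity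
  have hD : 0 < 2 * m - 2 * b / (dim + 1) := by
    have : 2 * b / (dim + 1) = 2 * (b / (dim + 1)) := by ring
    linarith
  -- The relative position of 1-x in that interval.
  set θ := ((1 - x) - (2 * b / (dim + 1) - m)) / (2 * m - 2 * b / (dim + 1)) with hθ
  have hθ₀ : 0 ≤ θ := div_nonneg (by linarith) hD.le
  have hθ₁ : θ ≤ 1 := by rw [hθ, div_le_one hD]; linarith
  have hline : ∀ w : ℂ, w.re = β → FormBound (fun v : V => Complex.Gamma w * powKernel w v)
      ((1 - θ) * x₀ + θ * (1 / 2)) ((1 - θ) * (1 / 2) + θ * x₀) (4 * C) := fun w hw => by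
    refine FormBound.interpolate_symm (measurable_const.mul (measurable_powKernel _)) ?_
      (fun v => congrArg (Complex.Gamma w * ·) (powKernel_neg w v)) hx₀0 (by positivity) hC (h w (by rw [hw]; ring)) hθ₀ hθ₁
    exact (locallyIntegrable_powKernel (by linarith) (by rw [hw]; linarith)).smul (Complex.Gamma w)
  have hpos : ∀ u v : ℝ, 0 < u → 0 < v → 0 < (1 - θ) * u + θ * v := fun u v hu hv => by
    rcases hθ₀.eq_or_lt with h0 | h0
    · rw [← h0]; simpa using hu
    · have := mul_nonneg (sub_nonneg.2 hθ₁) hu.le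
      have := mul_pos h0 hv
      linarith
  have key := formBound_powKernel_of_line (by linarith) hβ0 (by linarith)
    (hpos _ _ hx₀0 (by norm_num)) (hpos _ _ (by norm_num) hx₀0) (by positivity) hline hb
    (by linarith)
  have hbβ : b / β = 2 * m := by rw [hβ]; field_simp
  have hbx : 2 * m * (1 - x₀) = 2 * b / (dim + 1) - m := by
    rw [hx₀, hβ]; field_simp; ring
  have hθD : θ * (2 * m - 2 * b / (dim + 1)) = (1 - x) - (2 * b / (dim + 1) - m) :=
    div_mul_cancel₀ _ hD.ne'
  have e1 : 1 - 2 * m * (1 - ((1 - θ) * x₀ + θ * (1 / 2))) = x := by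
    linear_combination -(1 - θ) * hbx - hθD
  have e2 : 1 - 2 * m * (1 - ((1 - θ) * (1 / 2) + θ * x₀)) = y := by
    linear_combination -θ * hbx + hθD + hxy
  rw [hbβ, e1, e2] at key
  exact ⟨_, by positivity, key⟩

end RealExponents

/-! ### From form bounds to norms of convolutions -/

section Duality

variable {V : Type*} [NormedAddCommGroup V] [InnerProductSpace ℝ V] [FiniteDimensional ℝ V]
  [MeasurableSpace V] [BorelSpace V] {k f : V → ℂ}

/-- The convolution `u ↦ ∫ k v * f (u - v)`. -/
noncomputable def conv (k f : V → ℂ) (u : V) : ℂ := ∫ v, k v * f (u - v)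

theorem measurable_conv (hk : Measurable k) (hf : Measurable f) : Measurable (conv k f) := by
  have h : Measurable (Function.uncurry fun u v : V => k v * f (u - v)) := by
    simp only [Function.uncurry_def]; fun_prop
  exact h.stronglyMeasurable.integral_prod_right.measurable

theorem IsNice.integrable_mul_sub (hf : IsNice f) (hk : Measurable k) (hk' : LocallyIntegrable k)
    (r : ℝ) : ∃ C : ℝ, ∀ u : V, ‖u‖ ≤ r → Integrable (fun v => k v * f (u - v)) ∧
      ‖conv k f u‖ ≤ C := by
  obtain ⟨M, R, hM, hR, hfM, hfR⟩ := hf.exists_bound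
  have hfm := hf.measurable
  have hi : Integrable fun v => M * ‖(closedBall (0 : V) (r + R)).indicator k v‖ :=
    (((integrable_indicator_iff measurableSet_closedBall).2
      (hk'.integrableOn_isCompact (isCompact_closedBall _ _))).norm).const_mul M
  have hle : ∀ u : V, ‖u‖ ≤ r → ∀ v, ‖k v * f (u - v)‖ ≤
      M * ‖(closedBall (0 : V) (r + R)).indicator k v‖ := fun u hu v => by
    rw [norm_mul, mul_comm]
    by_cases hv : R < ‖u - v‖
    · rw [hfR _ hv, norm_zero, zero_mul]; positivity
    · rw [indicator_of_mem]
      · gcongr; exact hfM _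
      · rw [mem_closedBall_zero_iff]
        have := norm_sub_le u (u - v)
        rw [sub_sub_cancel] at this
        linarith
  exact ⟨_, fun u hu => ⟨hi.mono' (by fun_prop) (ae_of_all _ (hle u hu)),
    norm_integral_le_of_norm_le hi (ae_of_all _ (hle u hu))⟩⟩

theorem form_eq_integral_conv {g : V → ℂ} (hk : Measurable k) (hk' : LocallyIntegrable k)
    (hf : IsNice f) (hg : IsNice g) : form k f g = ∫ u, g u * conv k f u := by
  have h := integrable_form hk hk' hf hg
  rw [form, Measure.volume_eq_prod, integral_prod _ h]
  refine integral_congr_ae (ae_of_all _ fun u => ?_)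
  simp only
  rw [integral_mul_const, mul_comm, conv, ← integral_sub_left_eq_self _ volume u]
  simp only [sub_sub_cancel]

/-- The norm bound on balls for the convolution of a nice function, by testing the form. -/
theorem FormBound.integral_ball_le {x y C : ℝ} (h : FormBound k x y C) (hk : Measurable k)
    (hk' : LocallyIntegrable k) (hy : 0 < y) (hy1 : y < 1) (hC : 0 ≤ C) (hf : IsNice f) (r : ℝ) :
    ∫⁻ u in closedBall (0 : V) r, ENNReal.ofReal (‖conv k f u‖ ^ (1 - y)⁻¹) ≤
      ENNReal.ofReal ((C * recipNorm x f) ^ (1 - y)⁻¹) := by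
  set q := (1 - y)⁻¹ with hq
  have h1y : 0 < 1 - y := by linarith
  have hq1 : 1 < q := (one_lt_inv₀ h1y).2 (by linarith)
  set H := conv k f with hH
  have hHm : Measurable H := measurable_conv hk hf.measurable
  obtain ⟨D, hD⟩ := hf.integrable_mul_sub hk hk' r
  set B := closedBall (0 : V) r with hB
  have hBm : MeasurableSet B := measurableSet_closedBall
  have hDB : ∀ u ∈ B, ‖H u‖ ≤ |D| := fun u hu =>
    (hD u (mem_closedBall_zero_iff.1 hu)).2.trans (le_abs_self D)
  -- Hölder's extremal function cut to the ball: its pairing with `H` is ∫_B |H|^q, and |g|^{1/y} =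
  -- |H|^q on `B`.
  set g : V → ℂ := B.indicator fun u => (starRingEnd ℂ) (H u) * ((‖H u‖ ^ (q - 2) : ℝ) : ℂ) with hg
  have hgn : ∀ u, ‖g u‖ = B.indicator (fun u => ‖H u‖ ^ (q - 1)) u := fun u => by
    rw [hg, norm_indicator_eq_indicator_norm]
    refine congrFun (congrArg _ (funext fun u => ?_)) u
    rw [norm_mul, RCLike.norm_conj, Complex.norm_real, Real.norm_of_nonneg (by positivity)]
    rcases (norm_nonneg (H u)).eq_or_lt with h0 | h0
    · rw [← h0, zero_mul, Real.zero_rpow (by linarith)]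
    · rw [mul_comm, ← Real.rpow_add_one h0.ne']; congr 1; ring
  have hgnice : IsNice g := by
    refine ⟨Measurable.indicator (by fun_prop) hBm, ⟨|D| ^ (q - 1), fun u => ?_⟩, ⟨r, fun u hu => ?_⟩⟩
    · rw [hgn]
      by_cases hu : u ∈ B
      · rw [indicator_of_mem hu]
        exact Real.rpow_le_rpow (norm_nonneg _) (hDB u hu) (by linarith)
      · rw [indicator_of_notMem hu]
        positivity
    · exact indicator_of_notMem (fun hc => absurd (mem_closedBall_zero_iff.1 hc) (not_le.2 hu)) _
  set S := ∫ u in B, ‖H u‖ ^ q with hS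
  have hS0 : 0 ≤ S := by positivity
  have hform : form k f g = ((S : ℝ) : ℂ) := by
    rw [form_eq_integral_conv hk hk' hf hgnice, hS, ← integral_indicator hBm, ← integral_complex_ofReal]
    refine integral_congr_ae (ae_of_all _ fun u => ?_)
    simp only [hg]
    by_cases hu : u ∈ B
    · rw [indicator_of_mem hu, indicator_of_mem hu, mul_right_comm, mul_comm ((starRingEnd ℂ) _),
        Complex.mul_conj, Complex.normSq_eq_norm_sq, ← Complex.ofReal_mul]
      congr 1
      rcases (norm_nonneg (H u)).eq_or_lt with h0 | h0
      · rw [← hH, ← h0, Real.zero_rpow (show q ≠ 0 by linarith)]; ring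
      · rw [← hH, mul_comm, ← Real.rpow_natCast, ← Real.rpow_add h0]; congr 1; push_cast; ring
    · rw [indicator_of_notMem hu, indicator_of_notMem hu]; simp
  have hNg : recipNorm y g = S ^ y := by
    rw [recipNorm, hS, ← integral_indicator hBm]
    congr 1
    refine integral_congr_ae (ae_of_all _ fun u => ?_)
    simp only [hgn]
    by_cases hu : u ∈ B
    · rw [indicator_of_mem hu, indicator_of_mem hu, ← Real.rpow_mul (norm_nonneg _)]
      congr 1
      rw [hq]; field_simp; ring
    · rw [indicator_of_notMem hu, indicator_of_notMem hu, Real.zero_rpow (by positivity)]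
  have hb := h f g hf hgnice
  rw [hform, hNg, Complex.norm_real, Real.norm_of_nonneg hS0] at hb
  have hSi : IntegrableOn (fun u => ‖H u‖ ^ q) B := by
    refine Measure.integrableOn_of_bounded (M := |D| ^ q) measure_closedBall_lt_top.ne
      (hHm.norm.pow_const q).aestronglyMeasurable ?_
    filter_upwards [ae_restrict_mem hBm] with u hu
    rw [Real.norm_of_nonneg (by positivity)]
    exact Real.rpow_le_rpow (norm_nonneg _) (hDB u hu) (by linarith)
  rw [← ofReal_integral_eq_lintegral_ofReal hSi (ae_of_all _ fun u => by positivity)]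
  refine ENNReal.ofReal_le_ofReal ?_
  have hN := recipNorm_nonneg x f
  rcases hS0.eq_or_lt with h0 | h0
  · rw [← hS, ← h0]; positivity
  -- The form bound reads S ≤ C·‖f‖·S^y with S a positive real, so S^y can be divided out. This is
  -- why the ball comes first.
  · have h1 : S ^ (1 - y) ≤ C * recipNorm x f := by
      rw [Real.rpow_sub h0, Real.rpow_one, div_le_iff₀ (by positivity)]
      exact hb
    calc S = (S ^ (1 - y)) ^ q := by
          rw [← Real.rpow_mul hS0, hq, mul_inv_cancel₀ h1y.ne', Real.rpow_one]
      _ ≤ _ := by gcongr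

theorem FormBound.lintegral_conv_le {x y C : ℝ} (h : FormBound k x y C) (hk : Measurable k)
    (hk' : LocallyIntegrable k) (hy : 0 < y) (hy1 : y < 1) (hC : 0 ≤ C) (hf : IsNice f) :
    ∫⁻ u, ENNReal.ofReal (‖conv k f u‖ ^ (1 - y)⁻¹) ≤
      ENNReal.ofReal ((C * recipNorm x f) ^ (1 - y)⁻¹) := by
  have hd : Directed (· ⊆ ·) fun n : ℕ => closedBall (0 : V) n :=
    directed_of_isDirected_le fun m n hmn => closedBall_subset_closedBall (by exact_mod_cast hmn)
  rw [← setLIntegral_univ, ← iUnion_closedBall_nat (0 : V),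
    setLIntegral_iUnion_of_directed _ hd]
  exact iSup_le fun n => h.integral_ball_le hk hk' hy hy1 hC hf n

end Duality

/-! ### Extension to all of L_p and absolute convergence -/

section Extension

variable {V : Type*} [NormedAddCommGroup V] [InnerProductSpace ℝ V] [FiniteDimensional ℝ V]
  [MeasurableSpace V] [BorelSpace V] {k f : V → ℂ}

local notation "dim" => (Module.finrank ℝ V : ℝ)

theorem mul_le_add_rpow {a b x : ℝ} (ha : 0 ≤ a) (hb : 0 ≤ b) (hx : 0 < x) (hx1 : x < 1) :
    a * b ≤ a ^ (1 - x)⁻¹ + b ^ x⁻¹ := by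
  have h1x : 0 < 1 - x := by linarith
  have h := Real.young_inequality_of_nonneg ha hb (p := (1 - x)⁻¹) (q := x⁻¹)
    (Real.holderConjugate_iff.2 ⟨(one_lt_inv₀ h1x).2 (by linarith), by simp⟩)
  refine h.trans (add_le_add ?_ ?_)
  · exact div_le_self (by positivity) ((one_le_inv₀ h1x).2 (by linarith))
  · exact div_le_self (by positivity) ((one_le_inv₀ hx).2 hx1.le)

/-- Almost everywhere absolute convergence of a convolution against a kernel which is locally
integrable and belongs to the dual Lebesgue class at infinity. -/
theorem ae_integrable_mul_sub (hk : Measurable k) (hk' : LocallyIntegrable k) {x : ℝ} (hx : 0 < x)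
    (hx1 : x < 1) (hfar : IntegrableOn (fun v => ‖k v‖ ^ (1 - x)⁻¹) (closedBall 0 1)ᶜ)
    (hf : Measurable f) (hfi : Integrable (fun v => ‖f v‖ ^ x⁻¹)) :
    ∀ᵐ u, Integrable fun v => k v * f (u - v) := by
  set B := closedBall (0 : V) 1
  have hBm : MeasurableSet B := measurableSet_closedBall
  have h1 : Integrable (fun v => B.indicator (fun v => ‖k v‖) v) :=
    (integrable_indicator_iff hBm).2 (hk'.integrableOn_isCompact (isCompact_closedBall _ _)).norm
  have h2 := (integrable_indicator_iff hBm.compl).2 hfar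
  filter_upwards [h1.ae_convolution_exists (ContinuousLinearMap.mul ℝ ℝ) hfi] with u hu
  have hu' : Integrable fun v => B.indicator (fun v => ‖k v‖) v * ‖f (u - v)‖ ^ x⁻¹ := hu
  refine (((h1.add hu').add h2).add (hfi.comp_sub_left u)).mono' (by fun_prop)
    (ae_of_all _ fun v => ?_)
  simp only [Pi.add_apply]
  rw [norm_mul]
  by_cases hv : v ∈ B
  · rw [indicator_of_mem hv, indicator_of_notMem (notMem_compl_iff.2 hv)]
    -- Near the origin the kernel is integrable, so it can be convolved with 1 + |f|^p.
    have h3 : ‖f (u - v)‖ ≤ 1 + ‖f (u - v)‖ ^ x⁻¹ := by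
      rcases le_total ‖f (u - v)‖ 1 with h | h
      · have : 0 ≤ ‖f (u - v)‖ ^ x⁻¹ := by positivity
        linarith
      · have := Real.rpow_le_rpow_of_exponent_le h ((one_le_inv₀ hx).2 hx1.le)
        rw [Real.rpow_one] at this
        linarith
    have h4 : 0 ≤ ‖f (u - v)‖ ^ x⁻¹ := by positivity
    calc _ ≤ ‖k v‖ * (1 + ‖f (u - v)‖ ^ x⁻¹) := by gcongr
      _ ≤ _ := by linarith
  · rw [indicator_of_notMem hv, indicator_of_mem (mem_compl hv)]
    have := mul_le_add_rpow (norm_nonneg (k v)) (norm_nonneg (f (u - v))) hx hx1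
    linarith

theorem integrableOn_powKernel_rpow {b r : ℝ} (hb : 0 ≤ b) (hr : 0 ≤ r) (h : dim < b * r) :
    IntegrableOn (fun v : V => ‖powKernel (b : ℂ) v‖ ^ r) (closedBall 0 1)ᶜ := by
  have hm := measurable_powKernel (V := V) (b : ℂ)
  refine ((integrable_one_add_norm h).const_mul (2 ^ (b * r))).integrableOn.mono'
    (hm.norm.pow_const r).aestronglyMeasurable ?_
  filter_upwards [ae_restrict_mem measurableSet_closedBall.compl] with v hv
  have hv1 : 1 < ‖v‖ := by simpa using hv
  have hv0 : v ≠ 0 := norm_pos_iff.1 (by linarith)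
  rw [Real.norm_of_nonneg (by positivity), norm_powKernel _ hv0, Complex.ofReal_re,
    ← Real.rpow_mul (norm_nonneg _), Real.rpow_neg (by positivity), neg_mul,
    Real.rpow_neg (norm_nonneg _), ← div_eq_mul_inv, ← Real.inv_rpow (norm_nonneg _),
    ← Real.div_rpow zero_le_two (by positivity)]
  have hbr : 0 ≤ b * r := by positivity
  refine Real.rpow_le_rpow (by positivity) ?_ hbr
  rw [inv_eq_one_div, div_le_div_iff₀ (by linarith) (by positivity)]
  linarith

theorem IsNice.eLpNorm_eq (hf : IsNice f) {p : ℝ≥0∞} {x : ℝ} (hx : 0 < x) (hp : (p⁻¹).toReal = x) :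
    eLpNorm f p = ENNReal.ofReal (recipNorm x f) := by
  have hp0 : p ≠ 0 := fun h => by rw [h] at hp; simp at hp; linarith
  have hpt : p ≠ ∞ := fun h => by rw [h] at hp; simp at hp; linarith
  have hpr : p.toReal = x⁻¹ := by rw [← hp, ENNReal.toReal_inv, inv_inv]
  rw [eLpNorm_eq_lintegral_rpow_enorm_toReal hp0 hpt, hpr, recipNorm,
    ← ENNReal.ofReal_rpow_of_nonneg (integral_nonneg fun v => by positivity) hx.le,
    ofReal_integral_eq_lintegral_ofReal (hf.integrable_norm_rpow (by positivity))
      (ae_of_all _ fun v => by positivity), one_div, inv_inv]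
  congr 1
  refine lintegral_congr fun v => ?_
  rw [← ENNReal.ofReal_rpow_of_nonneg (norm_nonneg _) (by positivity), ofReal_norm]

/-- Truncation in both height and radius. Domination by `f` itself, not by a multiple, keeps the
constant unchanged in the limit. -/
theorem exists_tendsto_isNice (hf : Measurable f) : ∃ F : ℕ → V → ℂ, (∀ m, IsNice (F m)) ∧
    (∀ m z, ‖F m z‖ ≤ ‖f z‖) ∧ ∀ z, Tendsto (fun m => F m z) atTop (𝓝 (f z)) := by
  set F : ℕ → V → ℂ := fun m => {z | ‖f z‖ ≤ m ∧ ‖z‖ ≤ m}.indicator f with hF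
  have hset : ∀ m : ℕ, MeasurableSet {z | ‖f z‖ ≤ m ∧ ‖z‖ ≤ m} := fun m =>
    (measurableSet_le hf.norm measurable_const).inter (measurableSet_le measurable_norm measurable_const)
  have hFle : ∀ m z, ‖F m z‖ ≤ ‖f z‖ := fun m z => norm_indicator_le_norm_self _ _
  have hFn : ∀ m, IsNice (F m) := fun m => by
    refine ⟨hf.indicator (hset m), ⟨m, fun z => ?_⟩, ⟨m, fun z hz => ?_⟩⟩
    · simp only [hF, indicator_apply]
      split_ifs with hz
      · exact hz.1
      · simp
    · exact indicator_of_notMem (fun hc => absurd hc.2 (not_le.2 hz)) _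
  have hFt : ∀ z, Tendsto (fun m => F m z) atTop (𝓝 (f z)) := fun z => by
    obtain ⟨N, hN⟩ := exists_nat_ge (max ‖f z‖ ‖z‖)
    refine tendsto_const_nhds.congr' ?_
    filter_upwards [eventually_ge_atTop N] with m hm
    have hm' : (N : ℝ) ≤ m := by exact_mod_cast hm
    have hz : z ∈ {z | ‖f z‖ ≤ m ∧ ‖z‖ ≤ m} :=
      ⟨(le_max_left _ _).trans (hN.trans hm'), (le_max_right _ _).trans (hN.trans hm')⟩
    exact (indicator_of_mem hz _).symm
  exact ⟨F, hFn, hFle, hFt⟩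

/-- A form bound gives the `L^p → L^q` bound for the convolution operator. -/
theorem FormBound.memLp_conv {C : ℝ} {p q : ℝ≥0∞}
    (h : FormBound k (p⁻¹).toReal (1 - (q⁻¹).toReal) C) (hk : Measurable k)
    (hk' : LocallyIntegrable k) (hp : 0 < (p⁻¹).toReal) (hq : 0 < (q⁻¹).toReal)
    (hq1 : (q⁻¹).toReal < 1) (hC : 0 ≤ C) (hf : Measurable f) (hfp : MemLp f p)
    (hint : ∀ᵐ u, Integrable fun v => k v * f (u - v)) :
    MemLp (conv k f) q ∧ eLpNorm (conv k f) q ≤ ENNReal.ofReal C * eLpNorm f p := by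
  have hq0 : q ≠ 0 := fun h => by rw [h] at hq; simp at hq
  have hqt : q ≠ ∞ := fun h => by rw [h] at hq; simp at hq
  have hqr : (1 - (1 - (q⁻¹).toReal))⁻¹ = q.toReal := by
    rw [sub_sub_cancel, ENNReal.toReal_inv, inv_inv]
  have hqr0 : 0 < q.toReal := ENNReal.toReal_pos hq0 hqt
  obtain ⟨F, hFn, hFle, hFt⟩ := exists_tendsto_isNice hf
  have hlim : ∀ᵐ u, Tendsto (fun m => conv k (F m) u) atTop (𝓝 (conv k f u)) := by
    filter_upwards [hint] with u hu
    refine tendsto_integral_of_dominated_convergence _ (fun m => ?_) hu.norm (fun m => ?_) ?_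
    · have := (hFn m).measurable
      fun_prop
    · refine ae_of_all _ fun v => ?_
      rw [norm_mul, norm_mul]
      gcongr
      exact hFle m _
    · exact ae_of_all _ fun v => (hFt _).const_mul _
  have hmeas : AEStronglyMeasurable (conv k f) volume :=
    aestronglyMeasurable_of_tendsto_ae atTop
      (fun m => (measurable_conv hk (hFn m).measurable).aestronglyMeasurable) hlim
  have hbound : ∀ m, eLpNorm (conv k (F m)) q ≤ ENNReal.ofReal C * eLpNorm f p := fun m => by
    have h1 := h.lintegral_conv_le hk hk' (by linarith) (by linarith) hC (hFn m)
    rw [hqr, ← ENNReal.ofReal_rpow_of_nonneg (mul_nonneg hC (recipNorm_nonneg _ _)) hqr0.le,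
      ENNReal.ofReal_mul hC, ← (hFn m).eLpNorm_eq hp rfl] at h1
    have h2 : ∫⁻ u, ‖conv k (F m) u‖ₑ ^ q.toReal =
        ∫⁻ u, ENNReal.ofReal (‖conv k (F m) u‖ ^ q.toReal) := lintegral_congr fun u => by
      rw [← ENNReal.ofReal_rpow_of_nonneg (norm_nonneg _) hqr0.le, ofReal_norm]
    have h3 : eLpNorm (conv k (F m)) q ≤ ENNReal.ofReal C * eLpNorm (F m) p := by
      rw [eLpNorm_eq_lintegral_rpow_enorm_toReal hq0 hqt, one_div, ENNReal.rpow_inv_le_iff hqr0, h2]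
      exact h1
    exact h3.trans (mul_le_mul_right (eLpNorm_mono (hFle m)) _)
  -- Fatou's lemma along the truncations, whose convolutions converge almost everywhere.
  have hfin : eLpNorm (conv k f) q ≤ ENNReal.ofReal C * eLpNorm f p :=
    (Lp.eLpNorm_lim_le_liminf_eLpNorm (fun m => (measurable_conv hk
      (hFn m).measurable).aestronglyMeasurable) _ hlim).trans
      (liminf_le_of_frequently_le' (Frequently.of_forall hbound))
  exact ⟨⟨hmeas, hfin.trans_lt (ENNReal.mul_lt_top ENNReal.ofReal_lt_top hfp.2)⟩, hfin⟩

end Extension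

/-! ### Return to the operator K^α -/

section Operator

theorem kernel_eq_powKernel (n : ℕ) (α : ℝ) : kernel n α = powKernel (((n : ℝ) - α : ℝ) : ℂ) := by
  ext y
  rw [kernel, powKernel, Complex.cpow_neg, ← Complex.ofReal_cpow (norm_nonneg y), div_eq_mul_inv]

/-- The condition 1/p > α/n puts |y|^{-(n-α)} into the dual class L_{p'} at infinity, which gives
absolute convergence for every f in L_p. -/
theorem boundedBy_of_formBound {n : ℕ} (hn : 0 < n) {α C : ℝ} (hα : 0 < α) (hα' : α < n)
    {p q : ℝ≥0∞} (hp : α / n < (p⁻¹).toReal) (hp1 : (p⁻¹).toReal < 1) (hq : 0 < (q⁻¹).toReal)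
    (hq1 : (q⁻¹).toReal < 1) (hC : 0 ≤ C)
    (h : FormBound (powKernel (((n : ℝ) - α : ℝ) : ℂ) : EuclideanSpace ℝ (Fin n) → ℂ)
      (p⁻¹).toReal (1 - (q⁻¹).toReal) C) : BoundedBy n α p q C.toNNReal := by
  intro f hf
  have hn0 : (0 : ℝ) < n := by exact_mod_cast hn
  have hn1 : (1 : ℝ) ≤ n := by exact_mod_cast hn
  have hx : 0 < (p⁻¹).toReal := lt_trans (by positivity) hp
  set x := (p⁻¹).toReal with hxd
  have hp0 : p ≠ 0 := fun h => by rw [hxd, h] at hx; simp at hx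
  have hpt : p ≠ ∞ := fun h => by rw [hxd, h] at hx; simp at hx
  have hpr : p.toReal = x⁻¹ := by rw [hxd, ENNReal.toReal_inv, inv_inv]
  have hdim : (Module.finrank ℝ (EuclideanSpace ℝ (Fin n)) : ℝ) = n := by simp
  have hkm := measurable_powKernel (V := EuclideanSpace ℝ (Fin n)) (((n : ℝ) - α : ℝ) : ℂ)
  have hkl := locallyIntegrable_powKernel (V := EuclideanSpace ℝ (Fin n))
    (b := (((n : ℝ) - α : ℝ) : ℂ)) (by rw [hdim]; exact hn1)
    (by rw [hdim, Complex.ofReal_re]; linarith)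
  -- Elements of L_p are only almost everywhere measurable, so `f` is replaced by a measurable
  -- representative. Neither the convolution integrals nor the norms change.
  obtain ⟨g, hgm, hfg⟩ := hf.1
  have hgm := hgm.measurable
  have hg : MemLp g p := hf.ae_eq hfg
  have hae : ∀ u, (fun v => kernel n α v * f (u - v)) =ᵐ[volume] fun v =>
      powKernel (((n : ℝ) - α : ℝ) : ℂ) v * g (u - v) := fun u => by
    filter_upwards [(quasiMeasurePreserving_sub_left volume u).ae hfg] with v hv
    rw [kernel_eq_powKernel, hv]
  have hK : K n α f = conv (powKernel (((n : ℝ) - α : ℝ) : ℂ)) g :=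
    funext fun u => integral_congr_ae (hae u)
  have hfar := integrableOn_powKernel_rpow (V := EuclideanSpace ℝ (Fin n)) (b := (n : ℝ) - α)
    (r := (1 - x)⁻¹) (by linarith) (inv_nonneg.2 (by linarith)) (by
      rw [hdim, ← div_eq_mul_inv, lt_div_iff₀ (by linarith)]
      rw [div_lt_iff₀ hn0] at hp
      linarith)
  have hint := ae_integrable_mul_sub hkm hkl hx hp1 hfar hgm
    (by rw [← hpr]; exact hg.integrable_norm_rpow hp0 hpt)
  have key := h.memLp_conv hkm hkl hx hq hq1 hC hgm hg hint
  refine ⟨?_, ?_, ?_⟩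
  · filter_upwards [hint] with u hu
    exact hu.congr (hae u).symm
  · rw [hK]; exact key.1
  · rw [hK, eLpNorm_congr_ae hfg]; exact key.2

end Operator

end OscillatoryPotential
-- The two ranges of α
theorem mainTheorem3 (n : ℕ) (hn : 2 < n) (α : ℝ) (hα₁ : ((n : ℝ) - 1) / 2 < α) (hα₂ : α < n) :
    (α < (n : ℝ) / 2 →
      ∃ C : ℝ≥0, ∀ p q : ℝ≥0∞, 1 ≤ p → 1 ≤ q →
        OscillatoryPotential.exponentPoint p q ∈
          openSegment ℝ (OscillatoryPotential.pointP' n α) (OscillatoryPotential.pointP n α) →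
        OscillatoryPotential.BoundedBy n α p q C) ∧
    ((n : ℝ) / 2 ≤ α →
      ∀ p q : ℝ≥0∞, 1 ≤ p → 1 ≤ q →
        OscillatoryPotential.exponentPoint p q ∈
          openSegment ℝ (OscillatoryPotential.pointB' n α) (OscillatoryPotential.pointB n α) →
        ∃ C : ℝ≥0, OscillatoryPotential.BoundedBy n α p q C) := by
  have hn3 : (3 : ℝ) ≤ n := by exact_mod_cast hn
  have hn0 : (0 : ℝ) < n := by linarith
  have hdim : (Module.finrank ℝ (EuclideanSpace ℝ (Fin n)) : ℝ) = n := by simp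
  refine ⟨fun hα => ?_, fun hα p q _ _ hpq => ?_⟩
  · obtain ⟨C, hC, h⟩ := OscillatoryPotential.formBound_powKernel_of_half_lt
      (V := EuclideanSpace ℝ (Fin n)) (b := n - α) (by rw [hdim]; exact hn3)
      (by rw [hdim]; linarith) (by rw [hdim]; linarith)
    refine ⟨C.toNNReal, fun p q _ _ hpq => ?_⟩
    obtain ⟨a, c, ha, hc, hac, hp⟩ := hpq
    simp only [OscillatoryPotential.exponentPoint, OscillatoryPotential.pointP,
      OscillatoryPotential.pointP', Prod.smul_mk, Prod.mk_add_mk, smul_eq_mul, Prod.mk.injEq] at hp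
    obtain ⟨hpx, hqy⟩ := hp
    obtain rfl : c = 1 - a := by linarith
    -- In terms of σ, P = (1/2 + 2σ, 1/2) and P' = (1/2, 1/2 - 2σ), the two endpoints of the core
    -- bound. The weight `a` of P' serves as θ.
    set σ := (α - ((n : ℝ) - 1) / 2) / (n + 1) with hσ
    have hσ0 : 0 < σ := div_pos (by linarith) (by linarith)
    have hσ1 : σ < 1 / 8 := by rw [hσ, div_lt_iff₀ (by linarith)]; linarith
    have e1 : (4 * α - n + 3) / (2 * n + 2) = 1 / 2 + 2 * σ := by rw [hσ]; field_simp; ring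
    have e2 : (3 * n - 4 * α - 1) / (2 * n + 2) = 1 / 2 - 2 * σ := by rw [hσ]; field_simp; ring
    have e3 : 2 * (((n : ℝ) + 1) / 2 - (n - α)) / (n + 1) = 2 * σ := by rw [hσ]; field_simp; ring
    have hαn : α / n < 1 / 2 := by rw [div_lt_iff₀ hn0]; linarith
    have hcσ := mul_pos hc hσ0
    have haσ := mul_pos ha hσ0
    rw [e1] at hpx
    rw [e2] at hqy
    have hx := h a ha.le (by linarith)
    rw [hdim, e3] at hx
    refine OscillatoryPotential.boundedBy_of_formBound (by omega) (by linarith) hα₂ ?_ ?_ ?_ ?_ hC ?_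
    · linarith
    · linarith
    · linarith
    · linarith
    · convert hx using 1
      · linarith
      · linarith
  · obtain ⟨a, c, ha, hc, hac, hp⟩ := hpq
    simp only [OscillatoryPotential.exponentPoint, OscillatoryPotential.pointB,
      OscillatoryPotential.pointB', Prod.smul_mk, Prod.mk_add_mk, smul_eq_mul, Prod.mk.injEq] at hp
    obtain ⟨hpx, hqy⟩ := hp
    obtain rfl : c = 1 - a := by linarith
    -- Now B = (1-v, u) and B' = (1-u, v) with v < u, so on the open segment 1 - 1/p and 1/q lie
    -- strictly below u = b/n and add up to u + v = 2b/(n+1).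
    set u := ((n : ℝ) - α) / n with hu
    set v := ((n : ℝ) - 1) * (n - α) / (n * (n + 1)) with hv
    have hu0 : 0 < u := div_pos (by linarith) hn0
    have hv0 : 0 < v := div_pos (mul_pos (by linarith) (by linarith)) (by positivity)
    have e1 : α / n = 1 - u := by rw [hu]; field_simp; ring
    have e2 : u + v = 2 * (n - α) / (n + 1) := by rw [hu, hv]; field_simp; ring
    have e3 : v < u := by
      have : v * (n + 1) = u * (n - 1) := by rw [hu, hv]; field_simp
      nlinarith
    have hu1 : u ≤ 1 / 2 := by rw [hu, div_le_iff₀ hn0]; linarith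
    have hau := mul_pos ha (sub_pos.2 e3)
    have hcu := mul_pos hc (sub_pos.2 e3)
    rw [e1] at hpx hqy
    obtain ⟨C, hC, h⟩ := OscillatoryPotential.formBound_powKernel_of_le_half
      (V := EuclideanSpace ℝ (Fin n)) (b := n - α) (x := (p⁻¹).toReal) (y := 1 - (q⁻¹).toReal)
      (by rw [hdim]; exact hn3) (by linarith) (by rw [hdim]; linarith)
      (by rw [hdim, ← e2]; linarith) (by rw [hdim, ← hu]; linarith) (by rw [hdim, ← hu]; linarith)
    refine ⟨C.toNNReal, OscillatoryPotential.boundedBy_of_formBound (by omega) (by linarith) hα₂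
      ?_ ?_ ?_ ?_ hC h⟩
    · rw [e1]; linarith
    · linarith
    · linarith
    · linarith
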